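/- Let $n\ge 3$ and $d$ be integers with $0<d<n$, let $p=n/d$ and $\frac1p+\frac1{p'}=1$, let $\Omega\subseteq\mathbb R^n$ be open and bounded, and let $\nu$ be a positive Borel measure on $\Omega$ for which there are $\lambda\in(0,n]$, $C_0$ and $r_0>0$ with $$\nu\big(B(x,r)\cap\Omega\big)\le C_0\,r^\lambda\qquad\text{for all }x\in\mathbb R^n,\ 0<r\le r_0 .$$ Let $W_0^{d,p}(\Omega)$ be the closure of $C_c^\infty(\Omega)$ in the (real) Sobolev space $W^{d,p}(\mathbb R^n)$, let $\Delta=-\sum_i\partial_i^2$ be the positive Laplacian, let $\|\cdot\|_p$ be the norm of $L^p(\Omega)$ with respect to Lebesgue measure, let $\omega_{n-1}$ be the surface measure of the unit sphere of $\mathbb R^n$, and let $$c_s=\frac{\Gamma\big(\frac{n-s}2\big)}{2^s\pi^{n/2}\Gamma\big(\frac s2\big)},\qquad c_{d+1}(n-d-1)=\frac{2\,\Gamma\big(\frac{n-d+1}2\big)}{2^{d+1}\pi^{n/2}\,\Gamma\big(\frac{d+1}2\big)},$$ where the right-hand side of the second formula is the definition of the left-hand side when $d=n-1$ (it is the limit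 of $c_{s+1}(n-s-1)$ as $s\to n-1$). For $u\in W_0^{d,p}(\Omega)$ let $u(x)$ denote the precise value $\lim_{r\to0^+}\frac1{|B(x,r)|}\int_{B(x,r)}u(y)\,dy$. Then this limit exists for $\nu$-almost every $x\in\Omega$, for every $u\in W_0^{d,p}(\Omega)$, and (with $0/0=0$) there is a constant $C$, independent of $u$, such that for all $u\in W_0^{d,p}(\Omega)$ $$\int_\Omega \exp\bigg[\frac{\lambda\,c_d^{-p'}}{\omega_{n-1}}\bigg(\frac{|u(x)|}{\|\Delta^{d/2}u\|_p}\bigg)^{p'}\bigg]d\nu(x)\le C\qquad\text{if } d\text{ is even},$$ $$\int_\Omega \exp\bigg[\frac{\lambda}{\omega_{n-1}}\big(c_{d+1}(n-d-1)\big)^{-p'}\bigg(\frac{|u(x)|}{\|\nabla\Delta^{\frac{d-1}2}u\|_p}\bigg)^{p'}\bigg]d\nu(x)\le C\qquad\text{if } d\text{ is odd}.$$ Moreover, if there are $x_0\in\Omega$ and $C_1,r_1>0$ such that $\nu\big(B(x_0,r)\cap\Omega\big)\ge C_1r^\lambda$ for $0<r\le r_1$, then the constants $\lambda c_d^{-p'}/\omega_{n-1}$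 ($d$ even) and $\lambda\big(c_{d+1}(n-d-1)\big)^{-p'}/\omega_{n-1}$ ($d$ odd) are sharp: if either is replaced by a larger number, then the corresponding inequality does not hold for all $u\in W_0^{d,p}(\Omega)$ with any finite constant $C$. -/

import Mathlib

open MeasureTheory Set Filter Topology Metric
open scoped ENNReal ContDiff

noncomputable section

/-- Euclidean space `ℝⁿ`. -/
abbrev E (n : ℕ) : Type := EuclideanSpace ℝ (Fin n)

/-- `C_c^∞(U)`: smooth functions with compact support contained in `U`. -/
def IsTestFunction {n : ℕ} (U : Set (E n)) (φ : E n → ℝ) : Prop :=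
  ContDiff ℝ ∞ φ ∧ HasCompactSupport φ ∧ tsupport φ ⊆ U

/-- The classical iterated partial derivative `∂_{s 0} ⋯ ∂_{s (k-1)} φ` of a smooth function. -/
def partialDeriv {n k : ℕ} (s : Fin k → Fin n) (φ : E n → ℝ) (x : E n) : ℝ :=
  iteratedFDeriv ℝ k φ x (fun j => EuclideanSpace.single (s j) (1 : ℝ))

/-- `v` is the weak derivative `∂_{s 0} ⋯ ∂_{s (k-1)} u` on `ℝⁿ`. -/
def HasWeakPartial {n k : ℕ} (s : Fin k → Fin n) (u v : E n → ℝ) : Prop :=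
  LocallyIntegrable u volume ∧ LocallyIntegrable v volume ∧
    ∀ φ : E n → ℝ, IsTestFunction univ φ →
      ∫ x, u x * partialDeriv s φ x = (-1) ^ k * ∫ x, v x * φ x

open Classical in
/-- The weak derivative `∂_{s 0} ⋯ ∂_{s (k-1)} u` (determined almost everywhere); it is `0` by
convention when `u` has no such weak derivative. -/
def weakPartial {n k : ℕ} (s : Fin k → Fin n) (u : E n → ℝ) : E n → ℝ :=
  if h : ∃ v, HasWeakPartial s u v then h.choose else 0

/-- `u ∈ W^{d,p}(ℝⁿ)`: all weak derivatives of order at most `d` exist and belong to `L^p`. -/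
def MemSobolev {n : ℕ} (d : ℕ) (p : ℝ≥0∞) (u : E n → ℝ) : Prop :=
  MemLp u p volume ∧ ∀ k ≤ d, ∀ s : Fin k → Fin n, ∃ v, HasWeakPartial s u v ∧ MemLp v p volume

/-- The norm of `W^{d,p}(ℝⁿ)`: the sum of the `L^p` norms of all derivatives of order at most `d`
(the term `k = 0` is `‖u‖_p`). -/
def sobolevNorm {n : ℕ} (d : ℕ) (p : ℝ≥0∞) (u : E n → ℝ) : ℝ≥0∞ :=
  ∑ k ∈ Finset.range (d + 1), ∑ s : Fin k → Fin n, eLpNorm (weakPartial s u) p volume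

/-- `u ∈ W₀^{d,p}(Ω)`: the closure of `C_c^∞(Ω)` in `W^{d,p}(ℝⁿ)`. -/
def MemSobolevZero {n : ℕ} (Ω : Set (E n)) (d : ℕ) (p : ℝ≥0∞) (u : E n → ℝ) : Prop :=
  MemSobolev d p u ∧
    ∀ ε : ℝ≥0∞, 0 < ε → ∃ φ, IsTestFunction Ω φ ∧ sobolevNorm d p (u - φ) < ε

/-- The positive Laplacian `Δ u = -∑ᵢ ∂ᵢ∂ᵢ u`, in the weak sense. -/
def posLaplacian {n : ℕ} (u : E n → ℝ) : E n → ℝ :=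
  fun x => -∑ i : Fin n, weakPartial ![i, i] u x

/-- The gradient `∇ u`, in the weak sense. -/
def weakGradient {n : ℕ} (u : E n → ℝ) : E n → E n :=
  fun x => WithLp.toLp 2 (fun i : Fin n => weakPartial ![i] u x)

/-- The norm `‖f‖_p` of `L^p(Ω)` with respect to Lebesgue measure, as a real number; for a
vector field, `|f|` is the Euclidean length. -/
def lpNormOn {n : ℕ} {F : Type*} [NormedAddCommGroup F] (Ω : Set (E n)) (p : ℝ≥0∞)
    (f : E n → F) : ℝ :=
  (eLpNorm f p (volume.restrict Ω)).toReal

/-- The average of `u` over the ball `B(x,r)`, with respect to Lebesgue measure. -/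
def ballAverage {n : ℕ} (u : E n → ℝ) (x : E n) (r : ℝ) : ℝ :=
  ⨍ y in ball x r, u y

/-- The precise representative of `u`: `lim_{r → 0+} ⨍_{B(x,r)} u`, wherever this limit exists. -/
def preciseRep {n : ℕ} (u : E n → ℝ) (x : E n) : ℝ :=
  limUnder (𝓝[>] (0 : ℝ)) (ballAverage u x)

/-- The surface measure `ω_{n-1}` of the unit sphere of `ℝⁿ`. -/
def sphereArea (n : ℕ) : ℝ :=
  (volume : Measure (E n)).toSphere.real univ

/-- The constant `c_d = Γ((n-d)/2) / (2^d π^{n/2} Γ(d/2))` of the Riesz potential. -/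
def rieszConst (n : ℕ) (d : ℝ) : ℝ :=
  Real.Gamma ((n - d) / 2) / (2 ^ d * Real.pi ^ ((n : ℝ) / 2) * Real.Gamma (d / 2))

/-- The constant `c_{d+1} (n-d-1)`, in the form
`2 Γ((n-d+1)/2) / (2^{d+1} π^{n/2} Γ((d+1)/2))`, which is also meaningful for `d = n - 1`, where
`c_{d+1}` has a pole and the factor `n-d-1` vanishes; see `gradRieszConst_eq` and
`tendsto_gradRieszConst`. -/
def gradRieszConst (n : ℕ) (d : ℝ) : ℝ :=
  2 * Real.Gamma ((n - d + 1) / 2) /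
    (2 ^ (d + 1) * Real.pi ^ ((n : ℝ) / 2) * Real.Gamma ((d + 1) / 2))

theorem gradRieszConst_eq (n : ℕ) (d : ℝ) (h : d ≠ n - 1) :
    gradRieszConst n d = rieszConst n (d + 1) * (n - d - 1) := by
  have h0 : ((n : ℝ) - (d + 1)) / 2 ≠ 0 := by
    intro h1
    apply h
    linarith
  have h2 : Real.Gamma (((n : ℝ) - d + 1) / 2) =
      ((n - (d + 1)) / 2) * Real.Gamma ((n - (d + 1)) / 2) := by
    rw [← Real.Gamma_add_one h0]
    congr 1
    ring
  unfold gradRieszConst rieszConst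
  rw [h2]
  ring

/-- At `d = n - 1` the constant is the limit of `c_{s+1} (n-s-1)` as `s → d`. -/
theorem tendsto_gradRieszConst (n : ℕ) (hn : 1 ≤ n) :
    Tendsto (fun s : ℝ => rieszConst n (s + 1) * (n - s - 1)) (𝓝[≠] ((n : ℝ) - 1))
      (𝓝 (gradRieszConst n (n - 1))) := by
  have hn' : (0 : ℝ) < n := by exact_mod_cast hn
  have hG : ∀ y : ℝ, 0 < y → ContinuousAt Real.Gamma y := fun y hy =>
    (Real.differentiableAt_Gamma fun m => by
      have : (0 : ℝ) ≤ m := Nat.cast_nonneg m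
      linarith).continuousAt
  have hc : ContinuousAt (gradRieszConst n) ((n : ℝ) - 1) := by
    unfold gradRieszConst
    have e1 : ContinuousAt (fun d : ℝ => Real.Gamma (((n : ℝ) - d + 1) / 2)) ((n : ℝ) - 1) :=
      ContinuousAt.comp (g := Real.Gamma) (hG _ (by linarith)) (by fun_prop)
    have e2 : ContinuousAt (fun d : ℝ => Real.Gamma ((d + 1) / 2)) ((n : ℝ) - 1) :=
      ContinuousAt.comp (g := Real.Gamma) (hG _ (by linarith)) (by fun_prop)
    have e3 : ContinuousAt (fun d : ℝ => (2 : ℝ) ^ (d + 1)) ((n : ℝ) - 1) :=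
      ContinuousAt.comp (g := fun y : ℝ => (2 : ℝ) ^ y)
        (Real.continuousAt_const_rpow (by norm_num)) (by fun_prop)
    refine (continuousAt_const.mul e1).div ((e3.mul continuousAt_const).mul e2) ?_
    have g1 : 0 < Real.Gamma (((n : ℝ) - 1 + 1) / 2) := Real.Gamma_pos_of_pos (by linarith)
    have g2 : 0 < Real.pi ^ ((n : ℝ) / 2) := Real.rpow_pos_of_pos Real.pi_pos _
    positivity
  refine (hc.tendsto.mono_left nhdsWithin_le_nhds).congr' ?_
  filter_upwards [self_mem_nhdsWithin] with s hs
  exact gradRieszConst_eq n s hs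

/-- The exponential integral `∫_Ω exp[α (|u| / N)^q] dν`, with `u` evaluated through its precise
representative. -/
def expIntegral {n : ℕ} (Ω : Set (E n)) (ν : Measure (E n)) (α q : ℝ) (u : E n → ℝ) (N : ℝ) :
    ℝ≥0∞ :=
  ∫⁻ x in Ω, ENNReal.ofReal (Real.exp (α * (|preciseRep u x| / N) ^ q)) ∂ν

end

noncomputable section

theorem holder_two {p q : ℝ} (hpq : q.HolderConjugate p) {a b x y : ℝ}
    (ha : 0 ≤ a) (hb : 0 ≤ b) (hx : 0 ≤ x) (hy : 0 ≤ y) :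
    a ^ (1 / q) * x ^ (1 / p) + b ^ (1 / q) * y ^ (1 / p) ≤
      (a + b) ^ (1 / q) * (x + y) ^ (1 / p) := by
  have hq0 : q ≠ 0 := hpq.ne_zero
  have hp0 : p ≠ 0 := hpq.symm.ne_zero
  have h := Real.inner_le_Lp_mul_Lq_of_nonneg Finset.univ hpq
    (f := ![a ^ (1 / q), b ^ (1 / q)]) (g := ![x ^ (1 / p), y ^ (1 / p)])
    (by intro i _; fin_cases i <;> simp <;> positivity)
    (by intro i _; fin_cases i <;> simp <;> positivity)
  simp only [Fin.sum_univ_two, Matrix.cons_val_zero, Matrix.cons_val_one] at h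
  rw [← Real.rpow_mul ha, ← Real.rpow_mul hb, ← Real.rpow_mul hx, ← Real.rpow_mul hy] at h
  rw [one_div_mul_cancel hq0, one_div_mul_cancel hp0] at h
  simpa using h

theorem holder_three {p q : ℝ} (hpq : q.HolderConjugate p) {a b c x y z : ℝ}
    (ha : 0 ≤ a) (hb : 0 ≤ b) (hc : 0 ≤ c) (hx : 0 ≤ x) (hy : 0 ≤ y) (hz : 0 ≤ z) :
    a ^ (1 / q) * x ^ (1 / p) + b ^ (1 / q) * y ^ (1 / p) + c ^ (1 / q) * z ^ (1 / p) ≤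
      (a + b + c) ^ (1 / q) * (x + y + z) ^ (1 / p) := by
  have h1 := holder_two hpq ha hb hx hy
  have h2 := holder_two hpq (add_nonneg ha hb) hc (add_nonneg hx hy) hz
  linarith

/-- Raise an inequality between `q`-th roots to the power `q`. -/
theorem le_mul_rpow_of_root_le {p q : ℝ} (hpq : q.HolderConjugate p) {k A X : ℝ}
    (hk : 0 ≤ k) (hA : 0 ≤ A) (hX : 0 ≤ X) (h : k ^ (1 / q) ≤ A ^ (1 / q) * X ^ (1 / p)) :
    k ≤ A * X ^ (q / p) := by
  have hq0 : q ≠ 0 := hpq.ne_zero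
  have h1 := Real.rpow_le_rpow (by positivity) h hpq.nonneg
  rw [Real.mul_rpow (by positivity) (by positivity), ← Real.rpow_mul hk, ← Real.rpow_mul hA,
    ← Real.rpow_mul hX, one_div_mul_cancel hq0, Real.rpow_one, Real.rpow_one] at h1
  convert h1 using 3
  ring

theorem one_add_rpow_le {e x : ℝ} (he : 0 ≤ e) (hx : 0 ≤ x) (hx1 : x ≤ 1) :
    (1 + x) ^ e ≤ 1 + 2 ^ e * x := by
  rcases le_total e 1 with h | h
  · have h1 := rpow_one_add_le_one_add_mul_self (s := x) (by linarith) he h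
    have h2 : (1 : ℝ) ≤ 2 ^ e := Real.one_le_rpow (by norm_num) he
    nlinarith
  · have h1 := (convexOn_rpow h).2 (show (1:ℝ) ∈ Ici 0 by simp) (show (2:ℝ) ∈ Ici 0 by simp)
      (show 0 ≤ 1 - x by linarith) hx (by ring)
    simp only [smul_eq_mul, Real.one_rpow] at h1
    have h3 : (1 - x) * 1 + x * 2 = 1 + x := by ring
    rw [h3] at h1
    linarith

theorem one_sub_rpow_le {e x : ℝ} (he : 0 ≤ e) (hx : 0 ≤ x) (hx1 : x ≤ 1) :
    (1 - x) ^ e ≤ 1 - min e 1 * x := by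
  have h0 : (1 - x) ^ e ≤ (1 - x) ^ (min e 1) := by
    rcases hx1.eq_or_lt with rfl | h
    · rcases he.eq_or_lt with rfl | h
      · simp
      · rw [sub_self, Real.zero_rpow h.ne', Real.zero_rpow (by positivity)]
    · exact Real.rpow_le_rpow_of_exponent_ge (by linarith) (by linarith) (min_le_left _ _)
  refine h0.trans ?_
  have := rpow_one_add_le_one_add_mul_self (s := -x) (p := min e 1) (by linarith)
    (by positivity) (min_le_right _ _)
  have h2 : (1 : ℝ) + -x = 1 - x := by ring
  rw [h2] at this
  linarith


theorem index_le {p q : ℝ} (hpq : q.HolderConjugate p) {k T l b : ℝ} (hk : 0 ≤ k) (hT : 0 ≤ T)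
    (hl : 0 ≤ l) (hl1 : l ≤ 1) (hb : 0 ≤ b)
    (h : k ^ (1 / q) ≤ T ^ (1 / q) * (1 - l) ^ (1 / p) + b * l ^ (1 / p)) :
    k ≤ T + b ^ q := by
  have e : b = (b ^ q) ^ (1 / q) := by
    rw [← Real.rpow_mul hb, mul_one_div_cancel hpq.ne_zero, Real.rpow_one]
  have h1 := holder_two hpq hT (Real.rpow_nonneg hb q) (sub_nonneg.2 hl1) hl
  rw [← e] at h1
  have h2 := le_mul_rpow_of_root_le hpq hk (by positivity) (by linarith) (h.trans h1)
  simpa using h2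

theorem index_gain {p q : ℝ} (hpq : q.HolderConjugate p) {k T l b : ℝ} (hk : 0 ≤ k) (hT : 0 ≤ T)
    (hl : 0 ≤ l) (hl1 : l ≤ 1) (hb : 0 ≤ b)
    (h : k ^ (1 / q) ≤ T ^ (1 / q) * (1 - l) ^ (1 / p) + b * l ^ (1 / p)) :
    T * l * (min (q / p) 1 / 2) ≤ T - k + 2 ^ (q / p) * b ^ q := by
  have hp0 : 0 < p := hpq.symm.pos
  have hq0 : 0 < q := hpq.pos
  have e : b * l ^ (1 / p) = (2 ^ (q / p) * b ^ q) ^ (1 / q) * (l / 2) ^ (1 / p) := by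
    rw [Real.mul_rpow (by positivity) (by positivity), ← Real.rpow_mul hb, ← Real.rpow_mul
      (by norm_num), mul_one_div_cancel hq0.ne', Real.rpow_one, Real.div_rpow hl (by norm_num)]
    have : q / p * (1 / q) = 1 / p := by field_simp
    rw [this]
    have : (0 : ℝ) < 2 ^ (1 / p) := by positivity
    field_simp
  rw [e] at h
  have h1 := holder_two hpq hT (by positivity : 0 ≤ 2 ^ (q / p) * b ^ q) (sub_nonneg.2 hl1)
    (by positivity : 0 ≤ l / 2)
  have h2 := le_mul_rpow_of_root_le hpq hk (by positivity) (by linarith) (h.trans h1)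
  have h3 : (1 - l + l / 2) ^ (q / p) ≤ 1 - min (q / p) 1 * (l / 2) := by
    have := one_sub_rpow_le (e := q / p) (x := l / 2) (by positivity) (by positivity) (by linarith)
    convert this using 2
    ring
  have h4 := mul_le_mul_of_nonneg_left h3 (by positivity : 0 ≤ T + 2 ^ (q / p) * b ^ q)
  have h5 : 0 ≤ 2 ^ (q / p) * b ^ q * (min (q / p) 1 * (l / 2)) := by positivity
  nlinarith

theorem index_two {p q : ℝ} (hpq : q.HolderConjugate p) {k S D l m b ε : ℝ} (hk : 0 ≤ k)
    (hS : 0 ≤ S) (hD : 0 ≤ D) (hl : 0 ≤ l) (hm : 0 ≤ m) (hb : 0 ≤ b) (hε : 0 < ε)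
    (h : k ^ (1 / q) ≤ S ^ (1 / q) + D ^ (1 / q) * l ^ (1 / p) + b * m ^ (1 / p)) :
    k ≤ (S + ε * D + b ^ q) * (1 + ε ^ (-(p / q)) * l + m) ^ (q / p) := by
  have hp0 : 0 < p := hpq.symm.pos
  have hq0 : 0 < q := hpq.pos
  have e : b = (b ^ q) ^ (1 / q) := by
    rw [← Real.rpow_mul hb, mul_one_div_cancel hpq.ne_zero, Real.rpow_one]
  have e2 : D ^ (1 / q) * l ^ (1 / p) = (ε * D) ^ (1 / q) * (ε ^ (-(p / q)) * l) ^ (1 / p) := by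
    rw [Real.mul_rpow hε.le hD, Real.mul_rpow (by positivity) hl, ← Real.rpow_mul hε.le]
    have : -(p / q) * (1 / p) = - (1 / q) := by field_simp
    rw [this, Real.rpow_neg hε.le]
    have : 0 < ε ^ (1 / q) := by positivity
    field_simp
  have h1 := holder_three hpq hS (by positivity : 0 ≤ ε * D) (Real.rpow_nonneg hb q)
    zero_le_one (by positivity : 0 ≤ ε ^ (-(p / q)) * l) hm
  rw [← e, ← e2, Real.one_rpow, mul_one] at h1
  exact le_mul_rpow_of_root_le hpq hk (by positivity) (by positivity) (h.trans h1)

theorem Finset.card_le_of_window (F : Finset ℕ) {a w : ℝ} (ha : 0 ≤ a) (hw : 0 ≤ w)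
    (h : ∀ j ∈ F, ∀ k ∈ F, j < k → a ≤ j → (k : ℝ) ≤ j + w) : (F.card : ℝ) ≤ a + w + 2 := by
  classical
  have h1 : ((F.filter fun j : ℕ => (j : ℝ) < a).card : ℝ) ≤ a + 1 := by
    have : F.filter (fun j : ℕ => (j : ℝ) < a) ⊆ Finset.range ⌈a⌉₊ := by
      intro j hj
      simp only [Finset.mem_filter] at hj
      exact Finset.mem_range.2 (Nat.lt_ceil.2 hj.2)
    have h2 := Finset.card_le_card this
    rw [Finset.card_range] at h2
    have := Nat.ceil_lt_add_one ha
    have h3 : ((F.filter fun j : ℕ => (j : ℝ) < a).card : ℝ) ≤ (⌈a⌉₊ : ℝ) := by exact_mod_cast h2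
    linarith
  have h2 : ((F.filter fun j : ℕ => ¬ (j : ℝ) < a).card : ℝ) ≤ w + 1 := by
    rcases (F.filter fun j : ℕ => ¬ (j : ℝ) < a).eq_empty_or_nonempty with h0 | h0
    · rw [h0]
      simp
      linarith
    · set j := (F.filter fun j : ℕ => ¬ (j : ℝ) < a).min' h0 with hj
      have hjm := Finset.min'_mem _ h0
      rw [← hj, Finset.mem_filter] at hjm
      have : F.filter (fun j : ℕ => ¬ (j : ℝ) < a) ⊆ Finset.Icc j (j + ⌊w⌋₊) := by
        intro k hk
        have hjk : j ≤ k := Finset.min'_le _ _ hk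
        rw [Finset.mem_filter] at hk
        rw [Finset.mem_Icc]
        refine ⟨hjk, ?_⟩
        rcases hjk.eq_or_lt with h4 | h4
        · omega
        · have := h j hjm.1 k hk.1 h4 (not_lt.1 hjm.2)
          have h5 : ((k - j : ℕ) : ℝ) ≤ w := by
            rw [Nat.cast_sub hjk]
            linarith
          have := Nat.le_floor h5
          omega
      have h3 := Finset.card_le_card this
      rw [Nat.card_Icc] at h3
      have h4 : ((F.filter fun j : ℕ => ¬ (j : ℝ) < a).card : ℝ) ≤ (⌊w⌋₊ : ℝ) + 1 := by
        have h6 : (F.filter fun j : ℕ => ¬ (j : ℝ) < a).card ≤ ⌊w⌋₊ + 1 := by omega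
        exact_mod_cast h6
      have := Nat.floor_le hw
      linarith
  have h3 := Finset.card_filter_add_card_filter_not (s := F) (fun j : ℕ => (j : ℝ) < a)
  have h4 : (F.card : ℝ) = ((F.filter fun j : ℕ => (j : ℝ) < a).card : ℝ) +
      ((F.filter fun j : ℕ => ¬ (j : ℝ) < a).card : ℝ) := by
    exact_mod_cast h3.symm
  linarith

/-- The discrete form of the one-dimensional lemma of Adams and Garsia. -/
theorem adams_garsia {p q : ℝ} (hpq : q.HolderConjugate p) {b lam : ℝ} (hb : 0 ≤ b)
    (hlam : 0 < lam) :
    ∃ C : ℝ, ∀ (K : Finset ℕ) (T l : ℕ → ℝ), (∀ j ∈ K, ∀ k ∈ K, j ≤ k → T j ≤ T k) →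
      (∀ k ∈ K, 0 < T k) → (∀ k ∈ K, 0 ≤ l k ∧ l k ≤ 1) →
      (∀ k ∈ K, (k : ℝ) ^ (1 / q) ≤
        T k ^ (1 / q) * (1 - l k) ^ (1 / p) + b * l k ^ (1 / p)) →
      (∀ j ∈ K, ∀ k ∈ K, j < k → (k : ℝ) ^ (1 / q) ≤
        T j ^ (1 / q) + (T k - T j) ^ (1 / q) * l j ^ (1 / p) + b * l k ^ (1 / p)) →
      ∑ k ∈ K, Real.exp (-lam * (T k - k)) ≤ C := by
  classical
  have hp0 : 0 < p := hpq.symm.pos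
  have hq0 : 0 < q := hpq.pos
  set e := q / p with he
  have he0 : 0 < e := by positivity
  set β := b ^ q with hβ
  have hβ0 : 0 ≤ β := by positivity
  set C₁ := (1 + 2 ^ e * β) / (min e 1 / 2) with hC₁
  have hC₁0 : 0 < C₁ := by positivity
  set A : ℝ := 1 + 2 ^ e with hA
  have hA0 : 0 < A := by positivity
  set ε := 1 / (2 * A) with hε
  have hε0 : 0 < ε := by positivity
  set c := ε ^ (-(p / q)) + 1 with hc
  have hc0 : 0 < c := by positivity
  set c' := 2 ^ e * (c * C₁) with hc'
  have hc'0 : 0 < c' := by positivity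
  set C₃ := c * C₁ + β with hC₃
  set C₄ := 2 + 2 * c' + 2 * β * A with hC₄
  set C₅ := C₃ + C₄ + 2 with hC₅
  have hC₃0 : 0 < C₃ := by positivity
  have hC₄0 : 0 < C₄ := by positivity
  have hsum : Summable fun s : ℕ => C₅ * (1 + s) * Real.exp (-lam * s) := by
    have h1 : Summable fun s : ℕ => (s : ℝ) ^ 1 * Real.exp (-lam * s) := by
      have := Real.summable_pow_mul_exp_neg_nat_mul 1 hlam
      exact this
    have h0 : Summable fun s : ℕ => (s : ℝ) ^ 0 * Real.exp (-lam * s) :=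
      Real.summable_pow_mul_exp_neg_nat_mul 0 hlam
    refine ((h0.add h1).mul_left C₅).congr ?_
    intro s
    ring
  refine ⟨Real.exp (lam * (1 + β)) * ∑' s : ℕ, C₅ * (1 + s) * Real.exp (-lam * s), ?_⟩
  intro K T l hmono hTpos hl h1 h2
  have hkT : ∀ k ∈ K, (k : ℝ) ≤ T k + β := fun k hk =>
    index_le hpq (Nat.cast_nonneg k) (hTpos k hk).le (hl k hk).1 (hl k hk).2 hb (h1 k hk)
  have hgain : ∀ k ∈ K, ∀ s : ℝ, 0 ≤ s → T k ≤ k + s → T k * l k ≤ C₁ * (1 + s) := by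
    intro k hk s hs hTs
    have := index_gain hpq (Nat.cast_nonneg k) (hTpos k hk).le (hl k hk).1 (hl k hk).2 hb (h1 k hk)
    have h3 : T k * l k * (min e 1 / 2) ≤ (1 + 2 ^ e * β) * (1 + s) := by
      have : 0 ≤ 2 ^ e * β * s := by positivity
      nlinarith
    have h4 : 0 < min e 1 / 2 := by positivity
    rw [hC₁, div_mul_eq_mul_div, le_div_iff₀ h4]
    exact h3
  have hwin : ∀ s : ℝ, 0 ≤ s → ∀ j ∈ K, ∀ k ∈ K, j < k → T j ≤ j + s → T k ≤ k + s →
      C₃ * (1 + s) ≤ j → (k : ℝ) ≤ j + C₄ * (1 + s) := by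
    intro s hs j hj k hk hjk hTj hTk hjs
    have hS := hTpos j hj
    have hSk := hTpos k hk
    have hD : 0 ≤ T k - T j := sub_nonneg.2 (hmono j hj k hk hjk.le)
    have h3 := index_two hpq (Nat.cast_nonneg k) hS.le hD (hl j hj).1 (hl k hk).1 hb hε0
      (h2 j hj k hk hjk)
    set x := ε ^ (-(p / q)) * l j + l k with hx
    have hx0 : 0 ≤ x := by
      have := (hl j hj).1
      have := (hl k hk).1
      positivity
    have hlk := hgain k hk s hs hTk
    have hlj := hgain j hj s hs hTj
    have hSx : T j * x ≤ c * C₁ * (1 + s) := by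
      have h4 : T j * l k ≤ C₁ * (1 + s) :=
        (mul_le_mul_of_nonneg_right (sub_nonneg.1 hD) (hl k hk).1).trans hlk
      have h5 := mul_le_mul_of_nonneg_left hlj (by positivity : 0 ≤ ε ^ (-(p / q)))
      have h6 : T j * x = ε ^ (-(p / q)) * (T j * l j) + T j * l k := by
        rw [hx]
        ring
      have h7 : c * C₁ * (1 + s) = ε ^ (-(p / q)) * (C₁ * (1 + s)) + C₁ * (1 + s) := by
        rw [hc]
        ring
      linarith
    have hSC : c * C₁ * (1 + s) ≤ T j := by
      have := hkT j hj
      have h6 : 0 ≤ β * s := by positivity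
      rw [hC₃, add_mul] at hjs
      linarith
    have hx1 : x ≤ 1 := by
      by_contra hcon
      push Not at hcon
      have := mul_lt_mul_of_pos_left hcon hS
      linarith
    have h7 := one_add_rpow_le he0.le hx0 hx1
    have h8 : (k : ℝ) ≤ (T j + ε * (T k - T j) + β) * (1 + 2 ^ e * x) := by
      refine h3.trans (mul_le_mul_of_nonneg_left ?_ (by positivity))
      rw [hx] at h7
      rw [add_assoc]
      exact h7
    have h9 : (ε * (T k - T j) + β) * (1 + 2 ^ e * x) ≤ (ε * (T k - T j) + β) * A := by
      refine mul_le_mul_of_nonneg_left ?_ (by positivity)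
      have : (0 : ℝ) < 2 ^ e := by positivity
      have := mul_le_mul_of_nonneg_left hx1 this.le
      rw [hA]
      linarith
    have h10 : ε * A = 1 / 2 := by
      rw [hε]
      field_simp
    have h11 : T j * (2 ^ e * x) ≤ c' * (1 + s) := by
      have := mul_le_mul_of_nonneg_left hSx (by positivity : (0 : ℝ) ≤ 2 ^ e)
      rw [hc', mul_assoc (2 ^ e) (c * C₁) (1 + s)]
      linarith
    have h12 : (ε * (T k - T j) + β) * A = (T k - T j) / 2 + β * A := by
      rw [add_mul, mul_right_comm, h10]
      ring
    have h13 : 0 ≤ β * A * s := by positivity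
    have h14 : (T j + ε * (T k - T j) + β) * (1 + 2 ^ e * x) =
        T j + T j * (2 ^ e * x) + (ε * (T k - T j) + β) * (1 + 2 ^ e * x) := by ring
    have h15 : C₄ * (1 + s) = 2 + 2 * s + 2 * (c' * (1 + s)) + 2 * (β * A) + 2 * (β * A * s) := by
      rw [hC₄]
      ring
    linarith
  set σ : ℕ → ℕ := fun k => ⌈T k - k⌉₊ with hσ
  have hcard : ∀ s : ℕ, ((K.filter fun k => σ k = s).card : ℝ) ≤ C₅ * (1 + s) := by
    intro s
    have hT : ∀ k ∈ K.filter (fun k => σ k = s), k ∈ K ∧ T k ≤ k + s := by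
      intro k hk
      rw [Finset.mem_filter] at hk
      refine ⟨hk.1, ?_⟩
      have := Nat.le_ceil (T k - k)
      have h3 : (σ k : ℝ) = s := by exact_mod_cast hk.2
      simp only [hσ] at h3
      linarith
    have hs : (0 : ℝ) ≤ s := Nat.cast_nonneg s
    have := Finset.card_le_of_window (K.filter fun k => σ k = s) (a := C₃ * (1 + s))
      (w := C₄ * (1 + s)) (by positivity) (by positivity) (by
        intro j hj k hk hjk haj
        exact hwin s hs j (hT j hj).1 k (hT k hk).1 hjk (hT j hj).2 (hT k hk).2 haj)
    rw [hC₅]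
    nlinarith
  calc ∑ k ∈ K, Real.exp (-lam * (T k - k))
      ≤ ∑ k ∈ K, Real.exp (lam * (1 + β)) * Real.exp (-lam * σ k) := by
        refine Finset.sum_le_sum fun k hk => ?_
        rw [← Real.exp_add, Real.exp_le_exp]
        have h3 : (σ k : ℝ) ≤ T k - k + 1 + β := by
          rcases le_or_gt (T k - k) 0 with h | h
          · have : σ k = 0 := Nat.ceil_eq_zero.2 h
            rw [this]
            have := hkT k hk
            push_cast
            linarith
          · have := Nat.ceil_lt_add_one h.le
            simp only [hσ]
            linarith
        nlinarith
    _ = Real.exp (lam * (1 + β)) * ∑ k ∈ K, Real.exp (-lam * σ k) := by rw [Finset.mul_sum]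
    _ ≤ _ := by
        refine mul_le_mul_of_nonneg_left ?_ (Real.exp_pos _).le
        rw [Finset.sum_comp (fun s : ℕ => Real.exp (-lam * s)) σ]
        refine le_trans (Finset.sum_le_sum fun s _ => ?_) (hsum.sum_le_tsum (K.image σ) ?_)
        · rw [nsmul_eq_mul]
          exact mul_le_mul_of_nonneg_right (hcard s) (Real.exp_pos _).le
        · intro s _
          positivity

/-- The kernel `|z|^{-a}`, with values in `[0, ∞]`. -/
def powKer {n : ℕ} (a : ℝ) (z : E n) : ℝ≥0∞ := ENNReal.ofReal (‖z‖ ^ (-a))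

/-- The part of `|z|^{-a}` in `{|z| < r}`. -/
def nearKer {n : ℕ} (a r : ℝ) : E n → ℝ≥0∞ := (ball 0 r).indicator (powKer a)

/-- The part of `|z|^{-a}` in `{r ≤ |z|}`. -/
def farKer {n : ℕ} (a r : ℝ) : E n → ℝ≥0∞ := (ball 0 r)ᶜ.indicator (powKer a)

/-- The part of `|z|^{-a}` in `{r ≤ |z| < R}`. -/
def annulusKer {n : ℕ} (a r R : ℝ) : E n → ℝ≥0∞ := (ball 0 R \ ball 0 r).indicator (powKer a)

@[fun_prop]
theorem measurable_powKer {n : ℕ} (a : ℝ) : Measurable (powKer a : E n → ℝ≥0∞) := by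
  unfold powKer
  fun_prop

@[fun_prop]
theorem measurable_nearKer {n : ℕ} (a r : ℝ) : Measurable (nearKer a r : E n → ℝ≥0∞) :=
  (measurable_powKer a).indicator measurableSet_ball

@[fun_prop]
theorem measurable_farKer {n : ℕ} (a r : ℝ) : Measurable (farKer a r : E n → ℝ≥0∞) :=
  (measurable_powKer a).indicator measurableSet_ball.compl

@[fun_prop]
theorem measurable_annulusKer {n : ℕ} (a r R : ℝ) :
    Measurable (annulusKer a r R : E n → ℝ≥0∞) :=
  (measurable_powKer a).indicator (measurableSet_ball.diff measurableSet_ball)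

theorem powKer_eq_near_add_far {n : ℕ} (a r : ℝ) (z : E n) :
    powKer a z = nearKer a r z + farKer a r z := by
  unfold nearKer farKer
  by_cases h : z ∈ ball (0 : E n) r
  · simp [h]
  · simp [h]

theorem powKer_neg {n : ℕ} (a : ℝ) (z : E n) : powKer a (-z) = powKer a z := by
  simp [powKer]

theorem nearKer_neg {n : ℕ} (a r : ℝ) (z : E n) : nearKer a r (-z) = nearKer a r z := by
  unfold nearKer
  by_cases h : z ∈ ball (0 : E n) r
  · have h' : -z ∈ ball (0 : E n) r := by simpa using h
    rw [indicator_of_mem h, indicator_of_mem h', powKer_neg]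
  · have h' : -z ∉ ball (0 : E n) r := by simpa using h
    rw [indicator_of_notMem h, indicator_of_notMem h']

theorem powKer_rpow {n : ℕ} {a c : ℝ} (hc : 0 ≤ c) (z : E n) :
    powKer a z ^ c = powKer (a * c) z := by
  unfold powKer
  rw [ENNReal.ofReal_rpow_of_nonneg (by positivity) hc, ← Real.rpow_mul (norm_nonneg _)]
  congr 2
  ring

theorem indicator_powKer_rpow {n : ℕ} {a c : ℝ} (hc : 0 < c) (s : Set (E n)) (z : E n) :
    s.indicator (powKer a) z ^ c = s.indicator (powKer (a * c)) z := by
  by_cases h : z ∈ s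
  · rw [indicator_of_mem h, indicator_of_mem h, powKer_rpow hc.le]
  · rw [indicator_of_notMem h, indicator_of_notMem h, ENNReal.zero_rpow_of_pos hc]

theorem nearKer_rpow {n : ℕ} {a c r : ℝ} (hc : 0 < c) (z : E n) :
    nearKer a r z ^ c = nearKer (a * c) r z := indicator_powKer_rpow hc _ z

theorem annulusKer_rpow {n : ℕ} {a c r R : ℝ} (hc : 0 < c) (z : E n) :
    annulusKer a r R z ^ c = annulusKer (a * c) r R z := indicator_powKer_rpow hc _ z

theorem nearKer_add {n : ℕ} {a b r : ℝ} (h : a + b ≠ 0) (z : E n) :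
    nearKer (a + b) r z ≤ nearKer a r z * nearKer b r z := by
  unfold nearKer
  by_cases hz : z ∈ ball (0 : E n) r
  · rw [indicator_of_mem hz, indicator_of_mem hz, indicator_of_mem hz]
    unfold powKer
    rw [← ENNReal.ofReal_mul (by positivity)]
    rcases eq_or_ne z 0 with rfl | h0
    · rw [norm_zero, Real.zero_rpow (neg_ne_zero.2 h)]
      simp
    · rw [← Real.rpow_add (norm_pos_iff.2 h0), neg_add]
  · rw [indicator_of_notMem hz]
    exact zero_le

/-- Sums of the kernel over dyadic shells. -/
theorem powKer_le_tsum {n : ℕ} {a r : ℝ} (ha : 0 < a) (hr : 0 < r) (z : E n) :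
    nearKer a r z ≤ ∑' j : ℕ, (ball (0 : E n) (2 * ((1 / 2) ^ j * r))).indicator
      (fun _ => ENNReal.ofReal (((1 / 2) ^ (j + 1) * r) ^ (-a))) z := by
  unfold nearKer
  by_cases hz : z ∈ ball (0 : E n) r
  swap
  · rw [indicator_of_notMem hz]
    exact zero_le
  rw [indicator_of_mem hz]
  rcases eq_or_ne z 0 with rfl | h0
  · unfold powKer
    rw [norm_zero, Real.zero_rpow (by simpa using ha.ne')]
    simp
  have hz0 := norm_pos_iff.2 h0
  rw [mem_ball_zero_iff] at hz
  obtain ⟨j, hj1, hj2⟩ := exists_nat_pow_near_of_lt_one (x := ‖z‖ / r) (y := 1 / 2)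
    (by positivity) ((div_le_one hr).2 hz.le) (by norm_num) (by norm_num)
  refine le_trans ?_ (ENNReal.le_tsum j)
  have hmem : z ∈ ball (0 : E n) (2 * ((1 / 2) ^ j * r)) := by
    rw [mem_ball_zero_iff]
    rw [div_le_iff₀ hr] at hj2
    have : 0 < (1 / 2 : ℝ) ^ j * r := by positivity
    linarith
  rw [indicator_of_mem hmem]
  unfold powKer
  apply ENNReal.ofReal_le_ofReal
  rw [lt_div_iff₀ hr] at hj1
  exact Real.rpow_le_rpow_of_nonpos (by positivity) hj1.le (by linarith)

/-- Integrals of `|x - y|^{-a}` over balls for a measure with `μ (B(x, r)) ≤ C r^lam`. -/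
theorem lintegral_nearKer_le {n : ℕ} {μ : Measure (E n)} {C lam a : ℝ} (hC : 0 ≤ C)
    (hμ : ∀ (x : E n) (r : ℝ), 0 < r → μ (ball x r) ≤ ENNReal.ofReal (C * r ^ lam))
    (ha : 0 < a) (hal : a < lam) :
    ∃ C' : ℝ, 0 ≤ C' ∧ ∀ (y : E n) (r : ℝ), 0 < r →
      ∫⁻ x, nearKer a r (x - y) ∂μ ≤ ENNReal.ofReal (C' * r ^ (lam - a)) := by
  set t : ℝ := (1 / 2) ^ (lam - a) with ht
  have ht0 : 0 ≤ t := by positivity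
  have ht1 : t < 1 := Real.rpow_lt_one (by norm_num) (by norm_num) (by linarith)
  set D : ℝ := C * 2 ^ lam * (1 / 2) ^ (-a) with hD
  have hD0 : 0 ≤ D := by positivity
  refine ⟨D * (1 - t)⁻¹, mul_nonneg hD0 (inv_nonneg.2 (by linarith)), fun y r hr => ?_⟩
  calc ∫⁻ x, nearKer a r (x - y) ∂μ
      ≤ ∫⁻ x, ∑' j : ℕ, (ball y (2 * ((1 / 2) ^ j * r))).indicator
          (fun _ => ENNReal.ofReal (((1 / 2) ^ (j + 1) * r) ^ (-a))) x ∂μ := by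
        refine lintegral_mono fun x => (powKer_le_tsum ha hr (x - y)).trans (le_of_eq ?_)
        congr 1
        ext j
        have : (x - y ∈ ball (0 : E n) (2 * ((1 / 2) ^ j * r))) ↔
          x ∈ ball y (2 * ((1 / 2) ^ j * r)) := by
          rw [mem_ball_zero_iff, mem_ball_iff_norm]
        by_cases h : x ∈ ball y (2 * ((1 / 2) ^ j * r))
        · rw [indicator_of_mem h, indicator_of_mem (this.2 h)]
        · rw [indicator_of_notMem h, indicator_of_notMem (fun h' => h (this.1 h'))]
    _ = ∑' j : ℕ, ENNReal.ofReal (((1 / 2) ^ (j + 1) * r) ^ (-a)) *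
          μ (ball y (2 * ((1 / 2) ^ j * r))) := by
        rw [lintegral_tsum fun j => (measurable_const.indicator measurableSet_ball).aemeasurable]
        congr 1
        ext j
        rw [lintegral_indicator_const measurableSet_ball]
    _ ≤ ∑' j : ℕ, ENNReal.ofReal (D * r ^ (lam - a) * t ^ j) := by
        refine ENNReal.tsum_le_tsum fun j => ?_
        refine (mul_le_mul_right (hμ y _ (by positivity)) _).trans ?_
        rw [← ENNReal.ofReal_mul (by positivity)]
        apply ENNReal.ofReal_le_ofReal
        apply le_of_eq
        have h2 : t ^ j = ((1 / 2 : ℝ) ^ j) ^ (lam - a) := by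
          rw [ht, ← Real.rpow_natCast, ← Real.rpow_natCast, ← Real.rpow_mul (by norm_num),
            ← Real.rpow_mul (by norm_num)]
          congr 1
          ring
        rw [h2, hD, pow_succ, Real.mul_rpow (by positivity) (by positivity),
          Real.mul_rpow (by positivity) (by positivity), Real.mul_rpow (by positivity)
          (by positivity), Real.mul_rpow (by positivity) (by positivity),
          Real.rpow_sub (by positivity), Real.rpow_sub (by positivity), Real.rpow_neg (by positivity),
          Real.rpow_neg (by positivity), Real.rpow_neg (by positivity)]
        field_simp
    _ = ENNReal.ofReal (D * (1 - t)⁻¹ * r ^ (lam - a)) := by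
        rw [← ENNReal.ofReal_tsum_of_nonneg]
        · rw [tsum_mul_left, tsum_geometric_of_lt_one ht0 ht1]
          congr 1
          ring
        · intro j
          positivity
        · exact (summable_geometric_of_lt_one ht0 ht1).mul_left _

theorem volume_ball_le {n : ℕ} (x : E n) {r : ℝ} (hr : 0 < r) :
    volume (ball x r) = ENNReal.ofReal (volume.real (ball (0 : E n) 1) * r ^ (n : ℝ)) := by
  rw [Measure.addHaar_ball_of_pos _ _ hr, mul_comm, ENNReal.ofReal_mul (by positivity),
    ofReal_measureReal (by finiteness)]
  simp

/-- The part of the Riesz potential near the diagonal, integrated over a set. -/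
theorem lintegral_near_potential_le {n : ℕ} (hn : 0 < n) {p q : ℝ} (hpq : q.HolderConjugate p)
    {μ : Measure (E n)} [IsFiniteMeasure μ] {C lam : ℝ} (hC : 0 ≤ C) (hlam : 0 < lam)
    (hμ : ∀ (x : E n) (r : ℝ), 0 < r → μ (ball x r) ≤ ENNReal.ofReal (C * r ^ lam)) :
    ∃ C' : ℝ, 0 ≤ C' ∧ ∀ (A : Set (E n)) (h : E n → ℝ≥0∞) (r : ℝ), Measurable h → 0 < r →
      ∫⁻ x in A, (∫⁻ y, nearKer (n / q) r (x - y) * h y) ∂μ ≤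
        ENNReal.ofReal (C' * r ^ (lam / p)) * μ A ^ (1 / q) * (∫⁻ y, h y ^ p) ^ (1 / p) := by
  have hp0 : 0 < p := hpq.symm.pos
  have hq0 : 0 < q := hpq.pos
  have hn0 : (0 : ℝ) < n := by exact_mod_cast hn
  set a : ℝ := min (lam / (2 * p)) (n / (2 * q)) with ha
  set b : ℝ := n / q - a with hb
  have ha0 : 0 < a := by positivity
  have hap : a * p < lam := by
    have : a ≤ lam / (2 * p) := min_le_left _ _
    have h2 := mul_le_mul_of_nonneg_right this hp0.le
    have h3 : lam / (2 * p) * p = lam / 2 := by field_simp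
    linarith
  have hb0 : 0 < b := by
    have : a ≤ n / (2 * q) := min_le_right _ _
    have h3 : n / (2 * q) = (n / q) / 2 := by field_simp
    have : 0 < n / q := by positivity
    linarith
  have hbq : b * q < n := by
    rw [hb, sub_mul, div_mul_cancel₀ _ hq0.ne']
    have : 0 < a * q := by positivity
    linarith
  obtain ⟨C₁, hC₁, h₁⟩ := lintegral_nearKer_le hC hμ (by positivity : 0 < a * p) hap
  obtain ⟨C₂, hC₂, h₂⟩ := lintegral_nearKer_le (μ := (volume : Measure (E n))) (lam := n)
    (a := b * q) (C := volume.real (ball (0 : E n) 1)) measureReal_nonneg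
    (fun x r hr => (volume_ball_le x hr).le) (by positivity) hbq
  refine ⟨C₁ ^ (1 / p) * C₂ ^ (1 / q), by positivity, fun A h r hh hr => ?_⟩
  have hadd : (n : ℝ) / q = a + b := by rw [hb]; ring
  calc ∫⁻ x in A, (∫⁻ y, nearKer (n / q) r (x - y) * h y) ∂μ
      ≤ ∫⁻ x in A, (∫⁻ y, nearKer a r (x - y) * h y * nearKer b r (x - y)) ∂μ := by
        refine lintegral_mono fun x => lintegral_mono fun y => ?_
        rw [hadd, mul_right_comm]
        exact mul_le_mul_left (nearKer_add (by positivity) _) _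
    _ = ∫⁻ z, ((fun z : E n × E n => nearKer a r (z.1 - z.2) * h z.2) *
          (fun z : E n × E n => nearKer b r (z.1 - z.2))) z ∂((μ.restrict A).prod volume) := by
        rw [lintegral_prod _ (by fun_prop)]
        rfl
    _ ≤ (∫⁻ z, (nearKer a r (z.1 - z.2) * h z.2) ^ p ∂((μ.restrict A).prod volume)) ^ (1 / p) *
        (∫⁻ z, (nearKer b r (z.1 - z.2)) ^ q ∂((μ.restrict A).prod volume)) ^ (1 / q) :=
        ENNReal.lintegral_mul_le_Lp_mul_Lq _ hpq.symm (by fun_prop) (by fun_prop)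
    _ ≤ (ENNReal.ofReal (C₁ * r ^ (lam - a * p)) * ∫⁻ y, h y ^ p) ^ (1 / p) *
        (ENNReal.ofReal (C₂ * r ^ (n - b * q)) * μ A) ^ (1 / q) := by
        gcongr
        · rw [lintegral_prod_symm _ (by fun_prop), ← lintegral_const_mul _ (by fun_prop)]
          refine lintegral_mono fun y => ?_
          simp only [ENNReal.mul_rpow_of_nonneg _ _ hp0.le, nearKer_rpow hp0]
          rw [lintegral_mul_const _ (by fun_prop)]
          exact mul_le_mul_left ((setLIntegral_le_lintegral _ _).trans (h₁ y r hr)) _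
        · rw [lintegral_prod _ (by fun_prop)]
          have : ∀ x : E n, ∫⁻ y, nearKer b r (x - y) ^ q ≤
              ENNReal.ofReal (C₂ * r ^ (n - b * q)) := by
            intro x
            simp only [nearKer_rpow hq0]
            refine le_trans (le_of_eq ?_) (h₂ x r hr)
            refine lintegral_congr fun y => ?_
            rw [← nearKer_neg, neg_sub]
          refine (lintegral_mono this).trans ?_
          rw [lintegral_const, Measure.restrict_apply_univ]
    _ = _ := by
        rw [ENNReal.mul_rpow_of_nonneg _ _ (by positivity), ENNReal.mul_rpow_of_nonneg _ _
          (by positivity), ENNReal.ofReal_rpow_of_nonneg (by positivity) (by positivity),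
          ENNReal.ofReal_rpow_of_nonneg (by positivity) (by positivity)]
        have : C₁ ^ (1 / p) * C₂ ^ (1 / q) * r ^ (lam / p) =
            (C₁ * r ^ (lam - a * p)) ^ (1 / p) * (C₂ * r ^ (n - b * q)) ^ (1 / q) := by
          rw [Real.mul_rpow hC₁ (by positivity), Real.mul_rpow hC₂ (by positivity),
            ← Real.rpow_mul hr.le, ← Real.rpow_mul hr.le]
          have h5 : lam / p = (lam - a * p) * (1 / p) + (n - b * q) * (1 / q) := by
            rw [hb]
            field_simp
            ring
          rw [h5, Real.rpow_add hr]
          ring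
        rw [this, ENNReal.ofReal_mul (by positivity)]
        ring

theorem sphereArea_eq {n : ℕ} : sphereArea n = n * volume.real (ball (0 : E n) 1) := by
  unfold sphereArea
  rw [Measure.toSphere_real_apply_univ, finrank_euclideanSpace_fin]

theorem volume_real_ball_pos {n : ℕ} : 0 < volume.real (ball (0 : E n) 1) :=
  ENNReal.toReal_pos (measure_ball_pos _ _ one_pos).ne' (by finiteness)

theorem sphereArea_pos {n : ℕ} (hn : 0 < n) : 0 < sphereArea n := by
  rw [sphereArea_eq]
  have := volume_real_ball_pos (n := n)
  positivity

theorem lintegral_annulusKer {n : ℕ} (hn : 0 < n) {r R : ℝ} (hr : 0 < r) (hR : r ≤ R) :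
    ∫⁻ z : E n, annulusKer n r R z = ENNReal.ofReal (sphereArea n * Real.log (R / r)) := by
  have : Nonempty (Fin n) := ⟨⟨0, hn⟩⟩
  set f : ℝ → ℝ := (Ico r R).indicator fun t => t ^ (-(n : ℝ)) with hf
  have hker : ∀ z : E n, annulusKer n r R z = ENNReal.ofReal (f ‖z‖) := by
    intro z
    unfold annulusKer powKer
    by_cases h : z ∈ ball (0 : E n) R \ ball 0 r
    · have h' : ‖z‖ ∈ Ico r R := by simpa [and_comm] using h
      rw [indicator_of_mem h, hf, indicator_of_mem h']
    · have h' : ‖z‖ ∉ Ico r R := by simpa [and_comm] using h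
      rw [indicator_of_notMem h, hf, indicator_of_notMem h', ENNReal.ofReal_zero]
  have hf0 : ∀ t, 0 ≤ f t := by
    intro t
    refine indicator_nonneg (fun t ht => ?_) t
    have : 0 < t := hr.trans_le ht.1
    positivity
  have hprod : ∀ t ∈ Ioi (0 : ℝ), t ^ (n - 1) • f t = (Ico r R).indicator (fun t => t⁻¹) t := by
    intro t ht
    by_cases h : t ∈ Ico r R
    · rw [hf, indicator_of_mem h, indicator_of_mem h, smul_eq_mul, ← Real.rpow_natCast,
        ← Real.rpow_add ht, ← Real.rpow_neg_one]
      congr 1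
      rw [Nat.cast_sub hn]
      push_cast
      ring
    · rw [hf, indicator_of_notMem h, indicator_of_notMem h, smul_zero]
  have hint : IntegrableOn (fun t : ℝ => t⁻¹) (Ico r R) := by
    refine (ContinuousOn.integrableOn_Icc ?_).mono_set Ico_subset_Icc_self
    exact continuousOn_inv₀.mono fun t ht => (hr.trans_le ht.1).ne'
  have hsub : Ico r R ⊆ Ioi 0 := fun t ht => hr.trans_le ht.1
  have hI : Integrable (fun z : E n => f ‖z‖) := by
    rw [integrable_fun_norm_addHaar, finrank_euclideanSpace_fin]
    rw [integrableOn_congr_fun hprod measurableSet_Ioi]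
    exact (hint.integrable_indicator measurableSet_Ico).integrableOn
  simp_rw [hker]
  rw [← ofReal_integral_eq_lintegral_ofReal hI (Eventually.of_forall fun z => hf0 _),
    integral_fun_norm_addHaar, finrank_euclideanSpace_fin,
    setIntegral_congr_fun measurableSet_Ioi hprod,
    setIntegral_indicator measurableSet_Ico, inter_eq_self_of_subset_right hsub,
    integral_Ico_eq_integral_Ioc, ← intervalIntegral.integral_of_le hR,
    integral_inv_of_pos hr (hr.trans_le hR), sphereArea_eq, nsmul_eq_mul, smul_eq_mul, mul_assoc]

/-- Hölder's inequality for the kernel on an annulus. -/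
theorem annulus_potential_le {n : ℕ} (hn : 0 < n) {p q : ℝ} (hpq : q.HolderConjugate p)
    {r R : ℝ} (hr : 0 < r) (hR : r ≤ R) {h : E n → ℝ≥0∞} (hh : Measurable h) (x : E n) :
    ∫⁻ y, annulusKer (n / q) r R (x - y) * h y ≤
      ENNReal.ofReal ((sphereArea n * Real.log (R / r)) ^ (1 / q)) *
        (∫⁻ y in ball x R, h y ^ p) ^ (1 / p) := by
  have hp0 : 0 < p := hpq.symm.pos
  have hq0 : 0 < q := hpq.pos
  have hlog : 0 ≤ Real.log (R / r) := Real.log_nonneg ((one_le_div hr).2 hR)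
  have hω := sphereArea_pos hn
  calc ∫⁻ y, annulusKer (n / q) r R (x - y) * h y
      = ∫⁻ y : E n, ((fun y : E n => annulusKer (n / q) r R (x - y)) *
          (fun y => (ball x R).indicator h y)) y := by
        refine lintegral_congr fun y => ?_
        simp only [Pi.mul_apply]
        by_cases hy : y ∈ ball x R
        · rw [indicator_of_mem hy]
        · rw [indicator_of_notMem hy, mul_zero]
          have : x - y ∉ ball (0 : E n) R \ ball 0 r := by
            intro h'
            apply hy
            have := h'.1
            rwa [mem_ball_zero_iff, ← dist_eq_norm, dist_comm, ← mem_ball] at this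
          unfold annulusKer
          rw [indicator_of_notMem this, zero_mul]
    _ ≤ (∫⁻ y, annulusKer (n / q) r R (x - y) ^ q) ^ (1 / q) *
        (∫⁻ y, ((ball x R).indicator h y) ^ p) ^ (1 / p) :=
        ENNReal.lintegral_mul_le_Lp_mul_Lq volume hpq (by fun_prop)
          (hh.indicator measurableSet_ball).aemeasurable
    _ = _ := by
        simp only [annulusKer_rpow hq0, div_mul_cancel₀ _ hq0.ne']
        rw [lintegral_sub_left_eq_self (fun z => annulusKer n r R z) x,
          lintegral_annulusKer hn hr hR, ENNReal.ofReal_rpow_of_nonneg (by positivity)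
          (by positivity), ← lintegral_indicator measurableSet_ball]
        congr 3
        ext y
        by_cases hy : y ∈ ball x R
        · rw [indicator_of_mem hy, indicator_of_mem hy]
        · rw [indicator_of_notMem hy, indicator_of_notMem hy, ENNReal.zero_rpow_of_pos hp0]

/-- A measurable set contains subsets of every smaller volume. -/
theorem exists_subset_volume_eq {n : ℕ} (hn : 0 < n) {Z : Set (E n)} (hZ : MeasurableSet Z)
    {v : ℝ≥0∞} (hv : v ≤ volume Z) (hv' : v ≠ ⊤) :
    ∃ Z' ⊆ Z, MeasurableSet Z' ∧ volume Z' = v := by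
  have : Nonempty (Fin n) := ⟨⟨0, hn⟩⟩
  rcases hv.eq_or_lt with h | h
  · exact ⟨Z, subset_rfl, hZ, h.symm⟩
  have hU : Z = ⋃ k : ℕ, Z ∩ ball (0 : E n) k := by
    rw [← inter_iUnion, iUnion_ball_nat, inter_univ]
  have hmono : Monotone fun k : ℕ => Z ∩ ball (0 : E n) k := fun i j hij =>
    inter_subset_inter_right _ (ball_subset_ball (by exact_mod_cast hij))
  have ht := tendsto_measure_iUnion_atTop (μ := (volume : Measure (E n))) hmono
  rw [← hU] at ht
  obtain ⟨k, hk⟩ := (ht.eventually (lt_mem_nhds h)).exists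
  set φ : ℝ → ℝ := fun ρ => volume.real (Z ∩ ball (0 : E n) ρ) with hφ
  have hφb : ∀ a b : ℝ, 0 ≤ a → a ≤ b → |φ b - φ a| ≤
      volume.real (ball (0 : E n) 1) * (b ^ n - a ^ n) := by
    intro a b ha hab
    have h1 : Z ∩ ball (0 : E n) a ⊆ Z ∩ ball (0 : E n) b :=
      inter_subset_inter_right _ (ball_subset_ball hab)
    have h2 : φ b - φ a = volume.real ((Z ∩ ball (0 : E n) b) \ (Z ∩ ball (0 : E n) a)) := by
      rw [measureReal_sdiff h1 (hZ.inter measurableSet_ball) (by finiteness)]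
    have h3 : (Z ∩ ball (0 : E n) b) \ (Z ∩ ball (0 : E n) a) ⊆ ball (0 : E n) b \ ball 0 a := by
      rintro z ⟨⟨hz, hzb⟩, hza⟩
      exact ⟨hzb, fun h => hza ⟨hz, h⟩⟩
    rw [h2, abs_of_nonneg measureReal_nonneg]
    have h4 : volume (ball (0 : E n) b \ ball 0 a) ≠ ⊤ :=
      ne_top_of_le_ne_top (by finiteness) (measure_mono sdiff_subset)
    refine (measureReal_mono h3 h4).trans (le_of_eq ?_)
    rw [measureReal_sdiff (ball_subset_ball hab) measurableSet_ball (by finiteness)]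
    unfold Measure.real
    rw [Measure.addHaar_ball _ _ (ha.trans hab), Measure.addHaar_ball _ _ ha,
      ENNReal.toReal_mul, ENNReal.toReal_mul, ENNReal.toReal_ofReal (by
        have := ha.trans hab
        positivity), ENNReal.toReal_ofReal (by positivity), finrank_euclideanSpace_fin]
    ring
  have hcont : ContinuousOn φ (Icc 0 k) := by
    intro a ha
    rw [ContinuousWithinAt, tendsto_iff_dist_tendsto_zero]
    have hlim : Tendsto (fun b : ℝ => volume.real (ball (0 : E n) 1) * |b ^ n - a ^ n|)
        (𝓝[Icc 0 (k : ℝ)] a) (𝓝 0) := by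
      have : Continuous fun b : ℝ => volume.real (ball (0 : E n) 1) * |b ^ n - a ^ n| := by
        fun_prop
      have h2 := this.tendsto a
      simp only [sub_self, abs_zero, mul_zero] at h2
      exact h2.mono_left nhdsWithin_le_nhds
    refine squeeze_zero' (Eventually.of_forall fun _ => dist_nonneg) ?_ hlim
    filter_upwards [self_mem_nhdsWithin] with b hb
    rw [Real.dist_eq]
    rcases le_total a b with hab | hab
    · refine (hφb a b ha.1 hab).trans ?_
      exact mul_le_mul_of_nonneg_left (le_abs_self _) measureReal_nonneg
    · rw [abs_sub_comm]
      refine (hφb b a hb.1 hab).trans ?_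
      rw [abs_sub_comm]
      exact mul_le_mul_of_nonneg_left (le_abs_self _) measureReal_nonneg
  have h0 : φ 0 = 0 := by simp [hφ]
  have hk' : v.toReal ≤ φ k :=
    ENNReal.toReal_mono (by finiteness) hk.le
  obtain ⟨ρ, -, hρ⟩ := intermediate_value_Icc (Nat.cast_nonneg k) hcont
    (show v.toReal ∈ Icc (φ 0) (φ k) from ⟨by rw [h0]; exact ENNReal.toReal_nonneg, hk'⟩)
  refine ⟨Z ∩ ball 0 ρ, inter_subset_left, hZ.inter measurableSet_ball, ?_⟩
  rw [← ENNReal.ofReal_toReal hv', ← hρ, hφ, ofReal_measureReal (by finiteness)]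

/-- A set of given volume on which an `L^p` function is largest. -/
theorem exists_top_set {n : ℕ} (hn : 0 < n) {p : ℝ} (hp : 0 < p) {h : E n → ℝ≥0∞}
    (hh : Measurable h) (hfin : ∫⁻ y, h y ^ p ≠ ⊤) {V : ℝ≥0∞} (hV : V ≠ ⊤) :
    ∃ (G : Set (E n)) (γ : ℝ≥0∞), MeasurableSet G ∧ volume G = V ∧ (∀ y ∉ G, h y ≤ γ) ∧
      ∀ y ∈ G, γ ≤ h y := by
  have : Nonempty (Fin n) := ⟨⟨0, hn⟩⟩
  have hfinγ : ∀ γ : ℝ≥0∞, 0 < γ → volume {y | γ < h y} ≠ ⊤ := by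
    intro γ hγ htop
    have hmin : min γ 1 ≠ ⊤ := ne_top_of_le_ne_top ENNReal.one_ne_top (min_le_right _ _)
    have h1 := meas_ge_le_lintegral_div (μ := (volume : Measure (E n)))
      (hh.pow_const p).aemeasurable (ε := (min γ 1) ^ p)
      (ENNReal.rpow_pos (lt_min hγ one_pos) hmin).ne'
      (ENNReal.rpow_ne_top_of_nonneg hp.le hmin)
    have h2 : volume {y | γ < h y} ≤ volume {y | (min γ 1) ^ p ≤ h y ^ p} := by
      refine measure_mono fun y hy => ?_
      exact ENNReal.rpow_le_rpow ((min_le_left _ _).trans (le_of_lt hy)) hp.le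
    rw [htop] at h2
    have h3 := (h2.trans h1)
    rw [top_le_iff] at h3
    exact (ENNReal.div_ne_top hfin
      (ENNReal.rpow_pos (lt_min hγ one_pos) hmin).ne') h3
  set S : Set ℝ≥0∞ := {γ | volume {y | γ < h y} ≤ V} with hS
  have hSne : S.Nonempty := ⟨⊤, by simp [hS]⟩
  set γ := sInf S with hγ
  have hup : ∀ γ', γ < γ' → volume {y | γ' < h y} ≤ V := by
    intro γ' h'
    obtain ⟨a, ha, hlt⟩ := (sInf_lt_iff).1 h'
    exact (measure_mono fun y hy => lt_trans hlt hy).trans ha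
  have h1 : volume {y | γ < h y} ≤ V := by
    rcases eq_or_ne γ ⊤ with htop | htop
    · rw [htop]
      simp
    obtain ⟨u, hu, hgt, hlim⟩ := exists_seq_strictAnti_tendsto' (lt_top_iff_ne_top.2 htop)
    have hU : {y | γ < h y} = ⋃ k, {y | u k < h y} := by
      ext y
      simp only [mem_ofPred_eq, mem_iUnion]
      constructor
      · intro hy
        exact (hlim.eventually (gt_mem_nhds hy)).exists
      · rintro ⟨k, hk⟩
        exact (hgt k).1.trans hk
    have hmono : Monotone fun k => {y | u k < h y} := fun i j hij y hy =>
      lt_of_le_of_lt (hu.antitone hij) hy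
    rw [hU]
    exact le_of_tendsto' (tendsto_measure_iUnion_atTop hmono) fun k => hup _ (hgt k).1
  have h2 : V ≤ volume {y | γ ≤ h y} := by
    rcases eq_or_ne γ 0 with h0 | h0
    · have : {y | γ ≤ h y} = univ := by
        ext y
        simp [h0]
      rw [this, measure_univ_of_isAddLeftInvariant]
      exact le_top
    obtain ⟨u, hu, hlt, hlim⟩ := exists_seq_strictMono_tendsto' (pos_iff_ne_zero.2 h0)
    have hI : {y | γ ≤ h y} = ⋂ k, {y | u k < h y} := by
      ext y
      simp only [mem_ofPred_eq, mem_iInter]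
      constructor
      · intro hy k
        exact (hlt k).2.trans_le hy
      · intro hy
        exact le_of_tendsto' hlim fun k => (hy k).le
    have hanti : Antitone fun k => {y | u k < h y} := fun i j hij y hy =>
      lt_of_le_of_lt (hu.monotone hij) hy
    rw [hI]
    refine ge_of_tendsto' (tendsto_measure_iInter_atTop
      (fun k => (measurableSet_lt measurable_const hh).nullMeasurableSet) hanti
      ⟨0, hfinγ _ (hlt 0).1⟩) fun k => ?_
    by_contra hcon
    push Not at hcon
    exact absurd (sInf_le (show u k ∈ S from hcon.le)) (not_le.2 (hlt k).2)
  have hms1 : MeasurableSet {y | γ < h y} := measurableSet_lt measurable_const hh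
  have hms2 : MeasurableSet {y | h y = γ} := hh (measurableSet_singleton γ)
  have hdisj : Disjoint {y | γ < h y} {y | h y = γ} := by
    rw [disjoint_left]
    intro y hy hy'
    exact absurd hy' (ne_of_gt hy)
  have hsplit : {y | γ ≤ h y} = {y | γ < h y} ∪ {y | h y = γ} := by
    ext y
    simp only [mem_ofPred_eq, mem_union]
    rw [le_iff_lt_or_eq, eq_comm]
  rw [hsplit, measure_union hdisj hms2] at h2
  obtain ⟨Z, hZs, hZm, hZv⟩ := exists_subset_volume_eq hn hms2
    (v := V - volume {y | γ < h y}) (tsub_le_iff_left.2 h2) (by finiteness)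
  refine ⟨{y | γ < h y} ∪ Z, γ, hms1.union hZm, ?_, ?_, ?_⟩
  · rw [measure_union (hdisj.mono_right hZs) hZm, hZv, add_tsub_cancel_of_le h1]
  · intro y hy
    by_contra hcon
    exact hy (Or.inl (not_le.1 hcon))
  · rintro y (hy | hy)
    · exact le_of_lt hy
    · exact (hZs hy).ge

theorem lintegral_le_of_top_set {n : ℕ} {f : E n → ℝ≥0∞} {G A : Set (E n)} {c : ℝ≥0∞}
    (hG : MeasurableSet G) (hA : MeasurableSet A) (hAG : volume A ≤ volume G)
    (hfin : volume G ≠ ⊤) (h1 : ∀ y ∉ G, f y ≤ c) (h2 : ∀ y ∈ G, c ≤ f y) :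
    ∫⁻ y in A, f y ≤ ∫⁻ y in G, f y := by
  have e1 := lintegral_inter_add_sdiff (μ := volume) f A hG
  have e2 := lintegral_inter_add_sdiff (μ := volume) f G hA
  rw [← e1, ← e2, inter_comm G A]
  refine add_le_add le_rfl ?_
  have hv : volume (A \ G) ≤ volume (G \ A) := by
    have v1 := measure_inter_add_sdiff (μ := (volume : Measure (E n))) A hG
    have v2 := measure_inter_add_sdiff (μ := (volume : Measure (E n))) G hA
    rw [← v1, ← v2, inter_comm G A] at hAG
    have hfi : volume (A ∩ G) ≠ ⊤ := ne_top_of_le_ne_top hfin (measure_mono inter_subset_right)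
    exact (ENNReal.add_le_add_iff_left hfi).1 hAG
  calc ∫⁻ y in A \ G, f y ≤ ∫⁻ _ in A \ G, c :=
        setLIntegral_mono' (hA.diff hG) fun y hy => h1 y hy.2
    _ = c * volume (A \ G) := by rw [lintegral_const, Measure.restrict_apply_univ]
    _ ≤ c * volume (G \ A) := by gcongr
    _ = ∫⁻ _ in G \ A, c := by rw [lintegral_const, Measure.restrict_apply_univ]
    _ ≤ ∫⁻ y in G \ A, f y := setLIntegral_mono' (hG.diff hA) fun y hy => h2 y hy.1

/-- The Riesz potential `∫ |x - y|^{-a} h(y) dy`. -/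
def rieszPot {n : ℕ} (a : ℝ) (h : E n → ℝ≥0∞) (x : E n) : ℝ≥0∞ :=
  ∫⁻ y, powKer a (x - y) * h y

theorem measurable_rieszPot {n : ℕ} (a : ℝ) {h : E n → ℝ≥0∞} (hh : Measurable h) :
    Measurable (rieszPot a h) := by
  unfold rieszPot
  exact Measurable.lintegral_prod_right' (f := fun z : E n × E n => powKer a (z.1 - z.2) * h z.2)
    (by fun_prop)

theorem lintegral_indicator_rpow {n : ℕ} {p : ℝ} (hp : 0 < p) {G : Set (E n)}
    (hG : MeasurableSet G) (h : E n → ℝ≥0∞) :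
    ∫⁻ y, G.indicator h y ^ p = ∫⁻ y in G, h y ^ p := by
  rw [← lintegral_indicator hG]
  refine lintegral_congr fun y => ?_
  by_cases hy : y ∈ G
  · rw [indicator_of_mem hy, indicator_of_mem hy]
  · rw [indicator_of_notMem hy, indicator_of_notMem hy, ENNReal.zero_rpow_of_pos hp]

theorem ofReal_rpow_volume_ball {n : ℕ} {r s : ℝ} (hr : 0 < r) (hs : 0 ≤ s) :
    volume (ball (0 : E n) r) ^ s =
      ENNReal.ofReal (volume.real (ball (0 : E n) 1) ^ s) * ENNReal.ofReal (r ^ (n * s)) := by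
  rw [volume_ball_le _ hr, ENNReal.ofReal_rpow_of_nonneg (by positivity) hs,
    Real.mul_rpow measureReal_nonneg (by positivity), ← Real.rpow_mul hr.le,
    ENNReal.ofReal_mul (by positivity)]

/-- The part of the potential near the diagonal, averaged over a set of measure `r^lam`. -/
theorem near_average_le {n : ℕ} (hn : 0 < n) {p q : ℝ} (hpq : q.HolderConjugate p)
    {μ : Measure (E n)} [IsFiniteMeasure μ] {C lam : ℝ} (hC : 0 ≤ C) (hlam : 0 < lam)
    (hμ : ∀ (x : E n) (r : ℝ), 0 < r → μ (ball x r) ≤ ENNReal.ofReal (C * r ^ lam)) :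
    ∃ b : ℝ, 0 ≤ b ∧ ∀ (h : E n → ℝ≥0∞) (A G : Set (E n)) (γ : ℝ≥0∞) (r : ℝ), Measurable h →
      0 < r → μ A = ENNReal.ofReal (r ^ lam) → MeasurableSet G →
      volume G = volume (ball (0 : E n) r) → (∀ y ∉ G, h y ≤ γ) → (∀ y ∈ G, γ ≤ h y) →
      ∫⁻ x in A, (∫⁻ y, nearKer (n / q) r (x - y) * h y) ∂μ ≤
        ENNReal.ofReal b * (∫⁻ y in G, h y ^ p) ^ (1 / p) * μ A := by
  have hp0 : 0 < p := hpq.symm.pos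
  have hq0 : 0 < q := hpq.pos
  have hn0 : (0 : ℝ) < n := by exact_mod_cast hn
  have hpq1 : 1 / p + 1 / q = 1 := by
    have := hpq.symm.inv_add_inv_eq_one
    simpa [one_div] using this
  obtain ⟨C₁, hC₁, h₁⟩ := lintegral_near_potential_le hn hpq hC hlam hμ
  have hnq : (n : ℝ) / q < n := div_lt_self hn0 hpq.lt
  obtain ⟨C₂, hC₂, h₂⟩ := lintegral_nearKer_le (μ := (volume : Measure (E n))) (lam := n)
    (a := n / q) (C := volume.real (ball (0 : E n) 1)) measureReal_nonneg
    (fun x r hr => (volume_ball_le x hr).le) (by positivity) hnq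
  set v := volume.real (ball (0 : E n) 1) with hv
  have hv0 : 0 < v := volume_real_ball_pos
  refine ⟨C₁ + C₂ * (v ^ (1 / p))⁻¹, by positivity, ?_⟩
  intro h A G γ r hh hr hA hG hGr hGc hGm
  set l := (∫⁻ y in G, h y ^ p) ^ (1 / p) with hl
  have hγ : γ * ENNReal.ofReal (r ^ (n / p)) ≤ ENNReal.ofReal ((v ^ (1 / p))⁻¹) * l := by
    have h3 : γ ^ p * volume (ball (0 : E n) r) ≤ ∫⁻ y in G, h y ^ p := by
      rw [← hGr]
      calc γ ^ p * volume G = ∫⁻ _ in G, γ ^ p := by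
            rw [lintegral_const, Measure.restrict_apply_univ]
        _ ≤ _ := setLIntegral_mono' hG fun y hy => ENNReal.rpow_le_rpow (hGm y hy) hp0.le
    have h4 := ENNReal.rpow_le_rpow h3 (by positivity : 0 ≤ 1 / p)
    rw [ENNReal.mul_rpow_of_nonneg _ _ (by positivity), ← ENNReal.rpow_mul,
      mul_one_div_cancel hp0.ne', ENNReal.rpow_one, ofReal_rpow_volume_ball hr (by positivity),
      ← hv, mul_one_div, ← hl] at h4
    have h5 : ENNReal.ofReal ((v ^ (1 / p))⁻¹) * ENNReal.ofReal (v ^ (1 / p)) = 1 := by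
      rw [← ENNReal.ofReal_mul (by positivity), inv_mul_cancel₀ (by positivity), ENNReal.ofReal_one]
    calc γ * ENNReal.ofReal (r ^ (n / p))
        = (ENNReal.ofReal ((v ^ (1 / p))⁻¹) * ENNReal.ofReal (v ^ (1 / p))) *
            (γ * ENNReal.ofReal (r ^ (n / p))) := by rw [h5, one_mul]
      _ = ENNReal.ofReal ((v ^ (1 / p))⁻¹) *
          (γ * (ENNReal.ofReal (v ^ (1 / p)) * ENNReal.ofReal (r ^ (n / p)))) := by ring
      _ ≤ _ := by gcongr
  have hpt : ∀ x : E n, ∫⁻ y, nearKer (n / q) r (x - y) * h y ≤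
      (∫⁻ y, nearKer (n / q) r (x - y) * G.indicator h y) +
        ENNReal.ofReal (C₂ * (v ^ (1 / p))⁻¹) * l := by
    intro x
    have h6 : ∫⁻ y, nearKer (n / q) r (x - y) * γ ≤
        ENNReal.ofReal (C₂ * (v ^ (1 / p))⁻¹) * l := by
      rw [lintegral_mul_const _ (by fun_prop)]
      have h7 : ∫⁻ y, nearKer (n / q) r (x - y) ≤ ENNReal.ofReal (C₂ * r ^ (n / p)) := by
        have := h₂ x r hr
        have e : (n : ℝ) - n / q = n / p := by
          have : (n : ℝ) * (1 / p + 1 / q) = n := by rw [hpq1, mul_one]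
          linear_combination -this
        rw [e] at this
        refine le_trans (le_of_eq ?_) this
        refine lintegral_congr fun y => ?_
        rw [← nearKer_neg, neg_sub]
      calc (∫⁻ y, nearKer (n / q) r (x - y)) * γ
          ≤ ENNReal.ofReal (C₂ * r ^ (n / p)) * γ := by gcongr
        _ = ENNReal.ofReal C₂ * (γ * ENNReal.ofReal (r ^ (n / p))) := by
          rw [ENNReal.ofReal_mul hC₂]
          ring
        _ ≤ ENNReal.ofReal C₂ * (ENNReal.ofReal ((v ^ (1 / p))⁻¹) * l) := by gcongr
        _ = _ := by rw [ENNReal.ofReal_mul hC₂, mul_assoc]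
    refine le_trans ?_ (add_le_add le_rfl h6)
    rw [← lintegral_add_left (by
      have := hh.indicator hG
      fun_prop)]
    refine lintegral_mono fun y => ?_
    rw [← mul_add]
    refine mul_le_mul_right ?_ _
    by_cases hy : y ∈ G
    · rw [indicator_of_mem hy]
      exact le_self_add
    · rw [indicator_of_notMem hy, zero_add]
      exact hGc y hy
  calc ∫⁻ x in A, (∫⁻ y, nearKer (n / q) r (x - y) * h y) ∂μ
      ≤ ∫⁻ x in A, ((∫⁻ y, nearKer (n / q) r (x - y) * G.indicator h y) +
        ENNReal.ofReal (C₂ * (v ^ (1 / p))⁻¹) * l) ∂μ := lintegral_mono hpt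
    _ = (∫⁻ x in A, (∫⁻ y, nearKer (n / q) r (x - y) * G.indicator h y) ∂μ) +
        ENNReal.ofReal (C₂ * (v ^ (1 / p))⁻¹) * l * μ A := by
        rw [lintegral_add_right _ measurable_const, lintegral_const, Measure.restrict_apply_univ]
    _ ≤ ENNReal.ofReal C₁ * l * μ A + ENNReal.ofReal (C₂ * (v ^ (1 / p))⁻¹) * l * μ A := by
        gcongr
        refine (h₁ A (G.indicator h) r (hh.indicator hG) hr).trans (le_of_eq ?_)
        rw [lintegral_indicator_rpow hp0 hG, hA, ENNReal.ofReal_rpow_of_nonneg (by positivity)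
          (by positivity), ← Real.rpow_mul hr.le, ENNReal.ofReal_mul hC₁, ← hl]
        have : r ^ lam = r ^ (lam / p) * r ^ (lam * (1 / q)) := by
          rw [← Real.rpow_add hr]
          congr 1
          linear_combination -lam * hpq1
        rw [this, ENNReal.ofReal_mul (by positivity)]
        ring
    _ = _ := by
        rw [ENNReal.ofReal_add hC₁ (by positivity)]
        ring

/-- The part of the potential away from the diagonal which comes from a set of small volume. -/
theorem far_top_le {n : ℕ} {p q : ℝ} (hpq : q.HolderConjugate p) {h : E n → ℝ≥0∞}
    (hh : Measurable h) {G : Set (E n)} {r : ℝ} (hr : 0 < r) (hG : MeasurableSet G)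
    (hGr : volume G = volume (ball (0 : E n) r)) (x : E n) :
    ∫⁻ y, farKer (n / q) r (x - y) * G.indicator h y ≤
      ENNReal.ofReal (volume.real (ball (0 : E n) 1) ^ (1 / q)) *
        (∫⁻ y in G, h y ^ p) ^ (1 / p) := by
  have hp0 : 0 < p := hpq.symm.pos
  have hq0 : 0 < q := hpq.pos
  have hker : ∀ z : E n, farKer (n / q) r z ≤ ENNReal.ofReal (r ^ (-(n / q : ℝ))) := by
    intro z
    unfold farKer
    by_cases hz : z ∈ (ball (0 : E n) r)ᶜ
    · rw [indicator_of_mem hz]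
      have : r ≤ ‖z‖ := by simpa using hz
      exact ENNReal.ofReal_le_ofReal (Real.rpow_le_rpow_of_nonpos hr this
        (by have : (0 : ℝ) ≤ n / q := by positivity
            linarith))
    · rw [indicator_of_notMem hz]
      exact zero_le
  calc ∫⁻ y, farKer (n / q) r (x - y) * G.indicator h y
      ≤ ∫⁻ y, ENNReal.ofReal (r ^ (-(n / q : ℝ))) * G.indicator h y :=
        lintegral_mono fun y => mul_le_mul_left (hker _) _
    _ = ENNReal.ofReal (r ^ (-(n / q : ℝ))) * ∫⁻ y in G, h y * 1 := by
        rw [lintegral_const_mul _ (hh.indicator hG), lintegral_indicator hG]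
        simp
    _ ≤ ENNReal.ofReal (r ^ (-(n / q : ℝ))) * ((∫⁻ y in G, h y ^ p) ^ (1 / p) *
          (∫⁻ y in G, 1 ^ q) ^ (1 / q)) := by
        gcongr
        exact ENNReal.lintegral_mul_le_Lp_mul_Lq _ hpq.symm hh.aemeasurable aemeasurable_const
    _ = _ := by
        rw [ENNReal.one_rpow, lintegral_const, one_mul, Measure.restrict_apply_univ, hGr,
          ofReal_rpow_volume_ball hr (by positivity), mul_one_div, Real.rpow_neg hr.le]
        have : ENNReal.ofReal ((r ^ (n / q : ℝ))⁻¹) * ENNReal.ofReal (r ^ (n / q : ℝ)) = 1 := by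
          rw [← ENNReal.ofReal_mul (by positivity), inv_mul_cancel₀ (by positivity),
            ENNReal.ofReal_one]
        calc _ = (ENNReal.ofReal ((r ^ (n / q : ℝ))⁻¹) * ENNReal.ofReal (r ^ (n / q : ℝ))) *
              (ENNReal.ofReal (volume.real (ball (0 : E n) 1) ^ (1 / q)) *
                (∫⁻ y in G, h y ^ p) ^ (1 / p)) := by ring
          _ = _ := by rw [this, one_mul]

theorem farKer_mul_le {n : ℕ} {Ω : Set (E n)} {R : ℝ}
    (hR : ∀ x ∈ Ω, ∀ y ∈ Ω, dist x y < R) {h : E n → ℝ≥0∞} (hΩ : ∀ y ∉ Ω, h y = 0) (a r : ℝ)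
    {x : E n} (hx : x ∈ Ω) (y : E n) :
    farKer a r (x - y) * h y ≤ annulusKer a r R (x - y) * h y := by
  by_cases hy : y ∈ Ω
  · refine mul_le_mul_left ?_ _
    unfold farKer annulusKer
    by_cases hz : x - y ∈ (ball (0 : E n) r)ᶜ
    · have : x - y ∈ ball (0 : E n) R \ ball 0 r :=
        ⟨by rw [mem_ball_zero_iff, ← dist_eq_norm]; exact hR x hx y hy, hz⟩
      rw [indicator_of_mem hz, indicator_of_mem this]
    · rw [indicator_of_notMem hz]
      exact zero_le
  · rw [hΩ y hy, mul_zero]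
    exact zero_le

theorem annulusKer_le_add {n : ℕ} (a r s R : ℝ) (z : E n) :
    annulusKer a r R z ≤ annulusKer a r s z + annulusKer a s R z := by
  unfold annulusKer
  by_cases h : z ∈ ball (0 : E n) R \ ball 0 r
  · rw [indicator_of_mem h]
    by_cases h1 : z ∈ ball (0 : E n) s
    · rw [indicator_of_mem (show z ∈ ball (0 : E n) s \ ball 0 r from ⟨h1, h.2⟩)]
      exact le_self_add
    · rw [indicator_of_mem (show z ∈ ball (0 : E n) R \ ball 0 s from ⟨h.1, h1⟩)]
      exact le_add_self
  · rw [indicator_of_notMem h]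
    exact zero_le

/-- Lower bounds for the potential on a set `A` are controlled by the top part of `h` and by the
part of the potential away from the diagonal. -/
theorem le_of_le_rieszPot {n : ℕ} {q : ℝ} {μ : Measure (E n)} {h : E n → ℝ≥0∞}
    (hh : Measurable h) {A : Set (E n)} (hA : MeasurableSet A) (hA0 : μ A ≠ 0) (hA1 : μ A ≠ ⊤)
    {r : ℝ} {τ B X : ℝ≥0∞} (hτ : ∀ x ∈ A, τ ≤ rieszPot (n / q) h x)
    (hB : ∫⁻ x in A, (∫⁻ y, nearKer (n / q) r (x - y) * h y) ∂μ ≤ B * μ A)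
    (hX : ∀ x ∈ A, ∫⁻ y, farKer (n / q) r (x - y) * h y ≤ X) : τ ≤ B + X := by
  have h1 : τ * μ A ≤ (B + X) * μ A := by
    calc τ * μ A = ∫⁻ _ in A, τ ∂μ := by rw [lintegral_const, Measure.restrict_apply_univ]
      _ ≤ ∫⁻ x in A, ((∫⁻ y, nearKer (n / q) r (x - y) * h y) + X) ∂μ := by
          refine setLIntegral_mono' hA fun x hx => (hτ x hx).trans ?_
          refine le_trans (le_of_eq ?_) (add_le_add le_rfl (hX x hx))
          unfold rieszPot
          rw [← lintegral_add_left (by fun_prop)]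
          refine lintegral_congr fun y => ?_
          rw [powKer_eq_near_add_far _ r, add_mul]
      _ ≤ _ := by
          rw [lintegral_add_right _ measurable_const, lintegral_const,
            Measure.restrict_apply_univ, add_mul]
          gcongr
  exact (ENNReal.mul_le_mul_iff_left hA0 hA1).1 h1

/-- Bounds for the level sets of the potential, in terms of the concentration of `h`. -/
theorem level_set_estimates {n : ℕ} (hn : 0 < n) {p q : ℝ} (hpq : q.HolderConjugate p)
    {μ : Measure (E n)} [IsFiniteMeasure μ] {C lam : ℝ} (hC : 0 ≤ C) (hlam : 0 < lam)
    (hμ : ∀ (x : E n) (r : ℝ), 0 < r → μ (ball x r) ≤ ENNReal.ofReal (C * r ^ lam)) :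
    ∃ b : ℝ, 0 ≤ b ∧ ∀ (Ω : Set (E n)) (R : ℝ), (∀ x ∈ Ω, ∀ y ∈ Ω, dist x y < R) →
      ∀ h : E n → ℝ≥0∞, Measurable h → (∀ y ∉ Ω, h y = 0) → ∫⁻ y, h y ^ p ≤ 1 →
      ∃ l : ℝ → ℝ, (∀ r, 0 < r → 0 ≤ l r ∧ l r ≤ 1) ∧
        (∀ r A τ, 0 < r → r ≤ R → 0 ≤ τ → MeasurableSet A → A ⊆ Ω →
          μ A = ENNReal.ofReal (r ^ lam) →
          (∀ x ∈ A, ENNReal.ofReal τ ≤ rieszPot (n / q) h x) →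
          τ ≤ (sphereArea n * Real.log (R / r)) ^ (1 / q) * (1 - l r) ^ (1 / p) +
            b * l r ^ (1 / p)) ∧
        (∀ r s A τ, 0 < r → r ≤ s → s ≤ R → 0 ≤ τ → MeasurableSet A → A ⊆ Ω →
          μ A = ENNReal.ofReal (r ^ lam) →
          (∀ x ∈ A, ENNReal.ofReal τ ≤ rieszPot (n / q) h x) →
          τ ≤ (sphereArea n * Real.log (R / s)) ^ (1 / q) +
            (sphereArea n * Real.log (s / r)) ^ (1 / q) * l s ^ (1 / p) + b * l r ^ (1 / p)) := by
  have hp0 : 0 < p := hpq.symm.pos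
  have hq0 : 0 < q := hpq.pos
  have hω := sphereArea_pos hn
  obtain ⟨b₀, hb₀, hnear⟩ := near_average_le hn hpq hC hlam hμ
  set v := volume.real (ball (0 : E n) 1) with hv
  refine ⟨b₀ + v ^ (1 / q), by positivity, ?_⟩
  intro Ω R hR h hh hΩ h1
  have hfin : ∫⁻ y, h y ^ p ≠ ⊤ := ne_top_of_le_ne_top ENNReal.one_ne_top h1
  have htop : ∀ r : ℝ, ∃ (G : Set (E n)) (γ : ℝ≥0∞), 0 < r → MeasurableSet G ∧
      volume G = volume (ball (0 : E n) r) ∧ (∀ y ∉ G, h y ≤ γ) ∧ ∀ y ∈ G, γ ≤ h y := by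
    intro r
    by_cases hr : 0 < r
    · obtain ⟨G, γ, hG⟩ := exists_top_set hn hp0 hh hfin (V := volume (ball (0 : E n) r))
        (by finiteness)
      exact ⟨G, γ, fun _ => hG⟩
    · exact ⟨∅, 0, fun h => absurd h hr⟩
  choose G γ hG using htop
  set l' : ℝ → ℝ≥0∞ := fun r => ∫⁻ y in G r, h y ^ p with hl'
  have hl1 : ∀ r, l' r ≤ 1 := fun r => (setLIntegral_le_lintegral _ _).trans h1
  have hlf : ∀ r, l' r ≠ ⊤ := fun r => ne_top_of_le_ne_top ENNReal.one_ne_top (hl1 r)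
  have hlr : ∀ r, l' r ^ (1 / p) = ENNReal.ofReal ((l' r).toReal ^ (1 / p)) := by
    intro r
    rw [← ENNReal.ofReal_rpow_of_nonneg ENNReal.toReal_nonneg (by positivity),
      ENNReal.ofReal_toReal (hlf r)]
  have hlt1 : ∀ r, (l' r).toReal ≤ 1 := fun r => by
    have := ENNReal.toReal_mono ENNReal.one_ne_top (hl1 r)
    simpa using this
  have hballs : ∀ (r : ℝ) (x : E n), 0 < r → ∫⁻ y in ball x r, h y ^ p ≤ l' r := by
    intro r x hr
    obtain ⟨hGm, hGv, hGc, hGi⟩ := hG r hr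
    refine lintegral_le_of_top_set (c := γ r ^ p) hGm measurableSet_ball ?_ ?_ ?_ ?_
    · rw [hGv, Measure.addHaar_ball_center]
    · rw [hGv]
      finiteness
    · exact fun y hy => ENNReal.rpow_le_rpow (hGc y hy) hp0.le
    · exact fun y hy => ENNReal.rpow_le_rpow (hGi y hy) hp0.le
  have hA01 : ∀ (r : ℝ) (A : Set (E n)), 0 < r → μ A = ENNReal.ofReal (r ^ lam) → μ A ≠ 0 := by
    intro r A hr hA
    rw [hA]
    exact (ENNReal.ofReal_pos.2 (by positivity)).ne'
  refine ⟨fun r => (l' r).toReal, fun r _ => ⟨ENNReal.toReal_nonneg, hlt1 r⟩, ?_, ?_⟩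
  · intro r A τ hr hrR hτ0 hAm hAΩ hA hτ
    have hlog : 0 ≤ Real.log (R / r) := Real.log_nonneg ((one_le_div hr).2 hrR)
    obtain ⟨hGm, hGv, hGc, hGi⟩ := hG r hr
    have hX : ∀ x ∈ A, ∫⁻ y, farKer (n / q) r (x - y) * h y ≤
        ENNReal.ofReal (v ^ (1 / q)) * l' r ^ (1 / p) +
        ENNReal.ofReal ((sphereArea n * Real.log (R / r)) ^ (1 / q)) *
          ENNReal.ofReal ((1 - (l' r).toReal) ^ (1 / p)) := by
      intro x hx
      have hsplit : ∫⁻ y, farKer (n / q) r (x - y) * h y =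
          (∫⁻ y, farKer (n / q) r (x - y) * (G r).indicator h y) +
            ∫⁻ y, farKer (n / q) r (x - y) * (G r)ᶜ.indicator h y := by
        rw [← lintegral_add_left (by
          have := hh.indicator hGm
          fun_prop)]
        refine lintegral_congr fun y => ?_
        rw [← mul_add, ← Pi.add_apply, indicator_self_add_compl]
      rw [hsplit]
      refine add_le_add (far_top_le hpq hh hr hGm hGv x) ?_
      have hΩ' : ∀ y ∉ Ω, (G r)ᶜ.indicator h y = 0 := by
        intro y hy
        by_cases hy' : y ∈ (G r)ᶜ
        · rw [indicator_of_mem hy', hΩ y hy]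
        · rw [indicator_of_notMem hy']
      refine (lintegral_mono fun y => farKer_mul_le hR hΩ' _ r (hAΩ hx) y).trans ?_
      refine (annulus_potential_le hn hpq hr hrR (hh.indicator hGm.compl) x).trans ?_
      refine mul_le_mul_right ?_ _
      rw [← ENNReal.ofReal_rpow_of_nonneg (sub_nonneg.2 (hlt1 r)) (by positivity)]
      refine ENNReal.rpow_le_rpow ?_ (by positivity)
      refine (setLIntegral_le_lintegral _ _).trans ?_
      rw [lintegral_indicator_rpow hp0 hGm.compl]
      rw [ENNReal.ofReal_sub _ ENNReal.toReal_nonneg, ENNReal.ofReal_one,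
        ENNReal.ofReal_toReal (hlf r)]
      refine ENNReal.le_sub_of_add_le_left (hlf r) ?_
      rw [hl', lintegral_add_compl _ hGm]
      exact h1
    have := le_of_le_rieszPot hh hAm (hA01 r A hr hA) (by finiteness) hτ
      (hnear h A (G r) (γ r) r hh hr hA hGm hGv hGc hGi) hX
    change ENNReal.ofReal τ ≤ ENNReal.ofReal b₀ * l' r ^ (1 / p) + _ at this
    rw [hlr, ← ENNReal.ofReal_mul (by positivity), ← ENNReal.ofReal_mul (by positivity),
      ← ENNReal.ofReal_mul (by positivity), ← ENNReal.ofReal_add (by positivity) (by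
        have := sub_nonneg.2 (hlt1 r)
        positivity), ← ENNReal.ofReal_add (by positivity) (by
        have := sub_nonneg.2 (hlt1 r)
        positivity)] at this
    have h3 := (ENNReal.ofReal_le_ofReal_iff (by
      have := sub_nonneg.2 (hlt1 r)
      positivity)).1 this
    refine h3.trans (le_of_eq ?_)
    ring
  · intro r s A τ hr hrs hsR hτ0 hAm hAΩ hA hτ
    have hs : 0 < s := hr.trans_le hrs
    have hlog1 : 0 ≤ Real.log (R / s) := Real.log_nonneg ((one_le_div hs).2 hsR)
    have hlog2 : 0 ≤ Real.log (s / r) := Real.log_nonneg ((one_le_div hr).2 hrs)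
    obtain ⟨hGm, hGv, hGc, hGi⟩ := hG r hr
    have hX : ∀ x ∈ A, ∫⁻ y, farKer (n / q) r (x - y) * h y ≤
        ENNReal.ofReal ((sphereArea n * Real.log (s / r)) ^ (1 / q)) * l' s ^ (1 / p) +
        ENNReal.ofReal ((sphereArea n * Real.log (R / s)) ^ (1 / q)) * 1 := by
      intro x hx
      refine (lintegral_mono fun y => farKer_mul_le hR hΩ _ r (hAΩ hx) y).trans ?_
      refine (lintegral_mono fun y => mul_le_mul_left (annulusKer_le_add _ r s R _) _).trans ?_
      simp only [add_mul]
      rw [lintegral_add_left (by fun_prop)]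
      refine add_le_add ((annulus_potential_le hn hpq hr hrs hh x).trans ?_)
        ((annulus_potential_le hn hpq hs hsR hh x).trans ?_)
      · exact mul_le_mul_right (ENNReal.rpow_le_rpow (hballs s x hs) (by positivity)) _
      · refine mul_le_mul_right ?_ _
        have := ENNReal.rpow_le_rpow ((setLIntegral_le_lintegral (ball x R) _).trans h1)
          (by positivity : 0 ≤ 1 / p)
        rwa [ENNReal.one_rpow] at this
    have := le_of_le_rieszPot hh hAm (hA01 r A hr hA) (by finiteness) hτ
      (hnear h A (G r) (γ r) r hh hr hA hGm hGv hGc hGi) hX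
    change ENNReal.ofReal τ ≤ ENNReal.ofReal b₀ * l' r ^ (1 / p) + _ at this
    rw [hlr, hlr, mul_one, ← ENNReal.ofReal_mul (by positivity),
      ← ENNReal.ofReal_mul (by positivity), ← ENNReal.ofReal_add (by positivity) (by positivity),
      ← ENNReal.ofReal_add (by positivity) (by positivity)] at this
    have h3 := (ENNReal.ofReal_le_ofReal_iff (by positivity)).1 this
    refine h3.trans ?_
    have : 0 ≤ v ^ (1 / q) * (l' r).toReal ^ (1 / p) := by positivity
    linarith

/-- Adams' inequality for Riesz potentials with the sharp constant. -/
theorem exp_rieszPot_le {n : ℕ} (hn : 0 < n) {p q : ℝ} (hpq : q.HolderConjugate p)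
    {μ : Measure (E n)} [IsFiniteMeasure μ] {C lam : ℝ} (hC : 0 ≤ C) (hlam : 0 < lam)
    (hμ : ∀ (x : E n) (r : ℝ), 0 < r → μ (ball x r) ≤ ENNReal.ofReal (C * r ^ lam))
    {Ω : Set (E n)} (hΩm : MeasurableSet Ω) (hΩb : Bornology.IsBounded Ω) :
    ∃ C' : ℝ, ∀ h : E n → ℝ≥0∞, Measurable h → (∀ y ∉ Ω, h y = 0) → ∫⁻ y, h y ^ p ≤ 1 →
      ∫⁻ x in Ω, ENNReal.ofReal (Real.exp (lam / sphereArea n *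
        (rieszPot (n / q) h x).toReal ^ q)) ∂μ ≤ ENNReal.ofReal C' := by
  classical
  have hp0 : 0 < p := hpq.symm.pos
  have hq0 : 0 < q := hpq.pos
  have hω := sphereArea_pos hn
  obtain ⟨b, hb, hlev⟩ := level_set_estimates hn hpq hC hlam hμ
  obtain ⟨C₀, hC₀⟩ := adams_garsia hpq (b := b / sphereArea n ^ (1 / q)) (lam := lam)
    (by positivity) hlam
  obtain ⟨R, hR0, hRΩ, hRμ⟩ : ∃ R : ℝ, 0 < R ∧ (∀ x ∈ Ω, ∀ y ∈ Ω, dist x y < R) ∧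
      μ.real univ < R ^ lam := by
    obtain ⟨D, hD⟩ := Metric.isBounded_iff.1 hΩb
    refine ⟨max (D + 1) ((μ.real univ + 1) ^ (1 / lam)), by
      have := measureReal_nonneg (μ := μ) (s := univ)
      positivity, fun x hx y hy => ?_, ?_⟩
    · refine lt_of_lt_of_le ?_ (le_max_left _ _)
      linarith [hD hx hy]
    · have h0 := measureReal_nonneg (μ := μ) (s := univ)
      calc μ.real univ < μ.real univ + 1 := by linarith
        _ = ((μ.real univ + 1) ^ (1 / lam)) ^ lam := by
          rw [← Real.rpow_mul (by positivity), one_div_mul_cancel hlam.ne', Real.rpow_one]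
        _ ≤ _ := Real.rpow_le_rpow (by positivity) (le_max_right _ _) hlam.le
  refine ⟨Real.exp lam * R ^ lam * C₀, fun h hh hΩ h1 => ?_⟩
  obtain ⟨l, hl, hl1, hl2⟩ := hlev Ω R hRΩ h hh hΩ h1
  set Y : E n → ℝ := fun x => (rieszPot (n / q) h x).toReal ^ q / sphereArea n with hY
  have hYm : Measurable Y := ((measurable_rieszPot _ hh).ennreal_toReal.pow_const q).div_const _
  have hY0 : ∀ x, 0 ≤ Y x := fun x => by positivity
  set A : ℕ → Set (E n) := fun k => Ω ∩ {x | (k : ℝ) ≤ Y x} with hA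
  have hAm : ∀ k, MeasurableSet (A k) := fun k => hΩm.inter (measurableSet_le measurable_const hYm)
  set τ : ℕ → ℝ := fun k => (sphereArea n * k) ^ (1 / q) with hτ
  have hAτ : ∀ k, ∀ x ∈ A k, ENNReal.ofReal (τ k) ≤ rieszPot (n / q) h x := by
    intro k x hx
    refine ENNReal.ofReal_le_of_le_toReal ?_
    have h2 : sphereArea n * k ≤ (rieszPot (n / q) h x).toReal ^ q := by
      have := hx.2
      simp only [hY, mem_ofPred_eq] at this
      rw [le_div_iff₀ hω] at this
      linarith
    have h3 := Real.rpow_le_rpow (by positivity) h2 (by positivity : 0 ≤ 1 / q)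
    rwa [← Real.rpow_mul ENNReal.toReal_nonneg, mul_one_div_cancel hq0.ne', Real.rpow_one] at h3
  calc ∫⁻ x in Ω, ENNReal.ofReal (Real.exp (lam / sphereArea n *
        (rieszPot (n / q) h x).toReal ^ q)) ∂μ
      ≤ ∫⁻ x in Ω, ∑' k : ℕ, (A k).indicator
          (fun _ => ENNReal.ofReal (Real.exp (lam * (k + 1)))) x ∂μ := by
        refine setLIntegral_mono' hΩm fun x hx => ?_
        refine le_trans ?_ (ENNReal.le_tsum ⌊Y x⌋₊)
        rw [indicator_of_mem (show x ∈ A ⌊Y x⌋₊ from ⟨hx, Nat.floor_le (hY0 x)⟩)]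
        refine ENNReal.ofReal_le_ofReal (Real.exp_le_exp.2 ?_)
        have h2 : lam / sphereArea n * (rieszPot (n / q) h x).toReal ^ q = lam * Y x := by
          simp only [hY]
          ring
        rw [h2]
        exact mul_le_mul_of_nonneg_left (Nat.lt_floor_add_one _).le hlam.le
    _ = ∑' k : ℕ, ENNReal.ofReal (Real.exp (lam * (k + 1))) * μ (A k) := by
        rw [lintegral_tsum fun k => (measurable_const.indicator (hAm k)).aemeasurable]
        congr 1
        ext k
        rw [lintegral_indicator_const (hAm k), Measure.restrict_apply (hAm k),
          inter_eq_self_of_subset_left inter_subset_left]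
    _ ≤ _ := by
        rw [ENNReal.tsum_eq_iSup_sum]
        refine iSup_le fun F => ?_
        set K := F.filter fun k => μ (A k) ≠ 0 with hK
        have hK0 : ∀ k ∈ K, 0 < μ.real (A k) := by
          intro k hk
          rw [hK, Finset.mem_filter] at hk
          exact ENNReal.toReal_pos hk.2 (by finiteness)
        set r : ℕ → ℝ := fun k => μ.real (A k) ^ (1 / lam) with hr
        have hr0 : ∀ k ∈ K, 0 < r k := fun k hk => Real.rpow_pos_of_pos (hK0 k hk) _
        have hrl : ∀ k, r k ^ lam = μ.real (A k) := by
          intro k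
          rw [hr, ← Real.rpow_mul measureReal_nonneg, one_div_mul_cancel hlam.ne', Real.rpow_one]
        have hrA : ∀ k, μ (A k) = ENNReal.ofReal (r k ^ lam) := by
          intro k
          rw [hrl, ofReal_measureReal (by finiteness)]
        have hrR : ∀ k ∈ K, r k < R := by
          intro k hk
          refine (Real.rpow_lt_rpow_iff (hr0 k hk).le hR0.le hlam).1 ?_
          rw [hrl]
          exact (measureReal_mono (subset_univ _) (by finiteness)).trans_lt hRμ
        have hrmono : ∀ j k : ℕ, j ≤ k → r k ≤ r j := by
          intro j k hjk
          refine Real.rpow_le_rpow measureReal_nonneg (measureReal_mono ?_ (by finiteness))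
            (by positivity)
          refine inter_subset_inter_right _ fun x hx => ?_
          have : (j : ℝ) ≤ k := by exact_mod_cast hjk
          exact this.trans hx
        set T : ℕ → ℝ := fun k => Real.log (R / r k) with hT
        have hsqrt : 0 < sphereArea n ^ (1 / q) := by positivity
        have key := hC₀ K T (fun k => l (r k)) ?_ ?_ ?_ ?_ ?_
        · calc ∑ k ∈ F, ENNReal.ofReal (Real.exp (lam * (k + 1))) * μ (A k)
              = ∑ k ∈ K, ENNReal.ofReal (Real.exp (lam * (k + 1))) * μ (A k) := by
                rw [hK, Finset.sum_filter]
                refine Finset.sum_congr rfl fun k _ => ?_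
                by_cases h0 : μ (A k) = 0
                · simp [h0]
                · simp [h0]
            _ = ∑ k ∈ K, ENNReal.ofReal (Real.exp lam * R ^ lam * Real.exp (-lam * (T k - k))) := by
                refine Finset.sum_congr rfl fun k hk => ?_
                rw [hrA, ← ENNReal.ofReal_mul (Real.exp_pos _).le]
                congr 1
                have h3 : Real.exp (-lam * (T k - k)) = (r k / R) ^ lam * Real.exp (lam * k) := by
                  rw [Real.rpow_def_of_pos (div_pos (hr0 k hk) hR0), ← Real.exp_add]
                  congr 1
                  simp only [hT]
                  rw [← inv_div, Real.log_inv]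
                  ring
                rw [h3, Real.div_rpow (hr0 k hk).le hR0.le, mul_add, mul_one, Real.exp_add]
                have : R ^ lam ≠ 0 := by positivity
                field_simp
            _ = ENNReal.ofReal (Real.exp lam * R ^ lam * ∑ k ∈ K, Real.exp (-lam * (T k - k))) := by
                rw [Finset.mul_sum, ENNReal.ofReal_sum_of_nonneg fun k _ => by positivity]
            _ ≤ _ := ENNReal.ofReal_le_ofReal (mul_le_mul_of_nonneg_left key (by positivity))
        · intro j hj k hk hjk
          refine Real.log_le_log (div_pos hR0 (hr0 j hj)) ?_
          exact div_le_div_of_nonneg_left hR0.le (hr0 k hk) (hrmono j k hjk)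
        · intro k hk
          exact Real.log_pos ((one_lt_div (hr0 k hk)).2 (hrR k hk))
        · exact fun k hk => hl _ (hr0 k hk)
        · intro k hk
          have h3 := hl1 (r k) (A k) (τ k) (hr0 k hk) (hrR k hk).le (by positivity) (hAm k)
            inter_subset_left (hrA k) (hAτ k)
          have hlog : 0 ≤ T k := Real.log_nonneg ((one_le_div (hr0 k hk)).2 (hrR k hk).le)
          simp only [hτ] at h3
          rw [Real.mul_rpow hω.le (Nat.cast_nonneg k)] at h3
          change _ ≤ (sphereArea n * T k) ^ (1 / q) * _ + _ at h3
          rw [Real.mul_rpow hω.le hlog] at h3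
          have h4 : b * l (r k) ^ (1 / p) = sphereArea n ^ (1 / q) *
              (b / sphereArea n ^ (1 / q) * l (r k) ^ (1 / p)) := by field_simp
          rw [h4, mul_assoc, ← mul_add] at h3
          exact le_of_mul_le_mul_left h3 hsqrt
        · intro j hj k hk hjk
          have h3 := hl2 (r k) (r j) (A k) (τ k) (hr0 k hk) (hrmono j k hjk.le) (hrR j hj).le
            (by positivity) (hAm k) inter_subset_left (hrA k) (hAτ k)
          have hlog : 0 ≤ T j := Real.log_nonneg ((one_le_div (hr0 j hj)).2 (hrR j hj).le)
          have hTT : Real.log (r j / r k) = T k - T j := by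
            simp only [hT]
            rw [Real.log_div hR0.ne' (hr0 k hk).ne', Real.log_div hR0.ne' (hr0 j hj).ne',
              Real.log_div (hr0 j hj).ne' (hr0 k hk).ne']
            ring
          have hlog2 : 0 ≤ T k - T j := by
            rw [← hTT]
            exact Real.log_nonneg ((one_le_div (hr0 k hk)).2 (hrmono j k hjk.le))
          simp only [hτ] at h3
          rw [Real.mul_rpow hω.le (Nat.cast_nonneg k), hTT] at h3
          change _ ≤ (sphereArea n * T j) ^ (1 / q) + _ + _ at h3
          rw [Real.mul_rpow hω.le hlog, Real.mul_rpow hω.le hlog2] at h3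
          have h4 : b * l (r k) ^ (1 / p) = sphereArea n ^ (1 / q) *
              (b / sphereArea n ^ (1 / q) * l (r k) ^ (1 / p)) := by field_simp
          rw [h4, mul_assoc, ← mul_add, ← mul_add] at h3
          exact le_of_mul_le_mul_left h3 hsqrt

/-- The classical partial derivative `∂_i φ`. -/
def pd {n : ℕ} (i : Fin n) (φ : E n → ℝ) (x : E n) : ℝ :=
  fderiv ℝ φ x (EuclideanSpace.single i (1 : ℝ))

/-- The classical positive Laplacian. -/
def cLap {n : ℕ} (φ : E n → ℝ) (x : E n) : ℝ := -∑ i : Fin n, pd i (pd i φ) x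

theorem ContDiff.pd {n : ℕ} {φ : E n → ℝ} (h : ContDiff ℝ ∞ φ) (i : Fin n) :
    ContDiff ℝ ∞ (pd i φ) := by
  unfold _root_.pd
  exact (h.fderiv_right (m := ∞) le_rfl).clm_apply contDiff_const

theorem ContDiff.cLap {n : ℕ} {φ : E n → ℝ} (h : ContDiff ℝ ∞ φ) : ContDiff ℝ ∞ (cLap φ) := by
  unfold _root_.cLap
  exact (ContDiff.sum fun i _ => (h.pd i).pd i).neg

theorem pd_congr {n : ℕ} {φ ψ : E n → ℝ} {x : E n} (h : φ =ᶠ[𝓝 x] ψ) (i : Fin n) :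
    pd i φ =ᶠ[𝓝 x] pd i ψ := by
  filter_upwards [h.fderiv (𝕜 := ℝ)] with y hy
  simp only [pd, hy]

theorem cLap_congr {n : ℕ} {φ ψ : E n → ℝ} {x : E n} (h : φ =ᶠ[𝓝 x] ψ) :
    cLap φ =ᶠ[𝓝 x] cLap ψ := by
  have : ∀ᶠ y in 𝓝 x, ∀ i : Fin n, pd i (pd i φ) y = pd i (pd i ψ) y :=
    eventually_all.2 fun i => pd_congr (pd_congr h i) i
  filter_upwards [this] with y hy
  simp only [cLap, hy]

theorem pd_zero {n : ℕ} (i : Fin n) : pd i (0 : E n → ℝ) = 0 := by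
  ext x
  simp [pd]

theorem cLap_zero {n : ℕ} : cLap (0 : E n → ℝ) = 0 := by
  ext x
  simp [cLap, pd_zero]

theorem tsupport_subset_of_local {n : ℕ} {φ ψ : E n → ℝ}
    (h : ∀ x, φ =ᶠ[𝓝 x] 0 → ψ x = 0) : tsupport ψ ⊆ tsupport φ := by
  refine closure_minimal (fun x hx => ?_) (isClosed_tsupport φ)
  by_contra hcon
  exact hx (h x (notMem_tsupport_iff_eventuallyEq.1 hcon))

theorem IsTestFunction.of_tsupport_subset {n : ℕ} {U : Set (E n)} {φ ψ : E n → ℝ}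
    (hφ : IsTestFunction U φ) (hψ : ContDiff ℝ ∞ ψ) (h : tsupport ψ ⊆ tsupport φ) :
    IsTestFunction U ψ :=
  ⟨hψ, IsCompact.of_isClosed_subset hφ.2.1 (isClosed_tsupport ψ) h, h.trans hφ.2.2⟩

theorem IsTestFunction.pd {n : ℕ} {U : Set (E n)} {φ : E n → ℝ} (hφ : IsTestFunction U φ)
    (i : Fin n) : IsTestFunction U (pd i φ) := by
  refine hφ.of_tsupport_subset (hφ.1.pd i) (tsupport_subset_of_local fun x hx => ?_)
  have := (pd_congr hx i).self_of_nhds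
  rw [this, pd_zero]
  rfl

theorem IsTestFunction.cLap {n : ℕ} {U : Set (E n)} {φ : E n → ℝ} (hφ : IsTestFunction U φ) :
    IsTestFunction U (cLap φ) := by
  refine hφ.of_tsupport_subset hφ.1.cLap (tsupport_subset_of_local fun x hx => ?_)
  have := (cLap_congr hx).self_of_nhds
  rw [this, cLap_zero]
  rfl

theorem IsTestFunction.iterate_cLap {n : ℕ} {U : Set (E n)} {φ : E n → ℝ}
    (hφ : IsTestFunction U φ) (k : ℕ) : IsTestFunction U (_root_.cLap^[k] φ) := by
  induction k with
  | zero => exact hφ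
  | succ k ih =>
    rw [Function.iterate_succ_apply']
    exact ih.cLap

theorem IsTestFunction.continuous {n : ℕ} {U : Set (E n)} {φ : E n → ℝ}
    (hφ : IsTestFunction U φ) : Continuous φ := hφ.1.continuous

theorem IsTestFunction.mono {n : ℕ} {U V : Set (E n)} {φ : E n → ℝ}
    (hφ : IsTestFunction U φ) (h : U ⊆ V) : IsTestFunction V φ :=
  ⟨hφ.1, hφ.2.1, hφ.2.2.trans h⟩

theorem integral_mul_pd {n : ℕ} {f w : E n → ℝ} (hf : ContDiff ℝ ∞ f)
    (hw : ContDiff ℝ ∞ w) (hc : HasCompactSupport w) (i : Fin n) :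
    ∫ x, f x * pd i w x = -∫ x, pd i f x * w x := by
  have hwt : IsTestFunction univ w := ⟨hw, hc, subset_univ _⟩
  have hwi := hwt.pd i
  unfold pd
  refine integral_mul_fderiv_eq_neg_fderiv_mul_of_integrable ?_ ?_ ?_
    (fun x _ => hf.differentiable (by simp) x) (fun x _ => hw.differentiable (by simp) x)
  · exact ((hf.pd i).continuous.mul hw.continuous).integrable_of_hasCompactSupport hc.mul_left
  · exact (hf.continuous.mul hwi.continuous).integrable_of_hasCompactSupport hwi.2.1.mul_left
  · exact (hf.continuous.mul hw.continuous).integrable_of_hasCompactSupport hc.mul_left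

theorem integral_mul_cLap {n : ℕ} {f w : E n → ℝ} (hf : ContDiff ℝ ∞ f)
    (hw : ContDiff ℝ ∞ w) (hc : HasCompactSupport w) :
    ∫ x, f x * cLap w x = ∫ x, cLap f x * w x := by
  have hwt : IsTestFunction univ w := ⟨hw, hc, subset_univ _⟩
  unfold cLap
  simp only [mul_neg, neg_mul, Finset.mul_sum, Finset.sum_mul]
  rw [integral_neg, integral_neg, integral_finsetSum, integral_finsetSum]
  · congr 1
    refine Finset.sum_congr rfl fun i _ => ?_
    rw [integral_mul_pd hf (hw.pd i) (hwt.pd i).2.1 i, integral_mul_pd (hf.pd i) hw hc i, neg_neg]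
  · intro i _
    exact (((hf.pd i).pd i).continuous.mul hw.continuous).integrable_of_hasCompactSupport
      hc.mul_left
  · intro i _
    exact (hf.continuous.mul ((hwt.pd i).pd i).continuous).integrable_of_hasCompactSupport
      ((hwt.pd i).pd i).2.1.mul_left

/-- Partial derivatives of a function of `|x - x₀|² + δ`. -/
theorem pd_radial {n : ℕ} (x₀ : E n) {δ : ℝ} (hδ : 0 < δ) {F : ℝ → ℝ}
    (hF : ContDiffOn ℝ ∞ F (Ioi 0)) (i : Fin n) :
    pd i (fun x => F (‖x - x₀‖ ^ 2 + δ)) =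
      fun x => 2 * (x i - x₀ i) * deriv F (‖x - x₀‖ ^ 2 + δ) := by
  ext x
  have hq : HasFDerivAt (fun x : E n => ‖x - x₀‖ ^ 2 + δ)
      (2 • (innerSL ℝ (x - x₀)).comp (ContinuousLinearMap.id ℝ (E n))) x :=
    (((hasFDerivAt_id x).sub_const x₀).norm_sq).add_const δ
  have hpos : 0 < ‖x - x₀‖ ^ 2 + δ := by positivity
  have hFd : HasDerivAt F (deriv F (‖x - x₀‖ ^ 2 + δ)) (‖x - x₀‖ ^ 2 + δ) :=
    ((hF.differentiableOn (by simp)).differentiableAt (Ioi_mem_nhds hpos)).hasDerivAt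
  have := hFd.comp_hasFDerivAt x hq
  unfold pd
  change fderiv ℝ (F ∘ fun x : E n => ‖x - x₀‖ ^ 2 + δ) x _ = _
  rw [this.fderiv]
  simp [EuclideanSpace.inner_single_right]
  ring

theorem contDiff_radial {n : ℕ} (x₀ : E n) {δ : ℝ} (hδ : 0 < δ) {F : ℝ → ℝ}
    (hF : ContDiffOn ℝ ∞ F (Ioi 0)) : ContDiff ℝ ∞ fun x : E n => F (‖x - x₀‖ ^ 2 + δ) := by
  have hq : ContDiff ℝ ∞ fun x : E n => ‖x - x₀‖ ^ 2 + δ :=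
    ((contDiff_id.sub contDiff_const).norm_sq ℝ).add contDiff_const
  rw [← contDiffOn_univ]
  exact hF.comp hq.contDiffOn fun x _ => by
    have : 0 < ‖x - x₀‖ ^ 2 + δ := by positivity
    exact this

theorem ContDiffOn.deriv_Ioi {F : ℝ → ℝ} (hF : ContDiffOn ℝ ∞ F (Ioi 0)) :
    ContDiffOn ℝ ∞ (deriv F) (Ioi 0) :=
  hF.deriv_of_isOpen isOpen_Ioi (m := ∞) le_rfl

theorem pd_mul_coord {n : ℕ} (x₀ : E n) {g : E n → ℝ} (hg : Differentiable ℝ g) (i : Fin n)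
    (x : E n) : pd i (fun x => (x i - x₀ i) * g x) x = g x + (x i - x₀ i) * pd i g x := by
  have h1 : HasFDerivAt (fun x : E n => x i - x₀ i) (EuclideanSpace.proj i : E n →L[ℝ] ℝ) x :=
    (EuclideanSpace.proj i : E n →L[ℝ] ℝ).hasFDerivAt.sub_const _
  unfold pd
  change fderiv ℝ ((fun x : E n => x i - x₀ i) * g) x _ = _
  rw [(h1.mul (hg x).hasFDerivAt).fderiv]
  simp
  ring

/-- The divergence of `(x - x₀) F(|x - x₀|² + δ)`. -/
theorem sum_pd_coord_radial {n : ℕ} (x₀ : E n) {δ : ℝ} (hδ : 0 < δ) {F : ℝ → ℝ}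
    (hF : ContDiffOn ℝ ∞ F (Ioi 0)) (x : E n) :
    ∑ i : Fin n, pd i (fun x => (x i - x₀ i) * F (‖x - x₀‖ ^ 2 + δ)) x =
      n * F (‖x - x₀‖ ^ 2 + δ) + 2 * ‖x - x₀‖ ^ 2 * deriv F (‖x - x₀‖ ^ 2 + δ) := by
  have h1 : ∀ i : Fin n, pd i (fun x => (x i - x₀ i) * F (‖x - x₀‖ ^ 2 + δ)) x =
      F (‖x - x₀‖ ^ 2 + δ) + (x i - x₀ i) ^ 2 * (2 * deriv F (‖x - x₀‖ ^ 2 + δ)) := by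
    intro i
    rw [pd_mul_coord x₀ ((contDiff_radial x₀ hδ hF).differentiable (by simp)) i x,
      pd_radial x₀ hδ hF i]
    ring
  simp only [h1]
  rw [Finset.sum_add_distrib, ← Finset.sum_mul]
  have h2 : ‖x - x₀‖ ^ 2 = ∑ i : Fin n, (x i - x₀ i) ^ 2 := by
    rw [EuclideanSpace.real_norm_sq_eq]
    simp
  rw [← h2]
  simp
  ring

theorem cLap_radial {n : ℕ} (x₀ : E n) {δ : ℝ} (hδ : 0 < δ) {F : ℝ → ℝ}
    (hF : ContDiffOn ℝ ∞ F (Ioi 0)) (x : E n) :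
    cLap (fun x => F (‖x - x₀‖ ^ 2 + δ)) x =
      -(2 * n * deriv F (‖x - x₀‖ ^ 2 + δ) +
        4 * ‖x - x₀‖ ^ 2 * deriv (deriv F) (‖x - x₀‖ ^ 2 + δ)) := by
  have h1 := sum_pd_coord_radial x₀ hδ (F := fun s => 2 * deriv F s)
    (contDiffOn_const.mul hF.deriv_Ioi) x
  have h2 : deriv (fun s => 2 * deriv F s) (‖x - x₀‖ ^ 2 + δ) =
      2 * deriv (deriv F) (‖x - x₀‖ ^ 2 + δ) := deriv_const_mul_field 2
  rw [h2] at h1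
  unfold cLap
  have h3 : ∀ i : Fin n, pd i (fun x => F (‖x - x₀‖ ^ 2 + δ)) =
      fun x => (x i - x₀ i) * (2 * deriv F (‖x - x₀‖ ^ 2 + δ)) := by
    intro i
    rw [pd_radial x₀ hδ hF i]
    ext x
    ring
  simp only [h3]
  rw [h1]
  ring

theorem integrable_norm_rpow_mul {n : ℕ} {c : ℝ} (hc : 0 < c) (hcn : c < n) {g : E n → ℝ}
    (hg : Continuous g) (hgc : HasCompactSupport g) (x₀ : E n) :
    Integrable fun y => ‖y - x₀‖ ^ (-c) * g y := by
  have hn : 0 < n := by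
    have := hc.trans hcn
    exact_mod_cast this
  obtain ⟨M, hM⟩ := hgc.exists_bound_of_continuous hg
  have hM0 : 0 ≤ M := (norm_nonneg _).trans (hM x₀)
  obtain ⟨r, hr0, hr⟩ : ∃ r : ℝ, 0 < r ∧ tsupport g ⊆ ball x₀ r := by
    obtain ⟨r, hr⟩ := hgc.isBounded.subset_ball x₀
    exact ⟨max r 1, by positivity, hr.trans (ball_subset_ball (le_max_left _ _))⟩
  obtain ⟨C, hC, h⟩ := lintegral_nearKer_le (μ := (volume : Measure (E n))) (lam := n)
    (a := c) (C := volume.real (ball (0 : E n) 1)) measureReal_nonneg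
    (fun x r hr => (volume_ball_le x hr).le) hc hcn
  refine ⟨(Measurable.mul (by fun_prop) hg.measurable).aestronglyMeasurable, ?_⟩
  calc ∫⁻ y, ‖‖y - x₀‖ ^ (-c) * g y‖ₑ ≤ ∫⁻ y, nearKer c r (y - x₀) * ENNReal.ofReal M := by
        refine lintegral_mono fun y => ?_
        rw [enorm_mul]
        by_cases hy : y ∈ ball x₀ r
        · unfold nearKer powKer
          rw [indicator_of_mem (by rwa [mem_ball_zero_iff, ← mem_ball_iff_norm])]
          refine mul_le_mul' ?_ ?_
          · rw [Real.enorm_of_nonneg (by positivity)]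
          · rw [← ofReal_norm]
            exact ENNReal.ofReal_le_ofReal (hM y)
        · rw [image_eq_zero_of_notMem_tsupport (fun h => hy (hr h))]
          simp
    _ = (∫⁻ y, nearKer c r (y - x₀)) * ENNReal.ofReal M := lintegral_mul_const _ (by fun_prop)
    _ ≤ ENNReal.ofReal (C * r ^ (n - c)) * ENNReal.ofReal M := by gcongr; exact h x₀ r hr0
    _ < ⊤ := by finiteness

theorem ae_ne_point {n : ℕ} (hn : 0 < n) (x₀ : E n) : ∀ᵐ y : E n, y ≠ x₀ := by
  have : Nonempty (Fin n) := ⟨⟨0, hn⟩⟩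
  have h := measure_singleton (μ := (volume : Measure (E n))) x₀
  exact compl_mem_ae_iff.2 h

theorem tendsto_integral_kernel {n : ℕ} {c : ℝ} (hc : 0 < c) (hcn : c < n) {g : E n → ℝ}
    (hg : Continuous g) (hgc : HasCompactSupport g) (x₀ : E n) {k : ℝ → E n → ℝ} {k₀ : E n → ℝ}
    (hm : ∀ ε, Measurable (k ε)) (hb : ∀ ε y, 0 < ε → y ≠ x₀ → |k ε y| ≤ ‖y - x₀‖ ^ (-c))
    (hl : ∀ y, y ≠ x₀ → Tendsto (fun ε => k ε y) (𝓝[>] 0) (𝓝 (k₀ y))) :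
    Tendsto (fun ε => ∫ y, k ε y * g y) (𝓝[>] 0) (𝓝 (∫ y, k₀ y * g y)) := by
  have hn : 0 < n := by
    have := hc.trans hcn
    exact_mod_cast this
  refine tendsto_integral_filter_of_dominated_convergence
    (fun y => ‖‖y - x₀‖ ^ (-c) * g y‖) ?_ ?_ (integrable_norm_rpow_mul hc hcn hg hgc x₀).norm ?_
  · exact Eventually.of_forall fun ε => ((hm ε).mul hg.measurable).aestronglyMeasurable
  · filter_upwards [self_mem_nhdsWithin] with ε hε
    filter_upwards [ae_ne_point hn x₀] with y hy
    rw [norm_mul, norm_mul]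
    refine mul_le_mul_of_nonneg_right ?_ (norm_nonneg _)
    rw [Real.norm_eq_abs]
    exact (hb ε y hε hy).trans (le_abs_self _)
  · filter_upwards [ae_ne_point hn x₀] with y hy
    exact (hl y hy).mul_const _

theorem sq_add_rpow_le {N ε c : ℝ} (hN : 0 < N) (hε : 0 < ε) (hc : 0 ≤ c) :
    (N ^ 2 + ε) ^ (-(c / 2)) ≤ N ^ (-c) := by
  calc (N ^ 2 + ε) ^ (-(c / 2)) ≤ (N ^ 2) ^ (-(c / 2)) :=
        Real.rpow_le_rpow_of_nonpos (by positivity) (by linarith) (by linarith)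
    _ = N ^ (-c) := by
        rw [← Real.rpow_natCast, ← Real.rpow_mul hN.le]
        congr 1
        push_cast
        ring

theorem tendsto_sq_add_rpow {N c : ℝ} (hN : 0 < N) :
    Tendsto (fun ε : ℝ => (N ^ 2 + ε) ^ (-(c / 2))) (𝓝[>] 0) (𝓝 (N ^ (-c))) := by
  have h1 : ContinuousAt (fun ε : ℝ => (N ^ 2 + ε) ^ (-(c / 2))) 0 :=
    ContinuousAt.rpow_const (by fun_prop) (Or.inl (by positivity))
  have h2 := h1.tendsto
  have h3 : (N ^ 2 + 0) ^ (-(c / 2)) = N ^ (-c) := by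
    rw [add_zero, ← Real.rpow_natCast, ← Real.rpow_mul hN.le]
    congr 1
    push_cast
    ring
  rw [h3] at h2
  exact h2.mono_left nhdsWithin_le_nhds

theorem tendsto_regularized {n : ℕ} {c : ℝ} (hc : 0 < c) (hcn : c < n) {g : E n → ℝ}
    (hg : Continuous g) (hgc : HasCompactSupport g) (x₀ : E n) :
    Tendsto (fun ε => ∫ y, (‖y - x₀‖ ^ 2 + ε) ^ (-(c / 2)) * g y) (𝓝[>] 0)
      (𝓝 (∫ y, ‖y - x₀‖ ^ (-c) * g y)) := by
  refine tendsto_integral_kernel hc hcn hg hgc x₀ (fun ε => by fun_prop) ?_ ?_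
  · intro ε y hε hy
    rw [abs_of_nonneg (by positivity)]
    exact sq_add_rpow_le (norm_pos_iff.2 (sub_ne_zero.2 hy)) hε hc.le
  · intro y hy
    exact tendsto_sq_add_rpow (norm_pos_iff.2 (sub_ne_zero.2 hy))

theorem tendsto_regularized_error {n : ℕ} {c : ℝ} (hc : 0 < c) (hcn : c < n) {g : E n → ℝ}
    (hg : Continuous g) (hgc : HasCompactSupport g) (x₀ : E n) :
    Tendsto (fun ε => ∫ y, (ε * (‖y - x₀‖ ^ 2 + ε) ^ (-((c + 2) / 2))) * g y) (𝓝[>] 0)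
      (𝓝 0) := by
  have h := tendsto_integral_kernel hc hcn hg hgc x₀
    (k := fun ε y => ε * (‖y - x₀‖ ^ 2 + ε) ^ (-((c + 2) / 2))) (k₀ := fun _ => 0)
    (fun ε => by fun_prop) ?_ ?_
  · simpa using h
  · intro ε y hε hy
    have hN := norm_pos_iff.2 (sub_ne_zero.2 hy)
    rw [abs_of_nonneg (by positivity)]
    refine le_trans ?_ (sq_add_rpow_le hN hε hc.le)
    have hs : 0 < ‖y - x₀‖ ^ 2 + ε := by positivity
    have e : -(c / 2) = -((c + 2) / 2) + 1 := by ring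
    rw [e, Real.rpow_add_one hs.ne', mul_comm]
    refine mul_le_mul_of_nonneg_left ?_ (by positivity)
    have : 0 ≤ ‖y - x₀‖ ^ 2 := by positivity
    linarith
  · intro y hy
    have hN := norm_pos_iff.2 (sub_ne_zero.2 hy)
    have h1 : Tendsto (fun ε : ℝ => ε) (𝓝[>] 0) (𝓝 0) := tendsto_id.mono_left nhdsWithin_le_nhds
    have := h1.mul (tendsto_sq_add_rpow (c := c + 2) hN)
    rwa [zero_mul] at this

theorem integral_japanese {n : ℕ} (hn : 0 < n) :
    ∫ z : E n, (‖z‖ ^ 2 + 1) ^ (-(((n : ℝ) + 2) / 2)) = sphereArea n / n := by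
  have : Nonempty (Fin n) := ⟨⟨0, hn⟩⟩
  have hn0 : (0 : ℝ) < n := by exact_mod_cast hn
  have hI : ∫ y in Ioi (0 : ℝ), y ^ (n - 1) * (y ^ 2 + 1) ^ (-(((n : ℝ) + 2) / 2)) =
      1 / (n : ℝ) := by
    have hd : ∀ y ∈ Ici (0 : ℝ), HasDerivAt
        (fun y : ℝ => y ^ n * (y ^ 2 + 1) ^ (-((n : ℝ) / 2)) / n)
        (y ^ (n - 1) * (y ^ 2 + 1) ^ (-(((n : ℝ) + 2) / 2))) y := by
      intro y hy
      have hs : 0 < y ^ 2 + 1 := by positivity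
      have h1 : HasDerivAt (fun y : ℝ => y ^ 2 + 1) (2 * y) y := by
        simpa using (hasDerivAt_pow 2 y).add_const 1
      have h2 := (h1.rpow_const (p := -((n : ℝ) / 2)) (Or.inl hs.ne'))
      have h3 := ((hasDerivAt_pow n y).mul h2).div_const (n : ℝ)
      refine h3.congr_deriv ?_
      have e1 : -((n : ℝ) / 2) - 1 = -(((n : ℝ) + 2) / 2) := by ring
      have e2 : (y ^ 2 + 1) ^ (-((n : ℝ) / 2)) =
          (y ^ 2 + 1) ^ (-(((n : ℝ) + 2) / 2)) * (y ^ 2 + 1) := by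
        rw [← Real.rpow_add_one hs.ne']
        congr 1
        ring
      have e3 : y ^ n = y ^ (n - 1) * y := by
        rw [← pow_succ, Nat.sub_add_cancel hn]
      rw [e1, e2, e3]
      field_simp
      ring
    have hlim : Tendsto (fun y : ℝ => y ^ n * (y ^ 2 + 1) ^ (-((n : ℝ) / 2)) / n) atTop
        (𝓝 (1 / (n : ℝ))) := by
      refine Tendsto.div_const ?_ _
      have h1 : Tendsto (fun y : ℝ => (1 + (y ^ 2)⁻¹) ^ (-((n : ℝ) / 2))) atTop (𝓝 1) := by
        have h2 : Tendsto (fun y : ℝ => 1 + (y ^ 2)⁻¹) atTop (𝓝 (1 + 0)) :=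
          tendsto_const_nhds.add (tendsto_inv_atTop_zero.comp (tendsto_pow_atTop two_ne_zero))
        rw [add_zero] at h2
        have := h2.rpow_const (p := -((n : ℝ) / 2)) (Or.inl one_ne_zero)
        rwa [Real.one_rpow] at this
      refine h1.congr' ?_
      filter_upwards [eventually_gt_atTop 0] with y hy
      have e1 : 1 + (y ^ 2)⁻¹ = (y ^ 2 + 1) * (y ^ 2)⁻¹ := by
        field_simp
      have e2 : ((y ^ 2)⁻¹) ^ (-((n : ℝ) / 2)) = y ^ n := by
        rw [Real.inv_rpow (by positivity), Real.rpow_neg (by positivity), inv_inv,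
          ← Real.rpow_natCast, ← Real.rpow_natCast, ← Real.rpow_mul hy.le]
        congr 1
        push_cast
        ring
      rw [e1, Real.mul_rpow (by positivity) (by positivity), e2, mul_comm]
    rw [integral_Ioi_of_hasDerivAt_of_nonneg' hd (fun y hy => by
      have : (0 : ℝ) < y := hy
      positivity) hlim]
    simp [hn.ne']
  have h1 := integral_fun_norm_addHaar (volume : Measure (E n))
    (fun t : ℝ => (t ^ 2 + 1) ^ (-(((n : ℝ) + 2) / 2)))
  rw [h1, finrank_euclideanSpace_fin]
  simp only [smul_eq_mul]
  rw [hI, sphereArea_eq, nsmul_eq_mul]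
  ring

/-- The kernels `ε (|y - x₀|² + ε)^{-n/2-1}` are an approximate identity. -/
theorem tendsto_approx_identity {n : ℕ} (hn : 0 < n) {g : E n → ℝ}
    (hg : Continuous g) (hgc : HasCompactSupport g) (x₀ : E n) :
    Tendsto (fun ε => ∫ y, (ε * (‖y - x₀‖ ^ 2 + ε) ^ (-(((n : ℝ) + 2) / 2))) * g y) (𝓝[>] 0)
      (𝓝 (sphereArea n / n * g x₀)) := by
  obtain ⟨M, hM⟩ := hgc.exists_bound_of_continuous hg
  have hint : Integrable fun z : E n => (‖z‖ ^ 2 + 1) ^ (-(((n : ℝ) + 2) / 2)) := by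
    have := integrable_rpow_neg_one_add_norm_sq (E := E n) (r := n + 2)
      (μ := (volume : Measure (E n))) (by rw [finrank_euclideanSpace_fin]; linarith)
    refine this.congr (Eventually.of_forall fun z => ?_)
    simp only
    congr 1
    · ring
    · ring
  have key : Tendsto (fun ε : ℝ => ∫ z : E n, (‖z‖ ^ 2 + 1) ^ (-(((n : ℝ) + 2) / 2)) *
      g (x₀ + √ε • z)) (𝓝[>] 0)
      (𝓝 (∫ z : E n, (‖z‖ ^ 2 + 1) ^ (-(((n : ℝ) + 2) / 2)) * g x₀)) := by
    refine tendsto_integral_filter_of_dominated_convergence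
      (fun z => (‖z‖ ^ 2 + 1) ^ (-(((n : ℝ) + 2) / 2)) * M) ?_ ?_ (hint.mul_const M) ?_
    · refine Eventually.of_forall fun ε => ?_
      have : Continuous fun z : E n => g (x₀ + √ε • z) := by fun_prop
      exact (Measurable.mul (by fun_prop) this.measurable).aestronglyMeasurable
    · refine Eventually.of_forall fun ε => Eventually.of_forall fun z => ?_
      rw [norm_mul, Real.norm_of_nonneg (by positivity)]
      exact mul_le_mul_of_nonneg_left (hM _) (by positivity)
    · refine Eventually.of_forall fun z => ?_
      refine Tendsto.const_mul _ ?_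
      have h1 : Continuous fun ε : ℝ => g (x₀ + √ε • z) := by fun_prop
      have := h1.tendsto 0
      simp only [Real.sqrt_zero, zero_smul, add_zero] at this
      exact this.mono_left nhdsWithin_le_nhds
  rw [integral_mul_const, integral_japanese hn] at key
  refine key.congr' ?_
  filter_upwards [self_mem_nhdsWithin] with ε hε
  have hε0 : (0 : ℝ) < ε := hε
  have ht : 0 < √ε := Real.sqrt_pos.2 hε0
  have h1 := Measure.integral_comp_smul_of_nonneg (volume : Measure (E n))
    (fun y => (ε * (‖y‖ ^ 2 + ε) ^ (-(((n : ℝ) + 2) / 2))) * g (x₀ + y)) (√ε) (hR := ht.le)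
  rw [finrank_euclideanSpace_fin] at h1
  have h2 : ∫ y, (ε * (‖y - x₀‖ ^ 2 + ε) ^ (-(((n : ℝ) + 2) / 2))) * g y =
      ∫ y, (ε * (‖y‖ ^ 2 + ε) ^ (-(((n : ℝ) + 2) / 2))) * g (x₀ + y) := by
    rw [← integral_add_left_eq_self _ x₀]
    simp
  rw [h2]
  have h3 : ∫ y, (ε * (‖y‖ ^ 2 + ε) ^ (-(((n : ℝ) + 2) / 2))) * g (x₀ + y) =
      √ε ^ n * ∫ z : E n, (ε * (‖√ε • z‖ ^ 2 + ε) ^ (-(((n : ℝ) + 2) / 2))) *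
        g (x₀ + √ε • z) := by
    rw [h1, smul_eq_mul, ← mul_assoc, mul_inv_cancel₀ (by positivity), one_mul]
  rw [h3, ← integral_const_mul]
  congr 1
  ext z
  have h4 : ‖√ε • z‖ ^ 2 + ε = ε * (‖z‖ ^ 2 + 1) := by
    rw [norm_smul, mul_pow, Real.norm_of_nonneg ht.le, Real.sq_sqrt hε0.le]
    ring
  have h5 : √ε ^ n * (ε * ε ^ (-(((n : ℝ) + 2) / 2))) = 1 := by
    have e1 : √ε ^ n = ε ^ ((n : ℝ) / 2) := by
      rw [Real.sqrt_eq_rpow, ← Real.rpow_natCast, ← Real.rpow_mul hε0.le]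
      congr 1
      ring
    rw [e1, mul_comm ε, ← Real.rpow_add_one hε0.ne', ← Real.rpow_add hε0]
    have e2 : (n : ℝ) / 2 + (-(((n : ℝ) + 2) / 2) + 1) = 0 := by ring
    rw [e2, Real.rpow_zero]
  rw [h4, Real.mul_rpow hε0.le (by positivity)]
  calc _ = 1 * ((‖z‖ ^ 2 + 1) ^ (-(((n : ℝ) + 2) / 2)) * g (x₀ + √ε • z)) := by rw [one_mul]
    _ = _ := by
      rw [← h5]
      ring

theorem contDiffOn_rpow_Ioi (e : ℝ) : ContDiffOn ℝ ∞ (fun s : ℝ => s ^ e) (Ioi 0) :=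
  fun _ hs => (Real.contDiffAt_rpow_const_of_ne (ne_of_gt hs)).contDiffWithinAt

theorem deriv_rpow_const_Ioi (e : ℝ) {s : ℝ} (hs : 0 < s) :
    deriv (fun s : ℝ => s ^ e) s = e * s ^ (e - 1) :=
  (Real.hasDerivAt_rpow_const (Or.inl hs.ne')).deriv

theorem deriv_deriv_rpow_const_Ioi (e : ℝ) {s : ℝ} (hs : 0 < s) :
    deriv (deriv fun s : ℝ => s ^ e) s = e * (e - 1) * s ^ (e - 2) := by
  have h : deriv (fun s : ℝ => s ^ e) =ᶠ[𝓝 s] fun s => e * s ^ (e - 1) := by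
    filter_upwards [Ioi_mem_nhds hs] with t ht
    exact deriv_rpow_const_Ioi e ht
  rw [h.deriv_eq, deriv_const_mul_field, deriv_rpow_const_Ioi _ hs]
  have : e - 1 - 1 = e - 2 := by ring
  rw [this]
  ring

theorem integral_regularized_cLap {n : ℕ} (a : ℝ) {w : E n → ℝ}
    (hw : IsTestFunction univ w) (x₀ : E n) {ε : ℝ} (hε : 0 < ε) :
    ∫ y, (‖y - x₀‖ ^ 2 + ε) ^ (-(a / 2)) * cLap w y =
      a * (n - 2 - a) * (∫ y, (‖y - x₀‖ ^ 2 + ε) ^ (-((a + 2) / 2)) * w y) +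
      a * (a + 2) * ∫ y, (ε * (‖y - x₀‖ ^ 2 + ε) ^ (-((a + 2 + 2) / 2))) * w y := by
  have hq : ∀ y : E n, 0 < ‖y - x₀‖ ^ 2 + ε := fun y => by positivity
  have hcont : ∀ e : ℝ, Continuous fun y : E n => (‖y - x₀‖ ^ 2 + ε) ^ e := fun e =>
    (contDiff_radial x₀ hε (contDiffOn_rpow_Ioi e)).continuous
  rw [integral_mul_cLap (contDiff_radial x₀ hε (contDiffOn_rpow_Ioi _)) hw.1 hw.2.1,
    ← integral_const_mul, ← integral_const_mul, ← integral_add]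
  · congr 1
    ext y
    rw [cLap_radial x₀ hε (contDiffOn_rpow_Ioi _), deriv_rpow_const_Ioi _ (hq y),
      deriv_deriv_rpow_const_Ioi _ (hq y)]
    have e1 : -(a / 2) - 1 = -((a + 2 + 2) / 2) + 1 := by ring
    have e2 : -((a + 2) / 2) = -((a + 2 + 2) / 2) + 1 := by ring
    have e3 : -(a / 2) - 2 = -((a + 2 + 2) / 2) := by ring
    rw [e1, e2, e3, Real.rpow_add_one (hq y).ne']
    ring
  · exact (((hcont _).mul hw.continuous).integrable_of_hasCompactSupport
      hw.2.1.mul_left).const_mul _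
  · exact (((continuous_const.mul (hcont _)).mul hw.continuous).integrable_of_hasCompactSupport
      hw.2.1.mul_left).const_mul _

theorem integral_norm_rpow_cLap {n : ℕ} {a : ℝ} (ha : 0 < a) (han : a + 2 < n) {w : E n → ℝ}
    (hw : IsTestFunction univ w) (x₀ : E n) :
    ∫ y, ‖y - x₀‖ ^ (-a) * cLap w y =
      a * (n - 2 - a) * ∫ y, ‖y - x₀‖ ^ (-(a + 2)) * w y := by
  have h1 := tendsto_regularized ha (by linarith) hw.cLap.continuous hw.cLap.2.1 x₀
  have h2 := ((tendsto_regularized (by linarith : 0 < a + 2) han hw.continuous hw.2.1 x₀).const_mul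
    (a * (n - 2 - a))).add ((tendsto_regularized_error (by linarith : 0 < a + 2) han
      hw.continuous hw.2.1 x₀).const_mul (a * (a + 2)))
  rw [mul_zero, add_zero] at h2
  refine tendsto_nhds_unique h1 (h2.congr' ?_)
  filter_upwards [self_mem_nhdsWithin] with ε hε
  exact (integral_regularized_cLap a hw x₀ hε).symm

theorem integral_newton_cLap {n : ℕ} (hn : 2 < n) {w : E n → ℝ}
    (hw : IsTestFunction univ w) (x₀ : E n) :
    ∫ y, ‖y - x₀‖ ^ (-((n : ℝ) - 2)) * cLap w y = (n - 2) * sphereArea n * w x₀ := by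
  have hn' : (2 : ℝ) < n := by exact_mod_cast hn
  have h1 := tendsto_regularized (by linarith : (0 : ℝ) < n - 2) (by linarith)
    hw.cLap.continuous hw.cLap.2.1 x₀
  have h2 := (tendsto_approx_identity (by omega) hw.continuous hw.2.1 x₀).const_mul
    (((n : ℝ) - 2) * n)
  have e : ((n : ℝ) - 2) * n * (sphereArea n / n * w x₀) = (n - 2) * sphereArea n * w x₀ := by
    field_simp
  rw [e] at h2
  refine tendsto_nhds_unique h1 (h2.congr' ?_)
  filter_upwards [self_mem_nhdsWithin] with ε hε
  rw [integral_regularized_cLap ((n : ℝ) - 2) hw x₀ hε]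
  simp

theorem integral_regularized_pd {n : ℕ} (b : ℝ) {w : E n → ℝ}
    (hw : IsTestFunction univ w) (x₀ : E n) {ε : ℝ} (hε : 0 < ε) :
    ∑ i : Fin n, ∫ y, ((y i - x₀ i) * (‖y - x₀‖ ^ 2 + ε) ^ (-(b / 2))) * pd i w y =
      -((n - b) * (∫ y, (‖y - x₀‖ ^ 2 + ε) ^ (-(b / 2)) * w y) +
      b * ∫ y, (ε * (‖y - x₀‖ ^ 2 + ε) ^ (-((b + 2) / 2))) * w y) := by
  have hq : ∀ y : E n, 0 < ‖y - x₀‖ ^ 2 + ε := fun y => by positivity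
  have hsm : ∀ e : ℝ, ContDiff ℝ ∞ fun y : E n => (‖y - x₀‖ ^ 2 + ε) ^ e := fun e =>
    contDiff_radial x₀ hε (contDiffOn_rpow_Ioi e)
  have hsmi : ∀ (e : ℝ) (i : Fin n),
      ContDiff ℝ ∞ fun y : E n => (y i - x₀ i) * (‖y - x₀‖ ^ 2 + ε) ^ e := by
    intro e i
    have h1 : ContDiff ℝ ∞ fun y : E n => y i - x₀ i :=
      (EuclideanSpace.proj i : E n →L[ℝ] ℝ).contDiff.sub contDiff_const
    exact h1.mul (hsm e)
  have h1 : ∀ i : Fin n, ∫ y, ((y i - x₀ i) * (‖y - x₀‖ ^ 2 + ε) ^ (-(b / 2))) * pd i w y =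
      -∫ y, pd i (fun y => (y i - x₀ i) * (‖y - x₀‖ ^ 2 + ε) ^ (-(b / 2))) y * w y :=
    fun i => integral_mul_pd (hsmi _ i) hw.1 hw.2.1 i
  simp only [h1]
  rw [Finset.sum_neg_distrib, ← integral_finsetSum]
  · rw [← integral_const_mul, ← integral_const_mul, ← integral_add]
    · congr 2
      ext y
      rw [← Finset.sum_mul, sum_pd_coord_radial x₀ hε (contDiffOn_rpow_Ioi _),
        deriv_rpow_const_Ioi _ (hq y)]
      have e1 : -(b / 2) = -((b + 2) / 2) + 1 := by ring
      have e2 : -((b + 2) / 2) + 1 - 1 = -((b + 2) / 2) := by ring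
      rw [e1, e2, Real.rpow_add_one (hq y).ne']
      ring
    · exact (((hsm _).continuous.mul hw.continuous).integrable_of_hasCompactSupport
        hw.2.1.mul_left).const_mul _
    · exact (((continuous_const.mul (hsm _).continuous).mul
        hw.continuous).integrable_of_hasCompactSupport hw.2.1.mul_left).const_mul _
  · intro i _
    exact (((hsmi _ i).pd i).continuous.mul hw.continuous).integrable_of_hasCompactSupport
      hw.2.1.mul_left

theorem tendsto_regularized_pd {n : ℕ} {b : ℝ} (hb : 1 < b) (hbn : b ≤ n) {w : E n → ℝ}
    (hw : IsTestFunction univ w) (x₀ : E n) :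
    Tendsto (fun ε => ∑ i : Fin n,
      ∫ y, ((y i - x₀ i) * (‖y - x₀‖ ^ 2 + ε) ^ (-(b / 2))) * pd i w y) (𝓝[>] 0)
      (𝓝 (∑ i : Fin n, ∫ y, ((y i - x₀ i) * ‖y - x₀‖ ^ (-b)) * pd i w y)) := by
  refine tendsto_finsetSum _ fun i _ => ?_
  refine tendsto_integral_kernel (c := b - 1) (by linarith) (by linarith) (hw.pd i).continuous
    (hw.pd i).2.1 x₀ (fun ε => by fun_prop) ?_ ?_
  · intro ε y hε hy
    have hN := norm_pos_iff.2 (sub_ne_zero.2 hy)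
    rw [abs_mul, abs_of_nonneg (a := (_ : ℝ) ^ (_ : ℝ)) (by positivity)]
    have h1 : |y i - x₀ i| ≤ ‖y - x₀‖ := by
      have := PiLp.norm_apply_le (y - x₀) i
      simpa using this
    calc |y i - x₀ i| * (‖y - x₀‖ ^ 2 + ε) ^ (-(b / 2)) ≤ ‖y - x₀‖ * ‖y - x₀‖ ^ (-b) :=
          mul_le_mul h1 (sq_add_rpow_le hN hε (by linarith)) (by positivity) (by positivity)
      _ = ‖y - x₀‖ ^ (-(b - 1)) := by
          have : -(b - 1) = -b + 1 := by ring
          rw [this, Real.rpow_add_one hN.ne', mul_comm]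
  · intro y hy
    exact (tendsto_sq_add_rpow (norm_pos_iff.2 (sub_ne_zero.2 hy))).const_mul _

theorem sum_integral_norm_rpow_pd {n : ℕ} {b : ℝ} (hb : 1 < b) (hbn : b < n) {w : E n → ℝ}
    (hw : IsTestFunction univ w) (x₀ : E n) :
    ∑ i : Fin n, ∫ y, ((y i - x₀ i) * ‖y - x₀‖ ^ (-b)) * pd i w y =
      -((n - b) * ∫ y, ‖y - x₀‖ ^ (-b) * w y) := by
  have h1 := tendsto_regularized_pd hb hbn.le hw x₀
  have h2 := (((tendsto_regularized (by linarith : 0 < b) hbn hw.continuous hw.2.1 x₀).const_mul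
    (n - b)).add ((tendsto_regularized_error (by linarith : 0 < b) hbn
      hw.continuous hw.2.1 x₀).const_mul b)).neg
  rw [mul_zero, add_zero] at h2
  refine tendsto_nhds_unique h1 (h2.congr' ?_)
  filter_upwards [self_mem_nhdsWithin] with ε hε
  exact (integral_regularized_pd b hw x₀ hε).symm

theorem sum_integral_newton_pd {n : ℕ} (hn : 1 < n) {w : E n → ℝ}
    (hw : IsTestFunction univ w) (x₀ : E n) :
    ∑ i : Fin n, ∫ y, ((y i - x₀ i) * ‖y - x₀‖ ^ (-(n : ℝ))) * pd i w y =
      -(sphereArea n * w x₀) := by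
  have hn' : (1 : ℝ) < n := by exact_mod_cast hn
  have h1 := tendsto_regularized_pd hn' le_rfl hw x₀
  have h2 := ((tendsto_approx_identity (by omega) hw.continuous hw.2.1 x₀).const_mul
    (n : ℝ)).neg
  have e : (n : ℝ) * (sphereArea n / n * w x₀) = sphereArea n * w x₀ := by
    field_simp
  rw [e] at h2
  refine tendsto_nhds_unique h1 (h2.congr' ?_)
  filter_upwards [self_mem_nhdsWithin] with ε hε
  rw [integral_regularized_pd (n : ℝ) hw x₀ hε]
  simp

theorem sphereArea_eq_Gamma {n : ℕ} (hn : 0 < n) :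
    sphereArea n = 2 * Real.pi ^ ((n : ℝ) / 2) / Real.Gamma ((n : ℝ) / 2) := by
  have : Nonempty (Fin n) := ⟨⟨0, hn⟩⟩
  have hn0 : (0 : ℝ) < n := by exact_mod_cast hn
  have hG : 0 < Real.Gamma ((n : ℝ) / 2) := Real.Gamma_pos_of_pos (by positivity)
  rw [sphereArea_eq, Measure.real, EuclideanSpace.volume_ball, Fintype.card_fin,
    ENNReal.ofReal_one, one_pow, one_mul, ENNReal.toReal_ofReal (by
      have : 0 < Real.Gamma ((n : ℝ) / 2 + 1) := Real.Gamma_pos_of_pos (by positivity)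
      positivity), Real.Gamma_add_one (by positivity), Real.sqrt_eq_rpow, ← Real.rpow_natCast,
    ← Real.rpow_mul Real.pi_pos.le]
  have e : 1 / 2 * (n : ℝ) = n / 2 := by ring
  rw [e]
  field_simp

theorem rieszConst_two {n : ℕ} (hn : 2 < n) :
    rieszConst n 2 * ((n - 2) * sphereArea n) = 1 := by
  have hn' : (2 : ℝ) < n := by exact_mod_cast hn
  have h0 : ((n : ℝ) - 2) / 2 ≠ 0 := by
    have : (0 : ℝ) < n - 2 := by linarith
    positivity
  have hG : 0 < Real.Gamma (((n : ℝ) - 2) / 2) := Real.Gamma_pos_of_pos (by linarith)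
  have hpi : 0 < Real.pi ^ ((n : ℝ) / 2) := Real.rpow_pos_of_pos Real.pi_pos _
  have h1 : Real.Gamma ((n : ℝ) / 2) = ((n : ℝ) - 2) / 2 * Real.Gamma (((n : ℝ) - 2) / 2) := by
    rw [← Real.Gamma_add_one h0]
    congr 1
    ring
  rw [sphereArea_eq_Gamma (by omega), rieszConst, h1]
  have h2 : (n : ℝ) - 2 ≠ 0 := by linarith
  have h3 : (2 : ℝ) ^ (2 : ℝ) = 4 := by norm_num
  rw [h3, div_self two_ne_zero, Real.Gamma_one]
  field_simp
  norm_num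

theorem rieszConst_step {n k : ℕ} (hk : 0 < k) (hkn : 2 * k + 2 < n) :
    rieszConst n (2 * k) =
      rieszConst n (2 * (k + 1)) * (((n : ℝ) - 2 * k - 2) * (2 * k)) := by
  have hk' : (0 : ℝ) < k := by exact_mod_cast hk
  have hkn' : (2 : ℝ) * k + 2 < n := by exact_mod_cast hkn
  have h0 : ((n : ℝ) - 2 * (k + 1)) / 2 ≠ 0 := by
    have : (0 : ℝ) < n - 2 * (k + 1) := by linarith
    positivity
  have hpi : 0 < Real.pi ^ ((n : ℝ) / 2) := Real.rpow_pos_of_pos Real.pi_pos _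
  have h1 : Real.Gamma (((n : ℝ) - 2 * k) / 2) =
      ((n : ℝ) - 2 * (k + 1)) / 2 * Real.Gamma (((n : ℝ) - 2 * (k + 1)) / 2) := by
    rw [← Real.Gamma_add_one h0]
    congr 1
    ring
  have h2 : Real.Gamma (2 * ((k : ℝ) + 1) / 2) = k * Real.Gamma (2 * (k : ℝ) / 2) := by
    have e : 2 * ((k : ℝ) + 1) / 2 = 2 * (k : ℝ) / 2 + 1 := by ring
    rw [e, Real.Gamma_add_one (by positivity)]
    ring
  have h3 : (2 : ℝ) ^ (2 * ((k : ℝ) + 1)) = 4 * 2 ^ (2 * (k : ℝ)) := by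
    have e : 2 * ((k : ℝ) + 1) = 2 * k + 2 := by ring
    rw [e, Real.rpow_add two_pos]
    norm_num
    ring
  have hG : 0 < Real.Gamma (2 * (k : ℝ) / 2) := Real.Gamma_pos_of_pos (by positivity)
  rw [rieszConst, rieszConst, h1, h2, h3]
  field_simp
  ring

theorem gradRieszConst_one {n : ℕ} (hn : 0 < n) : gradRieszConst n 1 * sphereArea n = 1 := by
  have hn0 : (0 : ℝ) < n := by exact_mod_cast hn
  have hG : 0 < Real.Gamma ((n : ℝ) / 2) := Real.Gamma_pos_of_pos (by positivity)
  have hpi : 0 < Real.pi ^ ((n : ℝ) / 2) := Real.rpow_pos_of_pos Real.pi_pos _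
  rw [sphereArea_eq_Gamma hn, gradRieszConst]
  have e1 : (n : ℝ) - 1 + 1 = n := by ring
  have e2 : ((1 : ℝ) + 1) / 2 = 1 := by norm_num
  have e3 : (2 : ℝ) ^ ((1 : ℝ) + 1) = 4 := by norm_num
  rw [e1, e2, e3, Real.Gamma_one]
  field_simp
  norm_num

theorem gradRieszConst_mul {n k : ℕ} (hk : 0 < k) :
    gradRieszConst n (2 * k + 1) * (2 * k) = rieszConst n (2 * k) := by
  have hk' : (0 : ℝ) < k := by exact_mod_cast hk
  have hpi : 0 < Real.pi ^ ((n : ℝ) / 2) := Real.rpow_pos_of_pos Real.pi_pos _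
  have hG : 0 < Real.Gamma (2 * (k : ℝ) / 2) := Real.Gamma_pos_of_pos (by positivity)
  have e1 : (n : ℝ) - (2 * k + 1) + 1 = n - 2 * k := by ring
  have e2 : Real.Gamma ((2 * (k : ℝ) + 1 + 1) / 2) = k * Real.Gamma (2 * (k : ℝ) / 2) := by
    have e : (2 * (k : ℝ) + 1 + 1) / 2 = 2 * (k : ℝ) / 2 + 1 := by ring
    rw [e, Real.Gamma_add_one (by positivity)]
    ring
  have e3 : (2 : ℝ) ^ (2 * (k : ℝ) + 1 + 1) = 4 * 2 ^ (2 * (k : ℝ)) := by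
    have e : 2 * (k : ℝ) + 1 + 1 = 2 * k + 2 := by ring
    rw [e, Real.rpow_add two_pos]
    norm_num
    ring
  rw [gradRieszConst, rieszConst, e1, e2, e3]
  field_simp
  ring

theorem rieszConst_pos {n k : ℕ} (hk : 0 < k) (hkn : 2 * k < n) : 0 < rieszConst n (2 * k) := by
  have hk' : (0 : ℝ) < k := by exact_mod_cast hk
  have hkn' : (2 : ℝ) * k < n := by exact_mod_cast hkn
  have h1 : 0 < Real.Gamma (((n : ℝ) - 2 * k) / 2) := Real.Gamma_pos_of_pos (by linarith)
  have h2 : 0 < Real.Gamma (2 * (k : ℝ) / 2) := Real.Gamma_pos_of_pos (by positivity)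
  have hpi : 0 < Real.pi ^ ((n : ℝ) / 2) := Real.rpow_pos_of_pos Real.pi_pos _
  unfold rieszConst
  positivity

theorem gradRieszConst_pos {n k : ℕ} (hkn : 2 * k + 1 < n) :
    0 < gradRieszConst n (2 * k + 1) := by
  have hkn' : (2 : ℝ) * k + 1 < n := by exact_mod_cast hkn
  have h1 : 0 < Real.Gamma (((n : ℝ) - (2 * k + 1) + 1) / 2) :=
    Real.Gamma_pos_of_pos (by linarith)
  have h2 : 0 < Real.Gamma ((2 * (k : ℝ) + 1 + 1) / 2) := Real.Gamma_pos_of_pos (by positivity)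
  have hpi : 0 < Real.pi ^ ((n : ℝ) / 2) := Real.rpow_pos_of_pos Real.pi_pos _
  unfold gradRieszConst
  positivity

/-- A test function is the Riesz potential of an iterated Laplacian. -/
theorem eq_riesz_potential {n : ℕ} {w : E n → ℝ} (hw : IsTestFunction univ w) (x : E n) {k : ℕ}
    (hk : 0 < k) (hkn : 2 * k < n) :
    w x = rieszConst n (2 * k) * ∫ y, ‖y - x‖ ^ (-((n : ℝ) - 2 * k)) * cLap^[k] w y := by
  induction k, hk using Nat.le_induction with
  | base =>
    have h1 := integral_newton_cLap (by omega) hw x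
    have h2 := rieszConst_two (n := n) (by omega)
    simp only [Nat.cast_one, mul_one, Function.iterate_one]
    rw [h1]
    linear_combination -w x * h2
  | succ k hk ih =>
    have hk' : (0 : ℝ) < k := by exact_mod_cast hk
    have hkn' : (2 : ℝ) * (k + 1) < n := by exact_mod_cast hkn
    rw [ih (by omega)]
    have h1 := integral_norm_rpow_cLap (a := n - 2 * (k + 1)) (by linarith) (by linarith)
      (hw.iterate_cLap k) x
    have h2 := rieszConst_step (n := n) (k := k) hk (by omega)
    push_cast
    rw [Function.iterate_succ_apply', h1, h2]
    have e1 : -((n : ℝ) - 2 * (k + 1) + 2) = -((n : ℝ) - 2 * k) := by ring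
    rw [e1]
    ring

/-- A test function is the potential of the gradient of an iterated Laplacian. -/
theorem eq_grad_riesz_potential {n : ℕ} {w : E n → ℝ} (hw : IsTestFunction univ w) (x : E n)
    {k : ℕ} (hkn : 2 * k + 1 < n) :
    w x = -(gradRieszConst n (2 * k + 1) * ∑ i : Fin n,
      ∫ y, ((y i - x i) * ‖y - x‖ ^ (-((n : ℝ) - 2 * k))) * pd i (cLap^[k] w) y) := by
  rcases Nat.eq_zero_or_pos k with rfl | hk
  · have h1 := sum_integral_newton_pd (by omega) hw x
    have h2 := gradRieszConst_one (n := n) (by omega)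
    simp only [Nat.cast_zero, mul_zero, sub_zero, zero_add, Function.iterate_zero, id]
    rw [h1]
    linear_combination -w x * h2
  · have hk' : (0 : ℝ) < k := by exact_mod_cast hk
    have hkn' : (2 : ℝ) * k + 1 < n := by exact_mod_cast hkn
    rw [sum_integral_norm_rpow_pd (by linarith) (by linarith) (hw.iterate_cLap k) x]
    have h1 := eq_riesz_potential hw x hk (by omega)
    have h2 := gradRieszConst_mul (n := n) hk
    rw [← h2] at h1
    linear_combination h1

theorem partialDeriv_zero {n : ℕ} (s : Fin 0 → Fin n) (φ : E n → ℝ) : partialDeriv s φ = φ := by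
  ext x
  simp [partialDeriv]

theorem partialDeriv_succ {n k : ℕ} (s : Fin (k + 1) → Fin n) {φ : E n → ℝ}
    (hφ : ContDiff ℝ ∞ φ) :
    partialDeriv s φ = pd (s 0) (partialDeriv (fun j => s j.succ) φ) := by
  ext x
  unfold partialDeriv pd
  rw [iteratedFDeriv_succ_apply_left]
  have hd : DifferentiableAt ℝ (iteratedFDeriv ℝ k φ) x :=
    (hφ.differentiable_iteratedFDeriv (by exact_mod_cast ENat.natCast_lt_top k)) x
  rw [fderiv_continuousMultilinear_apply_const_apply hd]
  rfl

theorem ContDiff.partialDeriv {n k : ℕ} (s : Fin k → Fin n) {φ : E n → ℝ}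
    (hφ : ContDiff ℝ ∞ φ) : ContDiff ℝ ∞ (partialDeriv s φ) := by
  induction k with
  | zero => rwa [partialDeriv_zero]
  | succ k ih =>
    rw [partialDeriv_succ s hφ]
    exact (ih _).pd _

theorem IsTestFunction.partialDeriv {n k : ℕ} {U : Set (E n)} (s : Fin k → Fin n) {φ : E n → ℝ}
    (hφ : IsTestFunction U φ) : IsTestFunction U (partialDeriv s φ) := by
  induction k with
  | zero => rwa [partialDeriv_zero]
  | succ k ih =>
    rw [partialDeriv_succ s hφ.1]
    exact (ih _).pd _

theorem pd_comm {n : ℕ} (i j : Fin n) {φ : E n → ℝ} (hφ : ContDiff ℝ ∞ φ) :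
    pd i (pd j φ) = pd j (pd i φ) := by
  have h : ∀ (i j : Fin n) (x : E n), pd i (pd j φ) x =
      fderiv ℝ (fderiv ℝ φ) x (EuclideanSpace.single i 1) (EuclideanSpace.single j 1) := by
    intro i j x
    have hd : DifferentiableAt ℝ (fderiv ℝ φ) x :=
      (hφ.fderiv_right (m := ∞) le_rfl).differentiable (by simp) x
    unfold pd
    rw [fderiv_clm_apply hd (differentiableAt_const _)]
    simp
  ext x
  rw [h, h]
  exact (hφ.contDiffAt.isSymmSndFDerivAt (by
    simp only [minSmoothness_of_isRCLikeNormedField]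
    exact WithTop.coe_le_coe.2 (le_top : (2 : ℕ∞) ≤ ⊤))).eq _ _

theorem pd_partialDeriv {n k : ℕ} (i : Fin n) (s : Fin k → Fin n) {φ : E n → ℝ}
    (hφ : ContDiff ℝ ∞ φ) : pd i (partialDeriv s φ) = partialDeriv s (pd i φ) := by
  induction k with
  | zero => rw [partialDeriv_zero, partialDeriv_zero]
  | succ k ih =>
    rw [partialDeriv_succ s hφ, partialDeriv_succ s (hφ.pd i), pd_comm _ _ (hφ.partialDeriv _), ih]

theorem partialDeriv_one {n : ℕ} (i : Fin n) {φ : E n → ℝ} (hφ : ContDiff ℝ ∞ φ) :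
    partialDeriv ![i] φ = pd i φ := by
  rw [partialDeriv_succ _ hφ, partialDeriv_zero]
  rfl

theorem partialDeriv_two {n : ℕ} (i j : Fin n) {φ : E n → ℝ} (hφ : ContDiff ℝ ∞ φ) :
    partialDeriv ![i, j] φ = pd i (pd j φ) := by
  rw [partialDeriv_succ _ hφ, partialDeriv_succ _ hφ, partialDeriv_zero]
  rfl

theorem integral_mul_partialDeriv {n k : ℕ} (s : Fin k → Fin n) {f w : E n → ℝ}
    (hf : ContDiff ℝ ∞ f) (hw : IsTestFunction univ w) :
    ∫ x, f x * partialDeriv s w x = (-1) ^ k * ∫ x, partialDeriv s f x * w x := by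
  induction k generalizing f with
  | zero => simp [partialDeriv_zero]
  | succ k ih =>
    rw [partialDeriv_succ s hw.1, partialDeriv_succ s hf,
      integral_mul_pd hf (hw.1.partialDeriv _) (hw.partialDeriv _).2.1, ih _ (hf.pd _),
      pd_partialDeriv _ _ hf]
    ring

theorem ContDiff.hasWeakPartial {n k : ℕ} (s : Fin k → Fin n) {f : E n → ℝ}
    (hf : ContDiff ℝ ∞ f) : HasWeakPartial s f (_root_.partialDeriv s f) :=
  ⟨hf.continuous.locallyIntegrable, (hf.partialDeriv s).continuous.locallyIntegrable,
    fun _ hφ => integral_mul_partialDeriv s hf hφ⟩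

theorem HasWeakPartial.ae_eq {n k : ℕ} {s : Fin k → Fin n} {u v v' : E n → ℝ}
    (h : HasWeakPartial s u v) (h' : HasWeakPartial s u v') : v =ᵐ[volume] v' := by
  refine ae_eq_of_integral_contDiff_smul_eq h.2.1 h'.2.1 fun g hg hgc => ?_
  have hgt : IsTestFunction univ g := ⟨hg, hgc, subset_univ _⟩
  have h1 := h.2.2 g hgt
  rw [h'.2.2 g hgt] at h1
  have h2 := mul_left_cancel₀ (pow_ne_zero k (by norm_num : (-1 : ℝ) ≠ 0)) h1
  simp only [smul_eq_mul]
  simp_rw [mul_comm (g _)]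
  exact h2.symm

theorem HasWeakPartial.weakPartial {n k : ℕ} {s : Fin k → Fin n} {u v : E n → ℝ}
    (h : HasWeakPartial s u v) : HasWeakPartial s u (weakPartial s u) := by
  have hex : ∃ v, HasWeakPartial s u v := ⟨v, h⟩
  unfold _root_.weakPartial
  rw [dif_pos hex]
  exact hex.choose_spec

theorem HasWeakPartial.weakPartial_ae {n k : ℕ} {s : Fin k → Fin n} {u v : E n → ℝ}
    (h : HasWeakPartial s u v) : _root_.weakPartial s u =ᵐ[volume] v :=
  h.weakPartial.ae_eq h

theorem HasWeakPartial.congr_left {n k : ℕ} {s : Fin k → Fin n} {u u' v : E n → ℝ}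
    (h : HasWeakPartial s u v) (hu : u =ᵐ[volume] u') : HasWeakPartial s u' v := by
  refine ⟨h.1.congr hu, h.2.1, fun φ hφ => ?_⟩
  rw [← h.2.2 φ hφ]
  refine integral_congr_ae ?_
  filter_upwards [hu] with x hx
  rw [hx]

theorem weakPartial_congr {n k : ℕ} (s : Fin k → Fin n) {u u' : E n → ℝ}
    (hu : u =ᵐ[volume] u') : weakPartial s u = weakPartial s u' := by
  have : HasWeakPartial s u = HasWeakPartial s u' := by
    ext v
    exact ⟨fun h => h.congr_left hu, fun h => h.congr_left hu.symm⟩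
  have key : ∀ P Q : (E n → ℝ) → Prop, P = Q →
      (open Classical in if h : ∃ v, P v then h.choose else 0) =
        (open Classical in if h : ∃ v, Q v then h.choose else 0) := by
    rintro P _ rfl
    rfl
  exact key _ _ this

theorem posLaplacian_congr {n : ℕ} {u u' : E n → ℝ} (hu : u =ᵐ[volume] u') :
    posLaplacian u = posLaplacian u' := by
  unfold posLaplacian
  simp only [weakPartial_congr _ hu]

theorem weakGradient_congr {n : ℕ} {u u' : E n → ℝ} (hu : u =ᵐ[volume] u') :
    weakGradient u = weakGradient u' := by
  unfold weakGradient
  simp only [weakPartial_congr _ hu]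

theorem LocallyIntegrable.integrable_mul_test {n : ℕ} {u φ : E n → ℝ}
    (hu : LocallyIntegrable u volume) (hφ : IsTestFunction univ φ) :
    Integrable fun x => u x * φ x :=
  hu.integrable_smul_right_of_hasCompactSupport hφ.continuous hφ.2.1

theorem HasWeakPartial.sub {n k : ℕ} {s : Fin k → Fin n} {u u' v v' : E n → ℝ}
    (h : HasWeakPartial s u v) (h' : HasWeakPartial s u' v') :
    HasWeakPartial s (u - u') (v - v') := by
  refine ⟨h.1.sub h'.1, h.2.1.sub h'.2.1, fun φ hφ => ?_⟩
  simp only [Pi.sub_apply, sub_mul]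
  rw [integral_sub (LocallyIntegrable.integrable_mul_test h.1 (hφ.partialDeriv s))
    (LocallyIntegrable.integrable_mul_test h'.1 (hφ.partialDeriv s)),
    integral_sub (LocallyIntegrable.integrable_mul_test h.2.1 hφ)
    (LocallyIntegrable.integrable_mul_test h'.2.1 hφ), h.2.2 φ hφ, h'.2.2 φ hφ]
  ring

theorem HasWeakPartial.neg_sum {n k : ℕ} {ι : Type*} (t : Finset ι) {s : Fin k → Fin n}
    {u v : ι → E n → ℝ} (h : ∀ i, HasWeakPartial s (u i) (v i)) :
    HasWeakPartial s (fun x => -∑ i ∈ t, u i x) (fun x => -∑ i ∈ t, v i x) := by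
  have hloc : ∀ w : ι → E n → ℝ, (∀ i, LocallyIntegrable (w i) volume) →
      LocallyIntegrable (fun x => -∑ i ∈ t, w i x) volume := by
    intro w hw
    exact (locallyIntegrable_finsetSum t fun i _ => hw i).neg
  refine ⟨hloc u fun i => (h i).1, hloc v fun i => (h i).2.1, fun φ hφ => ?_⟩
  simp only [neg_mul, Finset.sum_mul]
  rw [integral_neg, integral_neg, integral_finsetSum, integral_finsetSum]
  · simp only [fun i => (h i).2.2 φ hφ]
    rw [← Finset.mul_sum]
    ring
  · exact fun i _ => LocallyIntegrable.integrable_mul_test (h i).2.1 hφ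
  · exact fun i _ => LocallyIntegrable.integrable_mul_test (h i).1 (hφ.partialDeriv s)

/-- Weak derivatives of second weak derivatives. -/
theorem HasWeakPartial.of_comp_two {n k : ℕ} {i j : Fin n} {t : Fin k → Fin n} {u v w : E n → ℝ}
    (h : HasWeakPartial ![i, j] u v)
    (h' : HasWeakPartial (Fin.cons i (Fin.cons j t) : Fin (k + 2) → Fin n) u w) :
    HasWeakPartial t v w := by
  refine ⟨h.2.1, h'.2.1, fun φ hφ => ?_⟩
  have h1 := h.2.2 _ (hφ.partialDeriv t)
  have h2 := h'.2.2 φ hφ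
  rw [partialDeriv_two _ _ (hφ.1.partialDeriv t)] at h1
  rw [partialDeriv_succ _ hφ.1, partialDeriv_succ _ hφ.1] at h2
  have h3 : pd i (pd j (partialDeriv t φ)) =
      pd ((Fin.cons i (Fin.cons j t) : Fin (k + 2) → Fin n) 0)
        (pd ((fun l : Fin (k + 1) => (Fin.cons i (Fin.cons j t) : Fin (k + 2) → Fin n) l.succ) 0)
          (partialDeriv (fun l : Fin k => (fun l : Fin (k + 1) =>
            (Fin.cons i (Fin.cons j t) : Fin (k + 2) → Fin n) l.succ) l.succ) φ)) := rfl
  rw [← h3, h1] at h2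
  linear_combination h2

theorem MemSobolev.hasWeakPartial {n d k : ℕ} {p : ℝ≥0∞} {u : E n → ℝ} (hu : MemSobolev d p u)
    (hk : k ≤ d) (s : Fin k → Fin n) : HasWeakPartial s u (weakPartial s u) := by
  obtain ⟨v, hv, -⟩ := hu.2 k hk s
  exact hv.weakPartial

theorem MemSobolev.memLp_weakPartial {n d k : ℕ} {p : ℝ≥0∞} {u : E n → ℝ}
    (hu : MemSobolev d p u) (hk : k ≤ d) (s : Fin k → Fin n) :
    MemLp (weakPartial s u) p volume := by
  obtain ⟨v, hv, hvp⟩ := hu.2 k hk s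
  exact hvp.ae_eq hv.weakPartial_ae.symm

theorem MemSobolev.sub {n d : ℕ} {p : ℝ≥0∞} {u v : E n → ℝ} (hu : MemSobolev d p u)
    (hv : MemSobolev d p v) : MemSobolev d p (u - v) :=
  ⟨hu.1.sub hv.1, fun _ hk s => ⟨_, (hu.hasWeakPartial hk s).sub (hv.hasWeakPartial hk s),
    (hu.memLp_weakPartial hk s).sub (hv.memLp_weakPartial hk s)⟩⟩

theorem eLpNorm_weakPartial_le {n d k : ℕ} {p : ℝ≥0∞} {u : E n → ℝ} (hk : k ≤ d)
    (s : Fin k → Fin n) : eLpNorm (weakPartial s u) p volume ≤ sobolevNorm d p u := by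
  unfold sobolevNorm
  refine le_trans ?_ (Finset.single_le_sum (f := fun k => ∑ s : Fin k → Fin n,
    eLpNorm (weakPartial s u) p volume) (fun _ _ => zero_le)
    (Finset.mem_range.2 (Nat.lt_succ_of_le hk)))
  exact Finset.single_le_sum (f := fun s : Fin k → Fin n => eLpNorm (weakPartial s u) p volume)
    (fun _ _ => zero_le) (Finset.mem_univ s)

theorem weakPartial_zero_ae {n : ℕ} {u : E n → ℝ} (hu : LocallyIntegrable u volume)
    (s : Fin 0 → Fin n) : weakPartial s u =ᵐ[volume] u := by
  have : HasWeakPartial s u u := ⟨hu, hu, fun φ _ => by simp [partialDeriv_zero]⟩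
  exact this.weakPartial_ae

theorem eLpNorm_le_sobolevNorm {n d : ℕ} {p : ℝ≥0∞} (hp : 1 ≤ p) {u : E n → ℝ}
    (hu : MemSobolev d p u) : eLpNorm u p volume ≤ sobolevNorm d p u := by
  have := weakPartial_zero_ae (hu.1.locallyIntegrable hp) (Fin.elim0 : Fin 0 → Fin n)
  rw [← eLpNorm_congr_ae this]
  exact eLpNorm_weakPartial_le (Nat.zero_le d) _

theorem posLaplacian_hasWeakPartial {n d k : ℕ} {p : ℝ≥0∞} {u : E n → ℝ}
    (hu : MemSobolev (d + 2) p u) (hk : k ≤ d) (t : Fin k → Fin n) :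
    HasWeakPartial t (posLaplacian u)
      (fun x => -∑ i : Fin n, weakPartial (Fin.cons i (Fin.cons i t) : Fin (k + 2) → Fin n) u x) :=
  HasWeakPartial.neg_sum Finset.univ fun i =>
    (hu.hasWeakPartial (by omega) ![i, i]).of_comp_two (hu.hasWeakPartial (by omega) _)

theorem memLp_neg_sum {n : ℕ} {p : ℝ≥0∞} {v : Fin n → E n → ℝ}
    (h : ∀ i, MemLp (v i) p volume) : MemLp (fun x => -∑ i : Fin n, v i x) p volume :=
  (memLp_finsetSum Finset.univ fun i _ => h i).neg

theorem eLpNorm_neg_sum_le {n : ℕ} {p : ℝ≥0∞} (hp : 1 ≤ p) {v : Fin n → E n → ℝ} {B : ℝ≥0∞}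
    (h : ∀ i, AEStronglyMeasurable (v i) volume) (hB : ∀ i, eLpNorm (v i) p volume ≤ B) :
    eLpNorm (fun x => -∑ i : Fin n, v i x) p volume ≤ n * B := by
  have e : (fun x => -∑ i : Fin n, v i x) = -∑ i : Fin n, v i := by
    ext x
    simp
  rw [e, eLpNorm_neg]
  refine (eLpNorm_sum_le (fun i _ => h i) hp).trans ?_
  refine (Finset.sum_le_sum fun i _ => hB i).trans ?_
  simp

theorem MemSobolev.posLaplacian {n d : ℕ} {p : ℝ≥0∞} {u : E n → ℝ}
    (hu : MemSobolev (d + 2) p u) : MemSobolev d p (posLaplacian u) :=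
  ⟨memLp_neg_sum fun i => hu.memLp_weakPartial (by omega) _, fun k hk t =>
    ⟨_, posLaplacian_hasWeakPartial hu hk t,
      memLp_neg_sum fun i => hu.memLp_weakPartial (by omega) _⟩⟩

theorem exists_sobolevNorm_posLaplacian_le (n d : ℕ) {p : ℝ≥0∞} (hp : 1 ≤ p) :
    ∃ C : ℝ≥0∞, C ≠ ⊤ ∧ ∀ u : E n → ℝ, MemSobolev (d + 2) p u →
      sobolevNorm d p (posLaplacian u) ≤ C * sobolevNorm (d + 2) p u := by
  refine ⟨∑ k ∈ Finset.range (d + 1), ∑ _s : Fin k → Fin n, (n : ℝ≥0∞), ?_, fun u hu => ?_⟩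
  · exact ENNReal.sum_ne_top.2 fun k _ => ENNReal.sum_ne_top.2 fun s _ => ENNReal.natCast_ne_top n
  · conv_lhs => unfold sobolevNorm
    rw [Finset.sum_mul]
    refine Finset.sum_le_sum fun k hk => ?_
    rw [Finset.sum_mul]
    refine Finset.sum_le_sum fun t _ => ?_
    have hk' : k ≤ d := Nat.lt_succ_iff.1 (Finset.mem_range.1 hk)
    rw [eLpNorm_congr_ae (posLaplacian_hasWeakPartial hu hk' t).weakPartial_ae]
    exact eLpNorm_neg_sum_le hp (fun i => (hu.memLp_weakPartial (by omega) _).1) fun i =>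
      eLpNorm_weakPartial_le (by omega) _

theorem posLaplacian_sub {n d : ℕ} {p : ℝ≥0∞} {u v : E n → ℝ} (hu : MemSobolev (d + 2) p u)
    (hv : MemSobolev (d + 2) p v) :
    posLaplacian (u - v) =ᵐ[volume] posLaplacian u - posLaplacian v := by
  have h : ∀ i : Fin n, weakPartial ![i, i] (u - v) =ᵐ[volume]
      weakPartial ![i, i] u - weakPartial ![i, i] v := fun i =>
    ((hu.hasWeakPartial (by omega) ![i, i]).sub
      (hv.hasWeakPartial (by omega) ![i, i])).weakPartial_ae
  filter_upwards [ae_all_iff.2 h] with x hx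
  simp only [posLaplacian, Pi.sub_apply, hx, Finset.sum_sub_distrib]
  ring

theorem MemSobolev.iterate_posLaplacian {n d k : ℕ} {p : ℝ≥0∞} {u : E n → ℝ}
    (hu : MemSobolev (d + 2 * k) p u) : MemSobolev d p (_root_.posLaplacian^[k] u) := by
  induction k generalizing u with
  | zero => exact hu
  | succ k ih =>
    rw [Function.iterate_succ_apply]
    exact ih (MemSobolev.posLaplacian (d := d + 2 * k) hu)

theorem iterate_posLaplacian_congr {n k : ℕ} {u v : E n → ℝ} (h : u =ᵐ[volume] v) :
    posLaplacian^[k] u =ᵐ[volume] posLaplacian^[k] v := by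
  cases k with
  | zero => exact h
  | succ k => rw [Function.iterate_succ_apply, Function.iterate_succ_apply, posLaplacian_congr h]

theorem iterate_posLaplacian_sub {n d k : ℕ} {p : ℝ≥0∞} {u v : E n → ℝ}
    (hu : MemSobolev (d + 2 * k) p u) (hv : MemSobolev (d + 2 * k) p v) :
    posLaplacian^[k] (u - v) =ᵐ[volume] posLaplacian^[k] u - posLaplacian^[k] v := by
  induction k generalizing u v with
  | zero => exact EventuallyEq.rfl
  | succ k ih =>
    rw [Function.iterate_succ_apply, Function.iterate_succ_apply, Function.iterate_succ_apply]
    have h1 := posLaplacian_sub (d := d + 2 * k) hu hv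
    exact (iterate_posLaplacian_congr h1).trans
      (ih (MemSobolev.posLaplacian (d := d + 2 * k) hu)
        (MemSobolev.posLaplacian (d := d + 2 * k) hv))

theorem exists_sobolevNorm_iterate_le (n d k : ℕ) {p : ℝ≥0∞} (hp : 1 ≤ p) :
    ∃ C : ℝ≥0∞, C ≠ ⊤ ∧ ∀ u : E n → ℝ, MemSobolev (d + 2 * k) p u →
      sobolevNorm d p (posLaplacian^[k] u) ≤ C * sobolevNorm (d + 2 * k) p u := by
  induction k with
  | zero => exact ⟨1, ENNReal.one_ne_top, fun u _ => by simp⟩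
  | succ k ih =>
    obtain ⟨C, hC, h⟩ := ih
    obtain ⟨C', hC', h'⟩ := exists_sobolevNorm_posLaplacian_le n (d + 2 * k) hp
    refine ⟨C * C', ENNReal.mul_ne_top hC hC', fun u hu => ?_⟩
    rw [Function.iterate_succ_apply, mul_assoc]
    exact (h _ (MemSobolev.posLaplacian (d := d + 2 * k) hu)).trans
      (mul_le_mul_right (h' u hu) C)

theorem IsTestFunction.memLp {n : ℕ} {U : Set (E n)} {φ : E n → ℝ} (hφ : IsTestFunction U φ)
    (p : ℝ≥0∞) : MemLp φ p volume :=
  hφ.continuous.memLp_of_hasCompactSupport hφ.2.1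

theorem IsTestFunction.memSobolev {n : ℕ} {U : Set (E n)} {φ : E n → ℝ}
    (hφ : IsTestFunction U φ) (d : ℕ) (p : ℝ≥0∞) : MemSobolev d p φ :=
  ⟨hφ.memLp p, fun _ _ s => ⟨_, hφ.1.hasWeakPartial s, (hφ.partialDeriv s).memLp p⟩⟩

theorem sobolevNorm_zero {n d : ℕ} {p : ℝ≥0∞} : sobolevNorm d p (0 : E n → ℝ) = 0 := by
  unfold sobolevNorm
  refine Finset.sum_eq_zero fun k _ => Finset.sum_eq_zero fun s _ => ?_
  have h0 : HasWeakPartial s (0 : E n → ℝ) 0 :=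
    ⟨locallyIntegrable_zero, locallyIntegrable_zero, fun φ _ => by simp⟩
  rw [eLpNorm_congr_ae h0.weakPartial_ae, eLpNorm_zero]

theorem IsTestFunction.memSobolevZero {n : ℕ} {U : Set (E n)} {φ : E n → ℝ}
    (hφ : IsTestFunction U φ) (d : ℕ) (p : ℝ≥0∞) : MemSobolevZero U d p φ :=
  ⟨hφ.memSobolev d p, fun ε hε => ⟨φ, hφ, by rwa [sub_self, sobolevNorm_zero]⟩⟩

theorem posLaplacian_ae_cLap {n : ℕ} {φ : E n → ℝ} (hφ : ContDiff ℝ ∞ φ) :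
    posLaplacian φ =ᵐ[volume] cLap φ := by
  have h : ∀ i : Fin n, weakPartial ![i, i] φ =ᵐ[volume] pd i (pd i φ) := fun i => by
    have := (hφ.hasWeakPartial ![i, i]).weakPartial_ae
    rwa [partialDeriv_two _ _ hφ] at this
  filter_upwards [ae_all_iff.2 h] with x hx
  simp only [posLaplacian, cLap, hx]

theorem iterate_posLaplacian_ae_cLap {n : ℕ} {U : Set (E n)} {φ : E n → ℝ}
    (hφ : IsTestFunction U φ) (k : ℕ) : posLaplacian^[k] φ =ᵐ[volume] cLap^[k] φ := by
  induction k generalizing φ with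
  | zero => exact EventuallyEq.rfl
  | succ k ih =>
    rw [Function.iterate_succ_apply, Function.iterate_succ_apply]
    exact (iterate_posLaplacian_congr (posLaplacian_ae_cLap hφ.1)).trans (ih hφ.cLap)

/-- The classical gradient. -/
def cGrad {n : ℕ} (φ : E n → ℝ) (x : E n) : E n := WithLp.toLp 2 fun i => pd i φ x

theorem weakGradient_ae_cGrad {n : ℕ} {φ : E n → ℝ} (hφ : ContDiff ℝ ∞ φ) :
    weakGradient φ =ᵐ[volume] cGrad φ := by
  have h : ∀ i : Fin n, weakPartial ![i] φ =ᵐ[volume] pd i φ := fun i => by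
    have := (hφ.hasWeakPartial ![i]).weakPartial_ae
    rwa [partialDeriv_one _ hφ] at this
  filter_upwards [ae_all_iff.2 h] with x hx
  simp only [weakGradient, cGrad, hx]

theorem weakGradient_sub {n : ℕ} {p : ℝ≥0∞} {u v : E n → ℝ} (hu : MemSobolev 1 p u)
    (hv : MemSobolev 1 p v) :
    weakGradient (u - v) =ᵐ[volume] weakGradient u - weakGradient v := by
  have h : ∀ i : Fin n, weakPartial ![i] (u - v) =ᵐ[volume]
      weakPartial ![i] u - weakPartial ![i] v := fun i =>
    ((hu.hasWeakPartial le_rfl ![i]).sub (hv.hasWeakPartial le_rfl ![i])).weakPartial_ae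
  filter_upwards [ae_all_iff.2 h] with x hx
  ext i
  simp [weakGradient, hx]

theorem norm_toLp_le_sum {n : ℕ} (v : Fin n → ℝ) :
    ‖(WithLp.toLp 2 v : E n)‖ ≤ ∑ i : Fin n, ‖v i‖ := by
  rw [EuclideanSpace.norm_eq]
  refine Real.sqrt_le_iff.2 ⟨Finset.sum_nonneg fun i _ => norm_nonneg _, ?_⟩
  exact Finset.sum_sq_le_sq_sum_of_nonneg fun i _ => norm_nonneg _

theorem MemSobolev.memLp_weakGradient {n : ℕ} {p : ℝ≥0∞} {u : E n → ℝ}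
    (hu : MemSobolev 1 p u) : MemLp (weakGradient u) p volume := by
  unfold weakGradient
  have h : MemLp (fun x => ∑ i : Fin n, ‖weakPartial ![i] u x‖) p volume :=
    memLp_finsetSum _ fun i _ => (hu.memLp_weakPartial le_rfl ![i]).norm
  refine h.mono ?_ (Eventually.of_forall fun x => ?_)
  · have h1 : AEStronglyMeasurable (fun x => fun i : Fin n => weakPartial ![i] u x) volume :=
      (aemeasurable_pi_lambda _ fun i =>
        (hu.memLp_weakPartial le_rfl ![i]).1.aemeasurable).aestronglyMeasurable
    exact (PiLp.continuous_toLp 2 _).comp_aestronglyMeasurable h1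
  · refine (norm_toLp_le_sum _).trans (le_abs_self _)

theorem eLpNorm_weakGradient_le {n : ℕ} {p : ℝ≥0∞} (hp : 1 ≤ p) {u : E n → ℝ}
    (hu : MemSobolev 1 p u) : eLpNorm (weakGradient u) p volume ≤ n * sobolevNorm 1 p u := by
  calc eLpNorm (weakGradient u) p volume
      ≤ eLpNorm (∑ i : Fin n, fun x => ‖weakPartial ![i] u x‖) p volume := by
        refine eLpNorm_mono fun x => ?_
        rw [Finset.sum_apply]
        exact (norm_toLp_le_sum _).trans (le_abs_self _)
    _ ≤ ∑ i : Fin n, eLpNorm (fun x => ‖weakPartial ![i] u x‖) p volume :=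
        eLpNorm_sum_le (fun i _ => (hu.memLp_weakPartial le_rfl ![i]).1.norm) hp
    _ ≤ ∑ i : Fin n, sobolevNorm 1 p u := by
        refine Finset.sum_le_sum fun i _ => ?_
        rw [eLpNorm_norm]
        exact eLpNorm_weakPartial_le le_rfl _
    _ = _ := by simp

/-- Approximation of `u` and its iterated Laplacian by test functions. -/
theorem MemSobolevZero.exists_approx_even {n k : ℕ} {p : ℝ≥0∞} (hp : 1 ≤ p) {Ω : Set (E n)}
    {u : E n → ℝ} (hu : MemSobolevZero Ω (2 * k) p u) {ε : ℝ≥0∞} (hε : 0 < ε) :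
    ∃ φ, IsTestFunction Ω φ ∧ eLpNorm (u - φ) p volume ≤ ε ∧
      eLpNorm (posLaplacian^[k] u - cLap^[k] φ) p volume ≤ ε := by
  obtain ⟨C, hC, h⟩ := exists_sobolevNorm_iterate_le n 0 k hp
  obtain ⟨φ, hφ, hlt⟩ := hu.2 (min ε (ε / (C + 1))) (lt_min hε (ENNReal.div_pos hε.ne' (by
    finiteness)))
  have hu' : MemSobolev (0 + 2 * k) p u := by simpa using hu.1
  have hφ' := hφ.memSobolev (0 + 2 * k) p
  have hsub := hu'.sub hφ'
  refine ⟨φ, hφ, ?_, ?_⟩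
  · exact (eLpNorm_le_sobolevNorm hp (hu.1.sub (hφ.memSobolev _ _))).trans
      (hlt.le.trans (min_le_left _ _))
  · have h1 : posLaplacian^[k] u - cLap^[k] φ =ᵐ[volume] posLaplacian^[k] (u - φ) :=
      ((iterate_posLaplacian_sub hu' hφ').trans
        (EventuallyEq.rfl.sub (iterate_posLaplacian_ae_cLap hφ k))).symm
    rw [eLpNorm_congr_ae h1]
    refine (eLpNorm_le_sobolevNorm hp hsub.iterate_posLaplacian).trans ((h _ hsub).trans ?_)
    rw [zero_add]
    calc C * sobolevNorm (2 * k) p (u - φ) ≤ (C + 1) * (ε / (C + 1)) := by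
          gcongr
          · exact le_self_add
          · exact hlt.le.trans (min_le_right _ _)
      _ = ε := ENNReal.mul_div_cancel (by simp) (by finiteness)

theorem MemSobolevZero.exists_approx_odd {n k : ℕ} {p : ℝ≥0∞} (hp : 1 ≤ p) {Ω : Set (E n)}
    {u : E n → ℝ} (hu : MemSobolevZero Ω (2 * k + 1) p u) {ε : ℝ≥0∞} (hε : 0 < ε) :
    ∃ φ, IsTestFunction Ω φ ∧ eLpNorm (u - φ) p volume ≤ ε ∧
      eLpNorm (weakGradient (posLaplacian^[k] u) - cGrad (cLap^[k] φ)) p volume ≤ ε := by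
  obtain ⟨C, hC, h⟩ := exists_sobolevNorm_iterate_le n 1 k hp
  obtain ⟨φ, hφ, hlt⟩ := hu.2 (min ε (ε / (n * C + 1))) (lt_min hε (ENNReal.div_pos hε.ne' (by
    finiteness)))
  have hu' : MemSobolev (1 + 2 * k) p u := by
    rw [add_comm]
    exact hu.1
  have hφ' := hφ.memSobolev (1 + 2 * k) p
  have hsub := hu'.sub hφ'
  refine ⟨φ, hφ, ?_, ?_⟩
  · exact (eLpNorm_le_sobolevNorm hp (hu.1.sub (hφ.memSobolev _ _))).trans
      (hlt.le.trans (min_le_left _ _))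
  · have h0 : weakGradient (posLaplacian^[k] φ) =ᵐ[volume] cGrad (cLap^[k] φ) := by
      rw [weakGradient_congr (iterate_posLaplacian_ae_cLap hφ k)]
      exact weakGradient_ae_cGrad (hφ.iterate_cLap k).1
    have h1 : weakGradient (posLaplacian^[k] u) - cGrad (cLap^[k] φ) =ᵐ[volume]
        weakGradient (posLaplacian^[k] (u - φ)) := by
      rw [weakGradient_congr (iterate_posLaplacian_sub hu' hφ')]
      exact ((weakGradient_sub hu'.iterate_posLaplacian hφ'.iterate_posLaplacian).trans
        (EventuallyEq.rfl.sub h0)).symm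
    rw [eLpNorm_congr_ae h1]
    refine (eLpNorm_weakGradient_le hp hsub.iterate_posLaplacian).trans
      ((mul_le_mul_right (h _ hsub) _).trans ?_)
    rw [add_comm 1, ← mul_assoc]
    calc n * C * sobolevNorm (2 * k + 1) p (u - φ) ≤ (n * C + 1) * (ε / (n * C + 1)) := by
          gcongr
          · exact le_self_add
          · exact hlt.le.trans (min_le_right _ _)
      _ = ε := ENNReal.mul_div_cancel (by simp) (by finiteness)

/-- Kernels `k(z)` of linear functionals which are dominated by `|z|^{-a}`. -/
structure IsRieszKernel {n : ℕ} {F : Type*} [NormedAddCommGroup F] [MeasurableSpace F] (a : ℝ)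
    (k : E n → F → ℝ) : Prop where
  measurable : Measurable fun z : E n × F => k z.1 z.2
  sub : ∀ z v w, k z (v - w) = k z v - k z w
  bound : ∀ z v, |k z v| ≤ ‖z‖ ^ (-a) * ‖v‖
  cont : ∀ v z, z ≠ 0 → ContinuousAt (fun z => k z v) z

/-- The potential `∫_Ω k(x - y) G(y) dy`. -/
def kerPot {n : ℕ} {F : Type*} (k : E n → F → ℝ) (Ω : Set (E n)) (G : E n → F) (x : E n) : ℝ :=
  ∫ y in Ω, k (x - y) (G y)

/-- The length of `G` on `Ω`, extended by zero. -/
def absOn {n : ℕ} {F : Type*} [NormedAddCommGroup F] (Ω : Set (E n)) (G : E n → F) :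
    E n → ℝ≥0∞ :=
  Ω.indicator fun y => ‖G y‖ₑ

theorem measurable_absOn {n : ℕ} {F : Type*} [NormedAddCommGroup F] [MeasurableSpace F]
    [BorelSpace F] {Ω : Set (E n)} {G : E n → F}
    (hΩ : MeasurableSet Ω) (hG : Measurable G) :
    Measurable (absOn Ω G) := hG.enorm.indicator hΩ

theorem rieszPot_absOn {n : ℕ} {F : Type*} [NormedAddCommGroup F]
    {a : ℝ} {Ω : Set (E n)} {G : E n → F}
    (hΩ : MeasurableSet Ω) (x : E n) :
    rieszPot a (absOn Ω G) x = ∫⁻ y in Ω, powKer a (x - y) * ‖G y‖ₑ := by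
  unfold rieszPot absOn
  rw [← lintegral_indicator hΩ]
  refine lintegral_congr fun y => ?_
  by_cases hy : y ∈ Ω
  · rw [indicator_of_mem hy, indicator_of_mem hy]
  · rw [indicator_of_notMem hy, indicator_of_notMem hy, mul_zero]

theorem lintegral_absOn_rpow {n : ℕ} {F : Type*} [NormedAddCommGroup F]
    {Ω : Set (E n)} {G : E n → F}
    {p : ℝ} (hp : 1 ≤ p) (hΩ : MeasurableSet Ω) :
    (∫⁻ y, absOn Ω G y ^ p) ^ (1 / p) =
      eLpNorm G (ENNReal.ofReal p) (volume.restrict Ω) := by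
  have hp0 : 0 < p := by linarith
  unfold absOn
  rw [lintegral_indicator_rpow hp0 hΩ, eLpNorm_eq_lintegral_rpow_enorm_toReal
    (ENNReal.ofReal_pos.2 hp0).ne' ENNReal.ofReal_ne_top, ENNReal.toReal_ofReal hp0.le]

theorem IsRieszKernel.enorm_le {n : ℕ} {F : Type*} [NormedAddCommGroup F] [MeasurableSpace F]
    {a : ℝ} {k : E n → F → ℝ}
    (hk : IsRieszKernel a k) (z : E n) (v : F) :
    ‖k z v‖ₑ ≤ powKer a z * ‖v‖ₑ := by
  unfold powKer
  rw [← ofReal_norm, ← ofReal_norm v, ← ENNReal.ofReal_mul (by positivity),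
    Real.norm_eq_abs]
  exact ENNReal.ofReal_le_ofReal (hk.bound z v)

theorem IsRieszKernel.integrable {n : ℕ} {F : Type*} [NormedAddCommGroup F] [MeasurableSpace F]
    {a : ℝ} {k : E n → F → ℝ} {Ω : Set (E n)} {G : E n → F}
    (hk : IsRieszKernel a k) (hΩ : MeasurableSet Ω)
    (hG : Measurable G) {x : E n} (hx : rieszPot a (absOn Ω G) x ≠ ⊤) :
    Integrable (fun y => k (x - y) (G y)) (volume.restrict Ω) := by
  have hm : Measurable fun y => k (x - y) (G y) :=
    hk.measurable.comp ((measurable_const.sub measurable_id).prodMk hG)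
  refine ⟨hm.aestronglyMeasurable, ?_⟩
  refine lt_of_le_of_lt (lintegral_mono fun y => hk.enorm_le (x - y) (G y)) ?_
  rw [← rieszPot_absOn hΩ]
  exact hx.lt_top

theorem IsRieszKernel.enorm_kerPot_le {n : ℕ} {F : Type*} [NormedAddCommGroup F] [MeasurableSpace F]
    {a : ℝ} {k : E n → F → ℝ} {Ω : Set (E n)} {G : E n → F}
    (hk : IsRieszKernel a k) (hΩ : MeasurableSet Ω)
    (x : E n) : ‖kerPot k Ω G x‖ₑ ≤ rieszPot a (absOn Ω G) x := by
  rw [rieszPot_absOn hΩ]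
  exact (enorm_integral_le_lintegral_enorm _).trans
    (lintegral_mono fun y => hk.enorm_le (x - y) (G y))

theorem IsRieszKernel.measurable_kerPot {n : ℕ} {F : Type*} [NormedAddCommGroup F] [MeasurableSpace F]
    {a : ℝ} {k : E n → F → ℝ} {Ω : Set (E n)} {G : E n → F}
    (hk : IsRieszKernel a k) (hG : Measurable G) :
    StronglyMeasurable (kerPot k Ω G) := by
  unfold kerPot
  have : Measurable fun z : E n × E n => k (z.1 - z.2) (G z.2) :=
    hk.measurable.comp ((measurable_fst.sub measurable_snd).prodMk (hG.comp measurable_snd))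
  exact this.stronglyMeasurable.integral_prod_right'

theorem kerPot_sub {n : ℕ} {F : Type*} [NormedAddCommGroup F] [MeasurableSpace F]
    {a : ℝ} {k : E n → F → ℝ} {Ω : Set (E n)} {G : E n → F}
    (hk : IsRieszKernel a k) (hΩ : MeasurableSet Ω) {H : E n → F}
    (hG : Measurable G) (hH : Measurable H) {x : E n}
    (hx : rieszPot a (absOn Ω G) x ≠ ⊤) (hx' : rieszPot a (absOn Ω H) x ≠ ⊤) :
    kerPot k Ω G x - kerPot k Ω H x = kerPot k Ω (G - H) x := by
  unfold kerPot
  rw [← integral_sub (hk.integrable hΩ hG hx) (hk.integrable hΩ hH hx')]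
  simp only [Pi.sub_apply, hk.sub]

/-- Riesz potentials are integrable for measures with polynomial growth. -/
theorem lintegral_rieszPot_le {n : ℕ} (hn : 0 < n) {p q : ℝ} (hpq : q.HolderConjugate p)
    {μ : Measure (E n)} [IsFiniteMeasure μ] {C lam : ℝ} (hC : 0 ≤ C) (hlam : 0 < lam)
    (hμ : ∀ (x : E n) (r : ℝ), 0 < r → μ (ball x r) ≤ ENNReal.ofReal (C * r ^ lam))
    {Ω : Set (E n)} (hΩm : MeasurableSet Ω) (hΩb : Bornology.IsBounded Ω) :
    ∃ C' : ℝ≥0∞, C' ≠ ⊤ ∧ ∀ h : E n → ℝ≥0∞, Measurable h → (∀ y ∉ Ω, h y = 0) →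
      ∫⁻ x in Ω, rieszPot (n / q) h x ∂μ ≤ C' * (∫⁻ y, h y ^ p) ^ (1 / p) := by
  obtain ⟨C₁, hC₁, h₁⟩ := lintegral_near_potential_le hn hpq hC hlam hμ
  obtain ⟨D, hD⟩ := Metric.isBounded_iff.1 hΩb
  set R := max (D + 1) 1 with hR
  have hR0 : 0 < R := by positivity
  have hq0 : 0 < q := hpq.pos
  refine ⟨ENNReal.ofReal (C₁ * R ^ (lam / p)) * μ Ω ^ (1 / q), by
    have : 0 ≤ 1 / q := by positivity
    finiteness, fun h hh hΩ => ?_⟩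
  refine le_trans (setLIntegral_mono' hΩm fun x hx => ?_) (h₁ Ω h R hh hR0)
  refine lintegral_mono fun y => ?_
  by_cases hy : y ∈ Ω
  · have : x - y ∈ ball (0 : E n) R := by
      rw [mem_ball_zero_iff, ← dist_eq_norm]
      refine lt_of_lt_of_le ?_ (le_max_left _ _)
      linarith [hD hx hy]
    unfold nearKer
    rw [indicator_of_mem this]
  · rw [hΩ y hy, mul_zero]
    exact zero_le

/-- Averages of `|z - y|^{-a}` over balls are bounded by the value at the centre. -/
theorem exists_setLIntegral_powKer_le {n : ℕ} {a : ℝ} (ha : 0 < a) (han : a < n) :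
    ∃ C : ℝ, 0 ≤ C ∧ ∀ (x y : E n) (r : ℝ), 0 < r → x ≠ y →
      ∫⁻ z in ball x r, powKer a (z - y) ≤
        ENNReal.ofReal C * powKer a (x - y) * volume (ball x r) := by
  obtain ⟨C₁, hC₁, h₁⟩ := lintegral_nearKer_le (μ := (volume : Measure (E n))) (lam := n)
    (a := a) (C := volume.real (ball (0 : E n) 1)) measureReal_nonneg
    (fun x r hr => (volume_ball_le x hr).le) ha han
  set v := volume.real (ball (0 : E n) 1) with hv
  have hv0 : 0 < v := volume_real_ball_pos
  refine ⟨2 ^ a + C₁ * 3 ^ ((n : ℝ) - a) * 2 ^ a / v, by positivity, ?_⟩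
  intro x y r hr hxy
  have hρ : 0 < ‖x - y‖ := norm_pos_iff.2 (sub_ne_zero.2 hxy)
  set ρ := ‖x - y‖ with hρdef
  have hhalf : (ρ / 2) ^ (-a) = 2 ^ a * ρ ^ (-a) := by
    rw [Real.div_rpow hρ.le zero_le_two, Real.rpow_neg zero_le_two]
    field_simp
  rcases le_or_gt r (ρ / 2) with h | h
  · calc ∫⁻ z in ball x r, powKer a (z - y)
        ≤ ∫⁻ _ in ball x r, ENNReal.ofReal (2 ^ a * ρ ^ (-a)) := by
          refine setLIntegral_mono' measurableSet_ball fun z hz => ?_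
          unfold powKer
          refine ENNReal.ofReal_le_ofReal ?_
          rw [← hhalf]
          refine Real.rpow_le_rpow_of_nonpos (by positivity) ?_ (by linarith)
          rw [mem_ball_iff_norm] at hz
          have h3 : ρ ≤ ‖x - z‖ + ‖z - y‖ := by
            have := norm_add_le (x - z) (z - y)
            rwa [sub_add_sub_cancel] at this
          rw [norm_sub_rev] at h3
          linarith
      _ = ENNReal.ofReal (2 ^ a * ρ ^ (-a)) * volume (ball x r) := by
          rw [lintegral_const, Measure.restrict_apply_univ]
      _ ≤ _ := by
          unfold powKer
          rw [← ENNReal.ofReal_mul (by positivity)]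
          gcongr
          have : 0 ≤ C₁ * 3 ^ ((n : ℝ) - a) * 2 ^ a / v := by positivity
          linarith
  · have hsub : ball x r ⊆ ball y (3 * r) := by
      intro z hz
      rw [mem_ball_iff_norm] at hz ⊢
      have h3 : ‖z - y‖ ≤ ‖z - x‖ + ρ := by
        have := norm_add_le (z - x) (x - y)
        rwa [sub_add_sub_cancel] at this
      linarith
    calc ∫⁻ z in ball x r, powKer a (z - y)
        ≤ ∫⁻ z in ball x r, nearKer a (3 * r) (z - y) := by
          refine setLIntegral_mono' measurableSet_ball fun z hz => ?_
          have := hsub hz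
          unfold nearKer
          rw [indicator_of_mem (by rwa [mem_ball_zero_iff, ← mem_ball_iff_norm])]
      _ ≤ ∫⁻ z, nearKer a (3 * r) (z - y) := setLIntegral_le_lintegral _ _
      _ ≤ ENNReal.ofReal (C₁ * (3 * r) ^ ((n : ℝ) - a)) := h₁ y (3 * r) (by positivity)
      _ ≤ _ := by
          rw [volume_ball_le x hr, ← hv]
          unfold powKer
          rw [← ENNReal.ofReal_mul (by positivity), ← ENNReal.ofReal_mul (by positivity)]
          refine ENNReal.ofReal_le_ofReal ?_
          have e1 : (3 * r) ^ ((n : ℝ) - a) = 3 ^ ((n : ℝ) - a) * (r ^ (n : ℝ) * r ^ (-a)) := by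
            rw [Real.mul_rpow (by norm_num) hr.le, ← Real.rpow_add hr]
            rfl
          have e2 : r ^ (-a) ≤ 2 ^ a * ρ ^ (-a) := by
            rw [← hhalf]
            exact Real.rpow_le_rpow_of_nonpos (by positivity) h.le (by linarith)
          rw [e1, ← hρdef]
          calc C₁ * (3 ^ ((n : ℝ) - a) * (r ^ (n : ℝ) * r ^ (-a)))
              ≤ C₁ * (3 ^ ((n : ℝ) - a) * (r ^ (n : ℝ) * (2 ^ a * ρ ^ (-a)))) := by gcongr
            _ = C₁ * 3 ^ ((n : ℝ) - a) * 2 ^ a / v * ρ ^ (-a) * (v * r ^ (n : ℝ)) := by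
                field_simp
            _ ≤ _ := by
                gcongr
                have : (0 : ℝ) ≤ 2 ^ a := by positivity
                linarith

theorem tendsto_average_of_continuousAt {n : ℕ} {f : E n → ℝ} {x : E n} {r₀ : ℝ} (hr₀ : 0 < r₀)
    (hf : ∀ z ∈ ball x r₀, ContinuousAt f z) :
    Tendsto (fun r => ⨍ z in ball x r, f z) (𝓝[>] 0) (𝓝 (f x)) := by
  rw [Metric.tendsto_nhds]
  intro ε hε
  obtain ⟨δ, hδ, hδf⟩ := Metric.continuousAt_iff.1 (hf x (mem_ball_self hr₀)) (ε / 2) (by positivity)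
  have hmem : Ioo (0 : ℝ) (min δ r₀) ∈ 𝓝[>] (0 : ℝ) :=
    Ioo_mem_nhdsGT (lt_min hδ hr₀)
  filter_upwards [hmem] with r hr
  have hint : IntegrableOn f (ball x r) := by
    have hc : ContinuousOn f (closedBall x r) := fun z hz =>
      (hf z (closedBall_subset_ball (hr.2.trans_le (min_le_right _ _)) hz)).continuousWithinAt
    exact (hc.integrableOn_compact (isCompact_closedBall x r)).mono_set ball_subset_closedBall
  have := (convex_closedBall (f x) (ε / 2)).set_average_mem (μ := volume) isClosed_closedBall
    (measure_ball_pos _ x hr.1).ne' (by finiteness) (f := f) (t := ball x r) ?_ hint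
  · rw [mem_closedBall] at this
    linarith
  · refine (ae_restrict_iff' measurableSet_ball).2 (Eventually.of_forall fun z hz => ?_)
    rw [mem_closedBall]
    exact (hδf ((mem_ball.1 hz).trans_le (hr.2.le.trans (min_le_left _ _)))).le

/-- A growth bound at small scales on a bounded set is a growth bound at all scales. -/
theorem exists_growth_all {n : ℕ} {Ω : Set (E n)}
    (hΩb : Bornology.IsBounded Ω)
    {ν : Measure (E n)} {lam : ℝ} (hlam : 0 < lam)
    (hν : ∃ C r₀ : ℝ, 0 < r₀ ∧ ∀ (x : E n) (r : ℝ), 0 < r → r ≤ r₀ →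
      ν (ball x r ∩ Ω) ≤ ENNReal.ofReal (C * r ^ lam)) :
    IsFiniteMeasure (ν.restrict Ω) ∧ ∃ C : ℝ, 0 ≤ C ∧ ∀ (x : E n) (r : ℝ), 0 < r →
      ν.restrict Ω (ball x r) ≤ ENNReal.ofReal (C * r ^ lam) := by
  obtain ⟨C, r₀, hr₀, h⟩ := hν
  have hfin : ν Ω < ⊤ := by
    obtain ⟨t, ht, hcov⟩ := Metric.totallyBounded_iff.1
      (hΩb.isCompact_closure.totallyBounded.subset subset_closure) r₀ hr₀
    have h1 : Ω ⊆ ⋃ y ∈ t, (ball y r₀ ∩ Ω) := by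
      intro x hx
      obtain ⟨y, hy, hxy⟩ := mem_iUnion₂.1 (hcov hx)
      exact mem_iUnion₂.2 ⟨y, hy, hxy, hx⟩
    refine (measure_mono h1).trans_lt (measure_biUnion_lt_top ht fun y _ => ?_)
    exact (h y r₀ hr₀ le_rfl).trans_lt ENNReal.ofReal_lt_top
  refine ⟨⟨by rwa [Measure.restrict_apply_univ]⟩, max (max C 0) ((ν Ω).toReal / r₀ ^ lam),
    le_trans (le_max_right _ _) (le_max_left _ _), fun x r hr => ?_⟩
  have hrl : 0 < r ^ lam := by positivity
  rw [Measure.restrict_apply measurableSet_ball]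
  rcases le_or_gt r r₀ with hrr | hrr
  · refine (h x r hr hrr).trans (ENNReal.ofReal_le_ofReal ?_)
    gcongr
    exact (le_max_left _ _).trans (le_max_left _ _)
  · refine (measure_mono inter_subset_right).trans ?_
    refine ENNReal.le_ofReal_iff_toReal_le hfin.ne (by positivity) |>.2 ?_
    have h0 : 0 < r₀ ^ lam := by positivity
    calc (ν Ω).toReal = (ν Ω).toReal / r₀ ^ lam * r₀ ^ lam := by field_simp
      _ ≤ (ν Ω).toReal / r₀ ^ lam * r ^ lam := by gcongr
      _ ≤ _ := by
        gcongr
        exact le_max_right _ _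

theorem rieszPot_absOn_ae_ne_top {n : ℕ} (hn : 0 < n) {p q : ℝ} (hpq : q.HolderConjugate p)
    {F : Type*} [NormedAddCommGroup F] [MeasurableSpace F] [BorelSpace F]
    {μ : Measure (E n)} [IsFiniteMeasure μ] {C lam : ℝ} (hC : 0 ≤ C) (hlam : 0 < lam)
    (hμ : ∀ (x : E n) (r : ℝ), 0 < r → μ (ball x r) ≤ ENNReal.ofReal (C * r ^ lam))
    {Ω : Set (E n)} (hΩm : MeasurableSet Ω) (hΩb : Bornology.IsBounded Ω) {G : E n → F}
    (hGm : Measurable G) (hG : eLpNorm G (ENNReal.ofReal p) (volume.restrict Ω) ≠ ⊤) :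
    ∀ᵐ x ∂μ.restrict Ω, rieszPot (n / q) (absOn Ω G) x ≠ ⊤ := by
  obtain ⟨C', hC', h⟩ := lintegral_rieszPot_le hn hpq hC hlam hμ hΩm hΩb
  have h1 := h (absOn Ω G) (measurable_absOn hΩm hGm) (fun y hy => indicator_of_notMem hy _)
  rw [lintegral_absOn_rpow hpq.symm.lt.le hΩm] at h1
  have h2 : ∫⁻ x in Ω, rieszPot (n / q) (absOn Ω G) x ∂μ ≠ ⊤ :=
    (h1.trans_lt (ENNReal.mul_lt_top hC'.lt_top hG.lt_top)).ne
  filter_upwards [ae_lt_top (measurable_rieszPot _ (measurable_absOn hΩm hGm)) h2] with x hx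
  exact hx.ne

theorem ae_eq_kerPot {n : ℕ} (hn : 0 < n) {p q : ℝ} (hpq : q.HolderConjugate p)
    {F : Type*} [NormedAddCommGroup F] [MeasurableSpace F] [BorelSpace F]
    [SecondCountableTopology F]
    {k : E n → F → ℝ} (hk : IsRieszKernel (n / q) k) {κ : ℝ}
    {Ω : Set (E n)} (hΩm : MeasurableSet Ω) (hΩb : Bornology.IsBounded Ω)
    {u : E n → ℝ} {G : E n → F}
    (hu : AEStronglyMeasurable u (volume.restrict Ω)) (hGm : Measurable G)
    (hG : eLpNorm G (ENNReal.ofReal p) (volume.restrict Ω) ≠ ⊤)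
    (happ : ∀ ε : ℝ≥0∞, 0 < ε → ∃ (φ : E n → ℝ) (g : E n → F), Measurable g ∧ Continuous φ ∧
      (∀ x, φ x = κ * kerPot k Ω g x) ∧
      eLpNorm (u - φ) (ENNReal.ofReal p) (volume.restrict Ω) ≤ ε ∧
      eLpNorm (G - g) (ENNReal.ofReal p) (volume.restrict Ω) ≤ ε) :
    u =ᵐ[volume.restrict Ω] fun x => κ * kerPot k Ω G x := by
  have hp1 : 1 ≤ p := hpq.symm.lt.le
  have : IsFiniteMeasure ((volume : Measure (E n)).restrict Ω) :=
    ⟨by rw [Measure.restrict_apply_univ]; exact hΩb.measure_lt_top⟩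
  have hn0 : (0 : ℝ) < n := by exact_mod_cast hn
  have hgr : ∀ (x : E n) (r : ℝ), 0 < r → (volume : Measure (E n)).restrict Ω (ball x r) ≤
      ENNReal.ofReal (volume.real (ball (0 : E n) 1) * r ^ (n : ℝ)) := fun x r hr =>
    (Measure.restrict_apply_le _ _).trans (volume_ball_le x hr).le
  have hfin : ∀ {H : E n → F}, Measurable H →
      eLpNorm H (ENNReal.ofReal p) (volume.restrict Ω) ≠ ⊤ →
      ∀ᵐ x ∂volume.restrict Ω, rieszPot (n / q) (absOn Ω H) x ≠ ⊤ := by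
    intro H hH hH'
    have := rieszPot_absOn_ae_ne_top hn hpq measureReal_nonneg hn0 hgr hΩm hΩb hH hH'
    rwa [Measure.restrict_restrict hΩm, inter_self] at this
  obtain ⟨C', hC', h⟩ := lintegral_rieszPot_le hn hpq measureReal_nonneg hn0 hgr hΩm hΩb
  rw [Measure.restrict_restrict hΩm, inter_self] at h
  set M : ℝ≥0∞ := volume.restrict Ω univ ^ (1 - 1 / p) with hM
  have hMt : M ≠ ⊤ := by
    have : 0 ≤ 1 - 1 / p := by
      rw [sub_nonneg, div_le_one (by linarith)]
      exact hp1
    finiteness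
  have key : ∀ ε : ℝ≥0∞, 0 < ε → ε ≠ ⊤ →
      ∫⁻ x in Ω, ‖u x - κ * kerPot k Ω G x‖ₑ ≤ (M + ‖κ‖ₑ * C') * ε := by
    intro ε hε hεt
    obtain ⟨φ, g, hgm, hφc, hφ, hφu, hgG⟩ := happ ε hε
    have hgt : eLpNorm g (ENNReal.ofReal p) (volume.restrict Ω) ≠ ⊤ := by
      have e : g = G - (G - g) := by abel
      rw [e]
      refine ((eLpNorm_sub_le hGm.aestronglyMeasurable
        (hGm.sub hgm).aestronglyMeasurable (by simpa using hp1)).trans_lt ?_).ne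
      exact ENNReal.add_lt_top.2 ⟨hG.lt_top, hgG.trans_lt hεt.lt_top⟩
    have hm : Measurable (absOn Ω (G - g)) := measurable_absOn hΩm (hGm.sub hgm)
    calc ∫⁻ x in Ω, ‖u x - κ * kerPot k Ω G x‖ₑ
        ≤ ∫⁻ x in Ω, (‖(u - φ) x‖ₑ + ‖κ‖ₑ * rieszPot (n / q) (absOn Ω (G - g)) x) := by
          refine lintegral_mono_ae ?_
          filter_upwards [hfin hGm hG, hfin hgm hgt] with x hx hx'
          have e : u x - κ * kerPot k Ω G x = (u - φ) x - κ * kerPot k Ω (G - g) x := by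
            rw [← kerPot_sub hk hΩm hGm hgm hx hx', Pi.sub_apply, hφ x]
            ring
          rw [e]
          refine enorm_sub_le.trans ?_
          rw [enorm_mul]
          gcongr
          exact hk.enorm_kerPot_le hΩm x
      _ = (∫⁻ x in Ω, ‖(u - φ) x‖ₑ) +
            ‖κ‖ₑ * ∫⁻ x in Ω, rieszPot (n / q) (absOn Ω (G - g)) x := by
          rw [lintegral_add_right _ ((measurable_rieszPot _ hm).const_mul _),
            lintegral_const_mul _ (measurable_rieszPot _ hm)]
      _ ≤ ε * M + ‖κ‖ₑ * (C' * ε) := by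
          gcongr
          · rw [← eLpNorm_one_eq_lintegral_enorm]
            refine (eLpNorm_le_eLpNorm_mul_rpow_measure_univ (q := ENNReal.ofReal p)
              (by simpa using hp1) (hu.sub hφc.aestronglyMeasurable)).trans ?_
            rw [ENNReal.toReal_one, ENNReal.toReal_ofReal (by linarith), div_one]
            gcongr
          · refine (h _ hm fun y hy => indicator_of_notMem hy _).trans ?_
            rw [lintegral_absOn_rpow hp1 hΩm]
            gcongr
      _ = _ := by ring
  have h0 : ∫⁻ x in Ω, ‖u x - κ * kerPot k Ω G x‖ₑ = 0 := by
    refine le_antisymm ?_ zero_le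
    have hK : M + ‖κ‖ₑ * C' ≠ ⊤ := by finiteness
    have ht : Tendsto (fun ε : ℝ≥0∞ => (M + ‖κ‖ₑ * C') * ε) (𝓝[>] 0)
        (𝓝 ((M + ‖κ‖ₑ * C') * 0)) :=
      (ENNReal.Tendsto.const_mul tendsto_id (Or.inr hK)).mono_left nhdsWithin_le_nhds
    rw [mul_zero] at ht
    refine ge_of_tendsto ht ?_
    filter_upwards [Ioo_mem_nhdsGT (zero_lt_one' ℝ≥0∞)] with ε hε
    exact key ε hε.1 (hε.2.trans ENNReal.one_lt_top).ne
  have hm : AEStronglyMeasurable (fun x => u x - κ * kerPot k Ω G x) (volume.restrict Ω) :=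
    hu.sub ((hk.measurable_kerPot hGm).const_mul κ).aestronglyMeasurable
  rw [lintegral_eq_zero_iff' hm.enorm] at h0
  filter_upwards [h0] with x hx
  have : u x - κ * kerPot k Ω G x = 0 := by simpa using hx
  linarith

theorem enorm_setAverage_le {α : Type*} [MeasurableSpace α] {μ : Measure α} {s : Set α}
    {f : α → ℝ} : ‖⨍ z in s, f z ∂μ‖ₑ ≤ (μ s)⁻¹ * ∫⁻ z in s, ‖f z‖ₑ ∂μ := by
  unfold average
  refine (enorm_integral_le_lintegral_enorm _).trans ?_
  rw [lintegral_smul_measure, Measure.restrict_apply_univ, smul_eq_mul]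

/-- The averages of a potential converge to its value wherever the potential of the absolute
value is finite. -/
theorem tendsto_ballAverage_kerPot {n : ℕ} (hn : 0 < n) {a : ℝ} (ha : 0 < a) (han : a < n)
    {F : Type*} [NormedAddCommGroup F] [MeasurableSpace F] [BorelSpace F]
    {k : E n → F → ℝ} (hk : IsRieszKernel a k) {Ω : Set (E n)} (hΩm : MeasurableSet Ω)
    {G : E n → F} (hGm : Measurable G) {x : E n} (hx : rieszPot a (absOn Ω G) x ≠ ⊤) :
    Tendsto (ballAverage (kerPot k Ω G) x) (𝓝[>] 0) (𝓝 (kerPot k Ω G x)) := by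
  obtain ⟨C, hC, hA⟩ := exists_setLIntegral_powKer_le ha han
  have hjm : Measurable fun z : E n × E n => k (z.1 - z.2) (G z.2) :=
    hk.measurable.comp ((measurable_fst.sub measurable_snd).prodMk (hGm.comp measurable_snd))
  have hne : ∀ᵐ y ∂volume.restrict Ω, x ≠ y := by
    filter_upwards [ae_restrict_of_ae (ae_ne_point hn x)] with y hy using fun h => hy h.symm
  have hin : ∀ r : ℝ, 0 < r → ∀ y, x ≠ y →
      ∫⁻ z in ball x r, ‖k (z - y) (G y)‖ₑ ≤
        volume (ball x r) * (ENNReal.ofReal C * (powKer a (x - y) * ‖G y‖ₑ)) := by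
    intro r hr y hy
    calc ∫⁻ z in ball x r, ‖k (z - y) (G y)‖ₑ
        ≤ ∫⁻ z in ball x r, powKer a (z - y) * ‖G y‖ₑ :=
          lintegral_mono fun z => hk.enorm_le _ _
      _ = (∫⁻ z in ball x r, powKer a (z - y)) * ‖G y‖ₑ :=
          lintegral_mul_const' _ _ enorm_ne_top
      _ ≤ ENNReal.ofReal C * powKer a (x - y) * volume (ball x r) * ‖G y‖ₑ := by
          gcongr
          exact hA x y r hr hy
      _ = _ := by ring
  have hswap : ∀ r : ℝ, 0 < r → ballAverage (kerPot k Ω G) x r =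
      ∫ y in Ω, ⨍ z in ball x r, k (z - y) (G y) := by
    intro r hr
    unfold ballAverage kerPot
    rw [setAverage_eq]
    have hI : Integrable (Function.uncurry fun z y : E n => k (z - y) (G y))
        ((volume.restrict (ball x r)).prod (volume.restrict Ω)) := by
      refine ⟨hjm.aestronglyMeasurable, ?_⟩
      change ∫⁻ z : E n × E n, ‖k (z.1 - z.2) (G z.2)‖ₑ
        ∂((volume.restrict (ball x r)).prod (volume.restrict Ω)) < ⊤
      rw [lintegral_prod_symm _ hjm.enorm.aemeasurable]
      calc ∫⁻ y in Ω, (∫⁻ z in ball x r, ‖k (z - y) (G y)‖ₑ)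
          ≤ ∫⁻ y in Ω, volume (ball x r) * (ENNReal.ofReal C * (powKer a (x - y) * ‖G y‖ₑ)) := by
            refine lintegral_mono_ae ?_
            filter_upwards [hne] with y hy
            exact hin r hr y hy
        _ = volume (ball x r) * (ENNReal.ofReal C * rieszPot a (absOn Ω G) x) := by
            rw [lintegral_const_mul' _ _ measure_ball_lt_top.ne,
              lintegral_const_mul' _ _ ENNReal.ofReal_ne_top, rieszPot_absOn hΩm]
        _ < ⊤ := ENNReal.mul_lt_top measure_ball_lt_top
            (ENNReal.mul_lt_top ENNReal.ofReal_lt_top hx.lt_top)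
    rw [integral_integral_swap hI, ← integral_smul]
    refine integral_congr_ae (Eventually.of_forall fun y => ?_)
    simp only [setAverage_eq]
  have hb : Integrable (fun y => C * (‖x - y‖ ^ (-a) * ‖G y‖)) (volume.restrict Ω) := by
    refine Integrable.const_mul ⟨?_, ?_⟩ C
    · have : Measurable fun y => ‖x - y‖ ^ (-a) * ‖G y‖ :=
        (((measurable_const.sub measurable_id).norm.pow_const (-a))).mul hGm.norm
      exact this.aestronglyMeasurable
    · unfold HasFiniteIntegral
      refine lt_of_le_of_lt (lintegral_mono fun y => ?_) (rieszPot_absOn hΩm (G := G) x ▸ hx.lt_top)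
      rw [Real.enorm_eq_ofReal (by positivity), ENNReal.ofReal_mul (by positivity), ofReal_norm]
      rfl
  have hlim : Tendsto (fun r => ∫ y in Ω, ⨍ z in ball x r, k (z - y) (G y)) (𝓝[>] 0)
      (𝓝 (∫ y in Ω, k (x - y) (G y))) := by
    refine tendsto_integral_filter_of_dominated_convergence
      (fun y => C * (‖x - y‖ ^ (-a) * ‖G y‖)) ?_ ?_ hb ?_
    · filter_upwards with r
      have : StronglyMeasurable fun y => ∫ z in ball x r, k (z - y) (G y) :=
        hjm.stronglyMeasurable.integral_prod_left'
      simp only [setAverage_eq]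
      exact (this.const_mul _).aestronglyMeasurable
    · filter_upwards [self_mem_nhdsWithin] with r hr
      filter_upwards [hne] with y hy
      have hr' : 0 < r := hr
      have hB0 : volume (ball x r) ≠ 0 := (measure_ball_pos _ x hr').ne'
      have hBt : volume (ball x r) ≠ ⊤ := measure_ball_lt_top.ne
      rw [← ENNReal.ofReal_le_ofReal_iff (by positivity), ofReal_norm]
      refine enorm_setAverage_le.trans ?_
      refine (mul_le_mul_right (hin r hr' y hy) _).trans ?_
      rw [← mul_assoc, ENNReal.inv_mul_cancel hB0 hBt, one_mul, ENNReal.ofReal_mul hC,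
        ENNReal.ofReal_mul (by positivity), ofReal_norm]
      rfl
    · filter_upwards [hne] with y hy
      refine tendsto_average_of_continuousAt (f := fun z => k (z - y) (G y))
        (r₀ := ‖x - y‖) (norm_pos_iff.2 (sub_ne_zero.2 hy)) fun z hz => ?_
      have hzy : z - y ≠ 0 := by
        intro h
        rw [sub_eq_zero] at h
        rw [h, mem_ball, dist_eq_norm, norm_sub_rev] at hz
        exact lt_irrefl _ hz
      exact ContinuousAt.comp (g := fun z => k z (G y)) (f := fun z => z - y)
        (hk.cont (G y) _ hzy) (by fun_prop)
  refine hlim.congr' ?_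
  filter_upwards [self_mem_nhdsWithin] with r hr
  exact (hswap r hr).symm

theorem tendsto_ballAverage_of_ae_eq {n : ℕ} {Ω : Set (E n)} (hΩ : IsOpen Ω) {u v : E n → ℝ}
    (huv : u =ᵐ[volume.restrict Ω] v) {x : E n} (hx : x ∈ Ω) {l : ℝ}
    (hv : Tendsto (ballAverage v x) (𝓝[>] 0) (𝓝 l)) :
    Tendsto (ballAverage u x) (𝓝[>] 0) (𝓝 l) := by
  obtain ⟨r₀, hr₀, hr⟩ := Metric.isOpen_iff.1 hΩ x hx
  refine hv.congr' ?_
  filter_upwards [Ioo_mem_nhdsGT hr₀] with r hr'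
  unfold ballAverage
  rw [setAverage_eq, setAverage_eq]
  congr 1
  refine integral_congr_ae ?_
  filter_upwards [ae_restrict_of_ae_restrict_of_subset
    ((ball_subset_ball hr'.2.le).trans hr) huv] with y hy using hy.symm

/-- The exponential inequality for functions that are limits of potentials `κ ∫ k(x-y) g(y) dy`. -/
theorem exists_expIntegral_le {n : ℕ} (hn : 0 < n) {p q : ℝ} (hpq : q.HolderConjugate p)
    {F : Type*} [NormedAddCommGroup F] [MeasurableSpace F] [BorelSpace F]
    [SecondCountableTopology F]
    {k : E n → F → ℝ} (hk : IsRieszKernel (n / q) k) {κ : ℝ} (hκ : 0 < κ)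
    {Ω : Set (E n)} (hΩ : IsOpen Ω) (hΩb : Bornology.IsBounded Ω)
    {ν : Measure (E n)} {lam : ℝ} (hlam : 0 < lam)
    (hν : ∃ C r₀ : ℝ, 0 < r₀ ∧ ∀ (x : E n) (r : ℝ), 0 < r → r ≤ r₀ →
      ν (ball x r ∩ Ω) ≤ ENNReal.ofReal (C * r ^ lam)) :
    ∃ C' : ℝ, ∀ (u : E n → ℝ) (G : E n → F), MemLp u (ENNReal.ofReal p) volume →
      MemLp G (ENNReal.ofReal p) (volume.restrict Ω) →
      (∀ ε : ℝ≥0∞, 0 < ε → ∃ (φ : E n → ℝ) (g : E n → F), Measurable g ∧ Continuous φ ∧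
        (∀ x, φ x = κ * kerPot k Ω g x) ∧
        eLpNorm (u - φ) (ENNReal.ofReal p) (volume.restrict Ω) ≤ ε ∧
        eLpNorm (G - g) (ENNReal.ofReal p) (volume.restrict Ω) ≤ ε) →
      (∀ᵐ x ∂ν.restrict Ω, Tendsto (ballAverage u x) (𝓝[>] 0) (𝓝 (preciseRep u x))) ∧
      expIntegral Ω ν (lam * κ ^ (-q) / sphereArea n) q u (lpNormOn Ω (ENNReal.ofReal p) G) ≤
        ENNReal.ofReal C' := by
  have hΩm := hΩ.measurableSet
  have hq : 0 < q := hpq.pos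
  have hq1 : 1 < q := hpq.lt
  have hp1 : 1 ≤ p := hpq.symm.lt.le
  have hn0 : (0 : ℝ) < n := by exact_mod_cast hn
  obtain ⟨hfinite, C, hC, hgr⟩ := exists_growth_all hΩb hlam hν
  obtain ⟨C₁, h₁⟩ := exp_rieszPot_le hn hpq hC hlam hgr hΩm hΩb
  rw [Measure.restrict_restrict hΩm, inter_self] at h₁
  refine ⟨max C₁ (ν Ω).toReal, fun u G₀ hu hG₀ happ => ?_⟩
  set G : E n → F := hG₀.1.mk G₀ with hGdef
  have hGm : Measurable G := hG₀.1.stronglyMeasurable_mk.measurable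
  have hGe : G₀ =ᵐ[volume.restrict Ω] G := hG₀.1.ae_eq_mk
  have hnorm : eLpNorm G₀ (ENNReal.ofReal p) (volume.restrict Ω) =
    eLpNorm G (ENNReal.ofReal p) (volume.restrict Ω) := eLpNorm_congr_ae hGe
  have hGt : eLpNorm G (ENNReal.ofReal p) (volume.restrict Ω) ≠ ⊤ := hnorm ▸ hG₀.2.ne
  have hrep : u =ᵐ[volume.restrict Ω] fun x => κ * kerPot k Ω G x := by
    refine ae_eq_kerPot hn hpq hk hΩm hΩb hu.1.restrict hGm hGt fun ε hε => ?_
    obtain ⟨φ, g, h1, h2, h3, h4, h5⟩ := happ ε hε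
    refine ⟨φ, g, h1, h2, h3, h4, ?_⟩
    rwa [eLpNorm_congr_ae (hGe.sub (ae_eq_refl g))] at h5
  have hfin : ∀ᵐ x ∂ν.restrict Ω, rieszPot (n / q) (absOn Ω G) x ≠ ⊤ := by
    have := rieszPot_absOn_ae_ne_top hn hpq hC hlam hgr hΩm hΩb hGm hGt
    rwa [Measure.restrict_restrict hΩm, inter_self] at this
  have hlim : ∀ᵐ x ∂ν.restrict Ω,
      Tendsto (ballAverage u x) (𝓝[>] 0) (𝓝 (κ * kerPot k Ω G x)) := by
    filter_upwards [hfin, ae_restrict_mem hΩm] with x hx hxΩ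
    refine tendsto_ballAverage_of_ae_eq hΩ hrep hxΩ ?_
    have := (tendsto_ballAverage_kerPot hn (a := n / q) (by positivity)
      (div_lt_self hn0 hq1) hk hΩm hGm hx).const_mul κ
    refine this.congr fun r => ?_
    unfold ballAverage
    rw [setAverage_eq, setAverage_eq, integral_const_mul, smul_eq_mul, smul_eq_mul]
    ring
  refine ⟨by filter_upwards [hlim] with x hx using by rwa [preciseRep, hx.limUnder_eq], ?_⟩
  have hω := sphereArea_pos hn
  set N := lpNormOn Ω (ENNReal.ofReal p) G₀ with hN
  have hNe : ENNReal.ofReal N = eLpNorm G (ENNReal.ofReal p) (volume.restrict Ω) := by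
    rw [hN, lpNormOn, hnorm, ENNReal.ofReal_toReal hGt]
  have hN0 : 0 ≤ N := ENNReal.toReal_nonneg
  unfold expIntegral
  rcases hN0.eq_or_lt with h0 | hNpos
  · rw [← h0]
    simp only [div_zero, Real.zero_rpow hq.ne', mul_zero, Real.exp_zero, ENNReal.ofReal_one]
    rw [lintegral_one]
    have : ν.restrict Ω univ ≠ ⊤ := measure_ne_top _ _
    rw [Measure.restrict_apply_univ] at this ⊢
    rw [ENNReal.le_ofReal_iff_toReal_le this (le_trans ENNReal.toReal_nonneg (le_max_right _ _))]
    exact le_max_right _ _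
  · set h : E n → ℝ≥0∞ := fun y => (ENNReal.ofReal N)⁻¹ * absOn Ω G y with hh
    have hNp : ENNReal.ofReal N ≠ 0 := (ENNReal.ofReal_pos.2 hNpos).ne'
    have hm := measurable_absOn hΩm hGm
    have hp0 : 0 < p := by linarith
    have hint : ∫⁻ y, h y ^ p ≤ 1 := by
      have e1 : ∫⁻ y, absOn Ω G y ^ p = ENNReal.ofReal N ^ p := by
        have := lintegral_absOn_rpow (G := G) hp1 hΩm
        rw [← hNe] at this
        rw [← this, ← ENNReal.rpow_mul, one_div, inv_mul_cancel₀ hp0.ne', ENNReal.rpow_one]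
      simp only [hh, ENNReal.mul_rpow_of_nonneg _ _ hp0.le]
      rw [lintegral_const_mul _ (hm.pow_const p), e1, ← ENNReal.mul_rpow_of_nonneg _ _ hp0.le,
        ENNReal.inv_mul_cancel hNp ENNReal.ofReal_ne_top, ENNReal.one_rpow]
    have hR : ∀ x, rieszPot (n / q) h x =
        (ENNReal.ofReal N)⁻¹ * rieszPot (n / q) (absOn Ω G) x := by
      intro x
      unfold rieszPot
      rw [← lintegral_const_mul' _ _ (ENNReal.inv_ne_top.2 hNp)]
      refine lintegral_congr fun y => ?_
      simp only [hh]
      ring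
    refine le_trans (le_trans ?_ (h₁ h (hm.const_mul _) (fun y hy => ?_) hint))
      (ENNReal.ofReal_le_ofReal (le_max_left _ _))
    · refine lintegral_mono_ae ?_
      filter_upwards [hlim, hfin] with x hx hxf
      refine ENNReal.ofReal_le_ofReal (Real.exp_le_exp.2 ?_)
      rw [preciseRep, hx.limUnder_eq]
      have hle : |κ * kerPot k Ω G x| / N ≤ κ * (rieszPot (n / q) h x).toReal := by
        rw [hR, ENNReal.toReal_mul, ENNReal.toReal_inv, ENNReal.toReal_ofReal hN0, abs_mul,
          abs_of_pos hκ]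
        have : |kerPot k Ω G x| ≤ (rieszPot (n / q) (absOn Ω G) x).toReal := by
          rw [← Real.norm_eq_abs, ← toReal_enorm]
          exact ENNReal.toReal_mono hxf (hk.enorm_kerPot_le hΩm x)
        calc κ * |kerPot k Ω G x| / N = κ * (N⁻¹ * |kerPot k Ω G x|) := by ring
          _ ≤ _ := by gcongr
      calc lam * κ ^ (-q) / sphereArea n * (|κ * kerPot k Ω G x| / N) ^ q
          ≤ lam * κ ^ (-q) / sphereArea n * (κ * (rieszPot (n / q) h x).toReal) ^ q := by
            gcongr
        _ = lam / sphereArea n * (rieszPot (n / q) h x).toReal ^ q := by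
            rw [Real.mul_rpow hκ.le ENNReal.toReal_nonneg, Real.rpow_neg hκ.le]
            have : κ ^ q ≠ 0 := (Real.rpow_pos_of_pos hκ q).ne'
            field_simp
    · simp only [hh]
      rw [absOn, indicator_of_notMem hy, mul_zero]

/-- The kernel of the Riesz potential. -/
theorem isRieszKernel_scalar {n : ℕ} (a : ℝ) :
    IsRieszKernel a fun (z : E n) (v : ℝ) => ‖z‖ ^ (-a) * v where
  measurable := by fun_prop
  sub z v w := by ring
  bound z v := by
    rw [abs_mul, abs_of_nonneg (by positivity), Real.norm_eq_abs]
  cont v z hz := by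
    refine ContinuousAt.mul ?_ continuousAt_const
    exact (continuousAt_id.norm).rpow_const (Or.inl (norm_ne_zero_iff.2 hz))

/-- The kernel of the vector-valued Riesz potential. -/
theorem isRieszKernel_vector {n : ℕ} (a : ℝ) :
    IsRieszKernel a fun (z : E n) (v : E n) => ‖z‖ ^ (-(a + 1)) * inner ℝ z v where
  measurable := by fun_prop
  sub z v w := by rw [inner_sub_right, mul_sub]
  bound z v := by
    rw [abs_mul, abs_of_nonneg (by positivity)]
    rcases eq_or_ne z 0 with rfl | hz
    · rw [inner_zero_left, abs_zero, mul_zero]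
      positivity
    · have hz' : 0 < ‖z‖ := norm_pos_iff.2 hz
      calc ‖z‖ ^ (-(a + 1)) * |inner ℝ z v| ≤ ‖z‖ ^ (-(a + 1)) * (‖z‖ * ‖v‖) := by
            gcongr
            exact abs_real_inner_le_norm z v
        _ = ‖z‖ ^ (-a) * ‖v‖ := by
            rw [← mul_assoc, ← Real.rpow_add_one hz'.ne']
            ring_nf
  cont v z hz := by
    refine ContinuousAt.mul ?_ (by fun_prop)
    exact (continuousAt_id.norm).rpow_const (Or.inl (norm_ne_zero_iff.2 hz))

theorem integrable_coord_norm_rpow_mul {n : ℕ} {c : ℝ} (hc : 0 < c) (hcn : c < n) {g : E n → ℝ}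
    (hg : Continuous g) (hgc : HasCompactSupport g) (x₀ : E n) (i : Fin n) :
    Integrable fun y => ((y i - x₀ i) * ‖y - x₀‖ ^ (-(c + 1))) * g y := by
  refine (integrable_norm_rpow_mul hc hcn hg hgc x₀).mono ?_ (Eventually.of_forall fun y => ?_)
  · have : Measurable fun y : E n => ((y i - x₀ i) * ‖y - x₀‖ ^ (-(c + 1))) * g y := by
      have := hg.measurable
      fun_prop
    exact this.aestronglyMeasurable
  · rw [norm_mul, norm_mul, norm_mul]
    gcongr
    have h1 : ∀ e : ℝ, ‖‖y - x₀‖ ^ e‖ = ‖y - x₀‖ ^ e := fun e =>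
      Real.norm_of_nonneg (by positivity)
    rw [h1, h1]
    rcases eq_or_ne y x₀ with rfl | hy
    · rw [sub_self (y i), norm_zero, zero_mul]
      positivity
    · have hz' : 0 < ‖y - x₀‖ := norm_pos_iff.2 (sub_ne_zero.2 hy)
      calc ‖y i - x₀ i‖ * ‖y - x₀‖ ^ (-(c + 1)) ≤ ‖y - x₀‖ * ‖y - x₀‖ ^ (-(c + 1)) := by
            gcongr
            exact PiLp.norm_apply_le (y - x₀) i
        _ = ‖y - x₀‖ ^ (-c) := by
            rw [mul_comm, ← Real.rpow_add_one hz'.ne']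
            ring_nf

theorem IsTestFunction.eq_kerPot_even {n k : ℕ} (hk : 0 < k) (hkn : 2 * k < n) {a : ℝ}
    (ha : a = n - 2 * k) {Ω : Set (E n)} {φ : E n → ℝ} (hφ : IsTestFunction Ω φ) (x : E n) :
    φ x = rieszConst n (2 * k) * kerPot (fun z v => ‖z‖ ^ (-a) * v) Ω (_root_.cLap^[k] φ) x := by
  rw [eq_riesz_potential (hφ.mono (subset_univ _)) x hk hkn, ha]
  unfold kerPot
  congr 1
  rw [setIntegral_eq_integral_of_forall_compl_eq_zero]
  · simp only [norm_sub_rev x]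
  · intro y hy
    have := image_eq_zero_of_notMem_tsupport fun h => hy ((hφ.iterate_cLap k).2.2 h)
    simp only [this, mul_zero]

theorem IsTestFunction.continuous_cGrad {n : ℕ} {Ω : Set (E n)} {φ : E n → ℝ}
    (hφ : IsTestFunction Ω φ) : Continuous (cGrad φ) :=
  (PiLp.continuous_toLp 2 _).comp (continuous_pi fun i => (hφ.pd i).continuous)

theorem IsTestFunction.cGrad_eq_zero {n : ℕ} {Ω : Set (E n)} {φ : E n → ℝ}
    (hφ : IsTestFunction Ω φ) {y : E n} (hy : y ∉ Ω) : cGrad φ y = 0 := by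
  ext i
  exact image_eq_zero_of_notMem_tsupport (f := _root_.pd i φ) fun h => hy ((hφ.pd i).2.2 h)

theorem IsTestFunction.eq_kerPot_odd {n k : ℕ} (hkn : 2 * k + 1 < n) {a : ℝ}
    (ha : a = n - (2 * k + 1)) {Ω : Set (E n)} {φ : E n → ℝ} (hφ : IsTestFunction Ω φ) (x : E n) :
    φ x = gradRieszConst n (2 * k + 1) *
      kerPot (fun z v => ‖z‖ ^ (-(a + 1)) * inner ℝ z v) Ω (cGrad (_root_.cLap^[k] φ)) x := by
  have hT := hφ.iterate_cLap k
  rw [eq_grad_riesz_potential (hφ.mono (subset_univ _)) x hkn, ha, ← mul_neg]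
  unfold kerPot
  congr 1
  rw [setIntegral_eq_integral_of_forall_compl_eq_zero]
  · have hkn' : (2 : ℝ) * k + 1 < n := by exact_mod_cast hkn
    have hk0 : (0 : ℝ) ≤ k := Nat.cast_nonneg k
    have e : (n : ℝ) - 2 * k = (n - (2 * k + 1)) + 1 := by ring
    rw [← integral_finsetSum, ← integral_neg]
    · refine integral_congr_ae (Eventually.of_forall fun y => ?_)
      simp only [e, norm_sub_rev x, PiLp.inner_apply, Finset.mul_sum, ← Finset.sum_neg_distrib]
      refine Finset.sum_congr rfl fun i _ => ?_
      simp only [cGrad, PiLp.sub_apply, RCLike.inner_apply, conj_trivial]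
      ring
    · intro i _
      rw [e]
      exact integrable_coord_norm_rpow_mul (by linarith) (by linarith)
        (hT.pd i).continuous (hT.pd i).2.1 x i
  · intro y hy
    simp only [hT.cGrad_eq_zero hy, inner_zero_right, mul_zero]

theorem MemSobolevZero.exists_potential_even {n k : ℕ} (hk : 0 < k) (hkn : 2 * k < n)
    {p a : ℝ} (hp : 1 ≤ p) (ha : a = n - 2 * k) {Ω : Set (E n)} {u : E n → ℝ}
    (hu : MemSobolevZero Ω (2 * k) (ENNReal.ofReal p) u) {ε : ℝ≥0∞} (hε : 0 < ε) :
    ∃ (φ g : E n → ℝ), Measurable g ∧ Continuous φ ∧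
        (∀ x, φ x = rieszConst n (2 * k) * kerPot (fun z v => ‖z‖ ^ (-a) * v) Ω g x) ∧
        eLpNorm (u - φ) (ENNReal.ofReal p) (volume.restrict Ω) ≤ ε ∧
        eLpNorm (posLaplacian^[k] u - g) (ENNReal.ofReal p) (volume.restrict Ω) ≤ ε := by
  obtain ⟨φ, hφ, h1, h2⟩ := hu.exists_approx_even (by simpa using hp) hε
  exact ⟨φ, cLap^[k] φ, (hφ.iterate_cLap k).continuous.measurable, hφ.continuous,
    hφ.eq_kerPot_even hk hkn ha,
    (eLpNorm_mono_measure _ Measure.restrict_le_self).trans h1,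
    (eLpNorm_mono_measure _ Measure.restrict_le_self).trans h2⟩

theorem MemSobolevZero.exists_potential_odd {n k : ℕ} (hkn : 2 * k + 1 < n)
    {p a : ℝ} (hp : 1 ≤ p) (ha : a = n - (2 * k + 1)) {Ω : Set (E n)} {u : E n → ℝ}
    (hu : MemSobolevZero Ω (2 * k + 1) (ENNReal.ofReal p) u) {ε : ℝ≥0∞} (hε : 0 < ε) :
    ∃ (φ : E n → ℝ) (g : E n → E n), Measurable g ∧ Continuous φ ∧
        (∀ x, φ x = gradRieszConst n (2 * k + 1) *
          kerPot (fun z v => ‖z‖ ^ (-(a + 1)) * inner ℝ z v) Ω g x) ∧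
        eLpNorm (u - φ) (ENNReal.ofReal p) (volume.restrict Ω) ≤ ε ∧
        eLpNorm (weakGradient (posLaplacian^[k] u) - g) (ENNReal.ofReal p)
          (volume.restrict Ω) ≤ ε := by
  obtain ⟨φ, hφ, h1, h2⟩ := hu.exists_approx_odd (by simpa using hp) hε
  exact ⟨φ, cGrad (cLap^[k] φ), (hφ.iterate_cLap k).continuous_cGrad.measurable, hφ.continuous,
    hφ.eq_kerPot_odd hkn ha,
    (eLpNorm_mono_measure _ Measure.restrict_le_self).trans h1,
    (eLpNorm_mono_measure _ Measure.restrict_le_self).trans h2⟩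

/-- Functions of `(δ, s)`, smooth for `s > 0`, which are `s^{-m} Q(δ/s)` for `s < s₀` and
vanish for `s > s₁`. -/
structure IsProfile (s₀ s₁ : ℝ) (m : ℤ) (Q : Polynomial ℝ) (F : ℝ → ℝ → ℝ) : Prop where
  smooth : ContDiffOn ℝ ∞ (Function.uncurry F) (univ ×ˢ Ioi 0)
  near : ∀ δ, ∀ s ∈ Ioo 0 s₀, F δ s = s ^ (-m) * Q.eval (δ / s)
  far : ∀ δ s, s₁ < s → F δ s = 0

theorem IsProfile.contDiffOn {s₀ s₁ : ℝ} {m : ℤ} {Q : Polynomial ℝ} {F : ℝ → ℝ → ℝ}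
    (hF : IsProfile s₀ s₁ m Q F) (δ : ℝ) : ContDiffOn ℝ ∞ (F δ) (Ioi 0) :=
  hF.smooth.comp (contDiffOn_const.prodMk contDiffOn_id) fun _ hs => ⟨mem_univ δ, hs⟩

theorem IsProfile.deriv {s₀ s₁ : ℝ} {m : ℤ} {Q : Polynomial ℝ} {F : ℝ → ℝ → ℝ}
    (hF : IsProfile s₀ s₁ m Q F) :
    IsProfile s₀ s₁ (m + 1) (-(Polynomial.C (m : ℝ) * Q + Polynomial.X * Q.derivative))
      fun δ => deriv (F δ) where
  smooth := by
    have ho : IsOpen ((univ : Set ℝ) ×ˢ Ioi (0 : ℝ)) := isOpen_univ.prod isOpen_Ioi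
    have h1 : ContDiffOn ℝ ∞ (fun z => fderiv ℝ (Function.uncurry F) z (0, 1))
        (univ ×ˢ Ioi 0) :=
      (hF.smooth.fderiv_of_isOpen ho (m := ∞) le_rfl).clm_apply contDiffOn_const
    refine h1.congr fun z hz => ?_
    have hd : DifferentiableAt ℝ (Function.uncurry F) z :=
      (hF.smooth.differentiableOn (by simp)).differentiableAt (ho.mem_nhds hz)
    have h2 : HasDerivAt (fun s : ℝ => (z.1, s)) ((0 : ℝ), (1 : ℝ)) z.2 :=
      (hasDerivAt_const z.2 z.1).prodMk (hasDerivAt_id z.2)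
    exact (hd.hasFDerivAt.comp_hasDerivAt z.2 h2).deriv
  near δ s hs := by
    have h1 : F δ =ᶠ[𝓝 s] fun s => s ^ (-m) * Q.eval (δ / s) := by
      filter_upwards [Ioo_mem_nhds hs.1 hs.2] with t ht using hF.near δ t ht
    rw [h1.deriv_eq]
    have hs0 : s ≠ 0 := hs.1.ne'
    have h2 : HasDerivAt (fun s : ℝ => δ / s) (-δ / s ^ 2) s := by
      have h : HasDerivAt (fun s : ℝ => δ / s) _ s :=
        (hasDerivAt_const s δ).fun_div (hasDerivAt_id' s) hs0
      simpa using h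
    have h3 := (hasDerivAt_zpow (-m) s (Or.inl hs0)).mul ((Q.hasDerivAt (δ / s)).comp s h2)
    have h4 : _root_.deriv (fun s => s ^ (-m) * Q.eval (δ / s)) s = _ := h3.deriv
    rw [h4]
    simp only [Function.comp, Polynomial.eval_neg, Polynomial.eval_add, Polynomial.eval_mul,
      Polynomial.eval_C, Polynomial.eval_X, neg_add, zpow_add₀ hs0, zpow_sub₀ hs0, zpow_one,
      zpow_neg_one]
    push_cast
    field_simp
  far δ s hs := by
    have h1 : F δ =ᶠ[𝓝 s] fun _ => 0 := by
      filter_upwards [Ioi_mem_nhds hs] with t ht using hF.far δ t ht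
    rw [h1.deriv_eq, deriv_const]

theorem IsProfile.add {s₀ s₁ : ℝ} {m : ℤ} {P Q : Polynomial ℝ} {F G : ℝ → ℝ → ℝ}
    (hF : IsProfile s₀ s₁ m P F) (hG : IsProfile s₀ s₁ m Q G) :
    IsProfile s₀ s₁ m (P + Q) fun δ s => F δ s + G δ s where
  smooth := hF.smooth.add hG.smooth
  near δ s hs := by rw [hF.near δ s hs, hG.near δ s hs, Polynomial.eval_add, mul_add]
  far δ s hs := by rw [hF.far δ s hs, hG.far δ s hs, add_zero]

theorem IsProfile.const_mul {s₀ s₁ : ℝ} {m : ℤ} {P : Polynomial ℝ} {F : ℝ → ℝ → ℝ}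
    (hF : IsProfile s₀ s₁ m P F) (c : ℝ) :
    IsProfile s₀ s₁ m (Polynomial.C c * P) fun δ s => c * F δ s where
  smooth := contDiffOn_const.mul hF.smooth
  near δ s hs := by
    rw [hF.near δ s hs, Polynomial.eval_mul, Polynomial.eval_C]
    ring
  far δ s hs := by rw [hF.far δ s hs, mul_zero]

theorem IsProfile.sub_mul {s₀ s₁ : ℝ} {m : ℤ} {P : Polynomial ℝ} {F : ℝ → ℝ → ℝ}
    (hF : IsProfile s₀ s₁ (m + 1) P F) :
    IsProfile s₀ s₁ m ((1 - Polynomial.X) * P) fun δ s => (s - δ) * F δ s where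
  smooth := (contDiff_snd.sub contDiff_fst).contDiffOn.mul hF.smooth
  near δ s hs := by
    have hs0 : s ≠ 0 := hs.1.ne'
    rw [hF.near δ s hs, Polynomial.eval_mul, Polynomial.eval_sub, Polynomial.eval_one,
      Polynomial.eval_X, neg_add, zpow_add₀ hs0, zpow_neg_one]
    field_simp
  far δ s hs := by rw [hF.far δ s hs, mul_zero]

/-- The positive Laplacian of `F(δ, |x|² + δ)` in terms of `s = |x|² + δ`. -/
def radLap (n : ℕ) (F : ℝ → ℝ → ℝ) (δ s : ℝ) : ℝ :=
  -(2 * n) * deriv (F δ) s + -4 * ((s - δ) * deriv (deriv (F δ)) s)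

theorem cLap_eq_radLap {n : ℕ} (x₀ : E n) {δ : ℝ} (hδ : 0 < δ) {F : ℝ → ℝ → ℝ}
    (hF : ContDiffOn ℝ ∞ (F δ) (Ioi 0)) :
    cLap (fun x => F δ (‖x - x₀‖ ^ 2 + δ)) = fun x => radLap n F δ (‖x - x₀‖ ^ 2 + δ) := by
  ext x
  rw [cLap_radial x₀ hδ hF, radLap]
  ring

theorem IsProfile.radLap_of_deriv {s₀ s₁ : ℝ} {m : ℤ} {P : Polynomial ℝ} {F : ℝ → ℝ → ℝ} (n : ℕ)
    (hF : IsProfile s₀ s₁ m P fun δ => _root_.deriv (F δ)) :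
    ∃ Q, IsProfile s₀ s₁ m Q (radLap n F) ∧ Q.eval 0 = (4 * m - 2 * n) * P.eval 0 := by
  refine ⟨_, (hF.const_mul (-(2 * n))).add (hF.deriv.sub_mul.const_mul (-4)), ?_⟩
  simp
  ring

theorem IsProfile.radLap {s₀ s₁ : ℝ} {m : ℤ} {P : Polynomial ℝ} {F : ℝ → ℝ → ℝ} (n : ℕ)
    (hF : IsProfile s₀ s₁ m P F) :
    ∃ Q, IsProfile s₀ s₁ (m + 1) Q (radLap n F) ∧
      Q.eval 0 = 2 * m * (n - 2 * m - 2) * P.eval 0 := by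
  obtain ⟨Q, hQ, h0⟩ := hF.deriv.radLap_of_deriv n
  refine ⟨Q, hQ, ?_⟩
  rw [h0]
  simp
  ring

theorem IsProfile.exists_bound {s₀ s₁ : ℝ} {m : ℤ} {P : Polynomial ℝ} {F : ℝ → ℝ → ℝ}
    (hs₀ : 0 < s₀) (hF : IsProfile s₀ s₁ m P F) :
    ∃ C M : ℝ, 0 ≤ C ∧ 0 ≤ M ∧ ∀ δ s : ℝ, 0 < δ → δ ≤ 1 → δ ≤ s →
      (s < s₀ → |F δ s| ≤ s ^ (-m) * (|P.eval 0| + C * (δ / s))) ∧ (s₀ ≤ s → |F δ s| ≤ M) := by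
  obtain ⟨C, hC⟩ := (isCompact_Icc (a := (0 : ℝ)) (b := 1)).exists_bound_of_continuousOn
    P.divX.continuous.continuousOn
  obtain ⟨M, hM⟩ := ((isCompact_Icc (a := (0 : ℝ)) (b := 1)).prod
    (isCompact_Icc (a := s₀) (b := s₁))).exists_bound_of_continuousOn
    (hF.smooth.continuousOn.mono fun z hz => ⟨mem_univ _, hs₀.trans_le hz.2.1⟩)
  refine ⟨max C 0, max M 0, le_max_right _ _, le_max_right _ _, fun δ s hδ hδ1 hδs =>
    ⟨fun hs => ?_, fun hs => ?_⟩⟩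
  · have hs0 : 0 < s := hδ.trans_le hδs
    have ht : δ / s ∈ Icc (0 : ℝ) 1 := ⟨by positivity, (div_le_one hs0).2 hδs⟩
    rw [hF.near δ s ⟨hs0, hs⟩, abs_mul, abs_of_pos (zpow_pos hs0 _)]
    gcongr
    conv_lhs => rw [← Polynomial.divX_mul_X_add P]
    rw [Polynomial.eval_add, Polynomial.eval_mul, Polynomial.eval_X, Polynomial.eval_C,
      Polynomial.coeff_zero_eq_eval_zero]
    refine (abs_add_le _ _).trans ?_
    rw [add_comm, abs_mul, abs_of_nonneg ht.1]
    gcongr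
    · exact (hC _ ht).trans (le_max_left _ _)
  · rcases le_or_gt s s₁ with h | h
    · exact (hM (δ, s) ⟨⟨hδ.le, hδ1⟩, hs, h⟩).trans (le_max_left _ _)
    · rw [hF.far δ s h, abs_zero]
      exact le_max_right _ _

/-- The logarithm `-(1/2) log s`, cut off smoothly between `s₀` and `s₁`. -/
def cutLog (s₀ s₁ : ℝ) (s : ℝ) : ℝ :=
  -(1 / 2) * Real.log s * Real.smoothTransition ((s₁ - s) / (s₁ - s₀))

theorem cutLog_of_le {s₀ s₁ s : ℝ} (h : s₀ < s₁) (hs : s ≤ s₀) :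
    cutLog s₀ s₁ s = -(1 / 2) * Real.log s := by
  rw [cutLog, Real.smoothTransition.one_of_one_le, mul_one]
  rw [one_le_div (by linarith)]
  linarith

theorem cutLog_of_ge {s₀ s₁ s : ℝ} (h : s₀ < s₁) (hs : s₁ ≤ s) : cutLog s₀ s₁ s = 0 := by
  rw [cutLog, Real.smoothTransition.zero_of_nonpos, mul_zero]
  exact div_nonpos_of_nonpos_of_nonneg (by linarith) (by linarith)

theorem contDiffOn_cutLog {s₀ s₁ : ℝ} : ContDiffOn ℝ ∞ (cutLog s₀ s₁) (Ioi 0) := by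
  unfold cutLog
  refine (contDiffOn_const.mul ?_).mul ?_
  · exact fun s hs => (Real.contDiffAt_log.2 (ne_of_gt hs)).contDiffWithinAt
  · refine ContDiff.contDiffOn ?_
    exact Real.smoothTransition.contDiff.comp ((contDiff_const.sub contDiff_id).div_const _)

theorem isProfile_deriv_cutLog {s₀ s₁ : ℝ} (h : s₀ < s₁) :
    IsProfile s₀ s₁ 1 (Polynomial.C (-(1 / 2))) fun _ => deriv (cutLog s₀ s₁) where
  smooth := contDiffOn_cutLog.deriv_Ioi.comp contDiffOn_snd fun z hz => hz.2
  near δ s hs := by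
    have h1 : cutLog s₀ s₁ =ᶠ[𝓝 s] fun s => -(1 / 2) * Real.log s := by
      filter_upwards [Iio_mem_nhds hs.2] with t ht using cutLog_of_le h (le_of_lt ht)
    rw [h1.deriv_eq, deriv_const_mul_field, Real.deriv_log, Polynomial.eval_C, zpow_neg_one]
    ring
  far δ s hs := by
    have h1 : cutLog s₀ s₁ =ᶠ[𝓝 s] fun _ => 0 := by
      filter_upwards [Ioi_mem_nhds hs] with t ht using cutLog_of_ge h (le_of_lt ht)
    rw [h1.deriv_eq, deriv_const]

theorem exists_isProfile_iterate {n : ℕ} {s₀ s₁ : ℝ} (h : s₀ < s₁) (k : ℕ)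
    (hkn : 2 * (k + 1) < n) :
    ∃ Q, IsProfile s₀ s₁ (k + 1) Q ((radLap n)^[k + 1] fun _ => cutLog s₀ s₁) ∧
      rieszConst n (2 * (k + 1 : ℕ)) * Q.eval 0 * sphereArea n = 1 := by
  induction k with
  | zero =>
    obtain ⟨Q, hQ, h0⟩ := (isProfile_deriv_cutLog h).radLap_of_deriv (F := fun _ => cutLog s₀ s₁) n
    refine ⟨Q, by simpa using hQ, ?_⟩
    have := rieszConst_two (n := n) (by omega)
    rw [h0]
    simp only [zero_add, Nat.cast_one, mul_one, Polynomial.eval_C, Int.cast_one]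
    linear_combination this
  | succ k ih =>
    obtain ⟨P, hP, hP0⟩ := ih (by omega)
    obtain ⟨Q, hQ, h0⟩ := hP.radLap n
    refine ⟨Q, ?_, ?_⟩
    · rw [Function.iterate_succ_apply']
      exact_mod_cast hQ
    · have := rieszConst_step (n := n) (k := k + 1) (by omega) (by omega)
      rw [h0]
      rw [this] at hP0
      push_cast at hP0 ⊢
      linear_combination hP0

theorem iterate_cLap_radial {n : ℕ} (x₀ : E n) {s₀ s₁ δ : ℝ} (h : s₀ < s₁) (hδ : 0 < δ) (k : ℕ)
    (hkn : 2 * k < n) :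
    cLap^[k] (fun x => cutLog s₀ s₁ (‖x - x₀‖ ^ 2 + δ)) =
      fun x => ((radLap n)^[k] fun _ => cutLog s₀ s₁) δ (‖x - x₀‖ ^ 2 + δ) := by
  induction k with
  | zero => rfl
  | succ k ih =>
    rw [Function.iterate_succ_apply', ih (by omega), Function.iterate_succ_apply']
    refine cLap_eq_radLap x₀ hδ ?_
    rcases Nat.eq_zero_or_pos k with rfl | hk
    · exact contDiffOn_cutLog
    · obtain ⟨j, rfl⟩ : ∃ j, k = j + 1 := ⟨k - 1, by omega⟩
      obtain ⟨Q, hQ, -⟩ := exists_isProfile_iterate (n := n) h j (by omega)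
      exact hQ.contDiffOn δ

/-- Energy of functions bounded by `s^{-d/2} (A + C δ/s)`, with `s = |x|² + δ`. -/
theorem exists_lintegral_radial_le {n : ℕ} (hn : 0 < n) {d p : ℝ} (hd : 0 < d) (hp : 0 < p)
    (hdp : d * p = n) {A C M s₀ s₁ A' : ℝ} (hA : 0 ≤ A) (hC : 0 ≤ C) (hM : 0 ≤ M)
    (hs₀ : 0 < s₀) (hs : s₀ < s₁) (hA' : A < A') (x₀ : E n) :
    ∃ K : ℝ, ∀ᶠ ε in 𝓝[>] (0 : ℝ), ∀ W : E n → ℝ, (∀ x, 0 ≤ W x) →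
      (∀ x, ‖x - x₀‖ ^ 2 + ε ^ 2 < s₀ →
        W x ≤ (‖x - x₀‖ ^ 2 + ε ^ 2) ^ (-(d / 2)) *
          (A + C * (ε ^ 2 / (‖x - x₀‖ ^ 2 + ε ^ 2)))) →
      (∀ x, W x ≤ M ∨ ‖x - x₀‖ ^ 2 + ε ^ 2 < s₀) →
      (∀ x, s₁ < ‖x - x₀‖ ^ 2 + ε ^ 2 → W x = 0) →
      ∫⁻ x, ENNReal.ofReal (W x) ^ p ≤
        ENNReal.ofReal (A' ^ p * sphereArea n * Real.log (1 / ε) + K) := by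
  have hn0 : (0 : ℝ) < n := by exact_mod_cast hn
  have hω := sphereArea_pos hn
  set η := A' - A with hη
  have hη0 : 0 < η := by linarith
  set R := Real.sqrt (C / η + 1) with hRdef
  have hR0 : 0 < R := Real.sqrt_pos.2 (by positivity)
  have hR2 : R ^ 2 = C / η + 1 := Real.sq_sqrt (by positivity)
  have hCR : C / R ^ 2 ≤ η := by
    rw [hR2, div_le_iff₀ (by positivity)]
    have : C / η * η = C := by field_simp
    nlinarith
  set ρ := Real.sqrt s₁ with hρdef
  have hs₁ : 0 < s₁ := hs₀.trans hs
  have hρ0 : 0 < ρ := Real.sqrt_pos.2 hs₁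
  have hρ2 : ρ ^ 2 = s₁ := Real.sq_sqrt hs₁.le
  have hA'0 : 0 < A' := by linarith
  set v := volume.real (ball (0 : E n) 1) with hv
  have hv0 : 0 < v := volume_real_ball_pos
  set V := volume.real (closedBall x₀ ρ) with hV
  refine ⟨(A + C) ^ p * (v * R ^ (n : ℝ)) + A' ^ p * sphereArea n * Real.log (ρ / R) +
    M ^ p * V, ?_⟩
  filter_upwards [Ioo_mem_nhdsGT (show 0 < ρ / R by positivity)] with ε hε W hW0 h1 h2 h3
  have hε0 : 0 < ε := hε.1
  have hRε : R * ε ≤ ρ := by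
    have := (lt_div_iff₀ hR0).1 hε.2
    linarith
  have hpt : ∀ x, ENNReal.ofReal (W x) ^ p ≤
      (ball x₀ (R * ε)).indicator (fun _ => ENNReal.ofReal ((A + C) ^ p * ε ^ (-(n : ℝ)))) x +
      ENNReal.ofReal (A' ^ p) * annulusKer n (R * ε) ρ (x - x₀) +
      (closedBall x₀ ρ).indicator (fun _ => ENNReal.ofReal (M ^ p)) x := by
    intro x
    set s := ‖x - x₀‖ ^ 2 + ε ^ 2 with hsdef
    have hs0 : 0 < s := by positivity
    rw [ENNReal.ofReal_rpow_of_nonneg (hW0 x) hp.le]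
    have hexp : ∀ t : ℝ, 0 < t → (t ^ (-(d / 2))) ^ p = t ^ (-((n : ℝ) / 2)) := by
      intro t ht
      rw [← Real.rpow_mul ht.le, ← hdp]
      congr 1
      ring
    have hsq : ∀ t : ℝ, 0 < t → (t ^ 2) ^ (-((n : ℝ) / 2)) = t ^ (-(n : ℝ)) := by
      intro t ht
      rw [← Real.rpow_natCast t 2, ← Real.rpow_mul ht.le]
      congr 1
      push_cast
      ring
    rcases lt_or_ge s s₀ with hss | hss
    · rcases lt_or_ge ‖x - x₀‖ (R * ε) with hx | hx
      · refine le_trans ?_ (le_trans (le_add_of_nonneg_right zero_le)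
          (le_add_of_nonneg_right zero_le))
        rw [indicator_of_mem (mem_ball_iff_norm.2 hx)]
        refine ENNReal.ofReal_le_ofReal ?_
        have e1 : W x ≤ (ε ^ 2) ^ (-(d / 2)) * (A + C) := by
          refine (h1 x hss).trans ?_
          have e2 : ε ^ 2 / s ≤ 1 := (div_le_one hs0).2 (by rw [hsdef]; nlinarith [sq_nonneg ‖x - x₀‖])
          have e3 : s ^ (-(d / 2)) ≤ (ε ^ 2) ^ (-(d / 2)) :=
            Real.rpow_le_rpow_of_nonpos (by positivity)
              (by rw [hsdef]; nlinarith [sq_nonneg ‖x - x₀‖]) (by linarith)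
          calc s ^ (-(d / 2)) * (A + C * (ε ^ 2 / s)) ≤ (ε ^ 2) ^ (-(d / 2)) * (A + C * 1) := by
                gcongr
            _ = _ := by rw [mul_one]
        calc W x ^ p ≤ ((ε ^ 2) ^ (-(d / 2)) * (A + C)) ^ p := by
              gcongr
              exact hW0 x
          _ = _ := by
              rw [Real.mul_rpow (by positivity) (by positivity), hexp _ (by positivity),
                hsq _ hε0, mul_comm]
      · refine le_trans ?_ (le_trans (le_add_of_nonneg_left zero_le)
          (le_add_of_nonneg_right zero_le))
        have hx0 : 0 < ‖x - x₀‖ := lt_of_lt_of_le (by positivity) hx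
        have hxρ : ‖x - x₀‖ < ρ := by
          refine lt_of_pow_lt_pow_left₀ 2 hρ0.le ?_
          rw [hρ2]
          have : 0 < ε ^ 2 := by positivity
          linarith
        have hmem : x - x₀ ∈ ball (0 : E n) ρ \ ball 0 (R * ε) :=
          ⟨mem_ball_zero_iff.2 hxρ, fun h => hx.not_gt (mem_ball_zero_iff.1 h)⟩
        unfold annulusKer
        rw [indicator_of_mem hmem, powKer, ← ENNReal.ofReal_mul (by positivity)]
        refine ENNReal.ofReal_le_ofReal ?_
        have e1 : W x ≤ (‖x - x₀‖ ^ 2) ^ (-(d / 2)) * A' := by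
          refine (h1 x hss).trans ?_
          have e2 : ε ^ 2 / s ≤ 1 / R ^ 2 := by
            rw [div_le_div_iff₀ hs0 (by positivity), hsdef]
            have : (R * ε) ^ 2 ≤ ‖x - x₀‖ ^ 2 := by gcongr
            nlinarith
          have e3 : s ^ (-(d / 2)) ≤ (‖x - x₀‖ ^ 2) ^ (-(d / 2)) :=
            Real.rpow_le_rpow_of_nonpos (by positivity)
              (by rw [hsdef]; nlinarith) (by linarith)
          calc s ^ (-(d / 2)) * (A + C * (ε ^ 2 / s))
              ≤ (‖x - x₀‖ ^ 2) ^ (-(d / 2)) * (A + C * (1 / R ^ 2)) := by gcongr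
            _ ≤ _ := by
                gcongr
                rw [mul_one_div]
                linarith
        calc W x ^ p ≤ ((‖x - x₀‖ ^ 2) ^ (-(d / 2)) * A') ^ p := by
              gcongr
              exact hW0 x
          _ = _ := by
              rw [Real.mul_rpow (by positivity) (by positivity), hexp _ (by positivity),
                hsq _ hx0, mul_comm]
    · refine le_trans ?_ (le_add_of_nonneg_left zero_le)
      rcases le_or_gt s s₁ with hss' | hss'
      · have hxρ : ‖x - x₀‖ ≤ ρ := by
          refine le_of_sq_le_sq ?_ hρ0.le
          rw [hρ2]
          have : 0 < ε ^ 2 := by positivity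
          linarith
        rw [indicator_of_mem (mem_closedBall_iff_norm.2 hxρ)]
        refine ENNReal.ofReal_le_ofReal ?_
        have : W x ≤ M := (h2 x).resolve_right (not_lt.2 hss)
        gcongr
        exact hW0 x
      · rw [h3 x hss', Real.zero_rpow hp.ne', ENNReal.ofReal_zero]
        exact zero_le
  have hlog : 0 ≤ Real.log (ρ / (R * ε)) :=
    Real.log_nonneg ((one_le_div (by positivity)).2 hRε)
  calc ∫⁻ x, ENNReal.ofReal (W x) ^ p
      ≤ ∫⁻ x, ((ball x₀ (R * ε)).indicator
          (fun _ => ENNReal.ofReal ((A + C) ^ p * ε ^ (-(n : ℝ)))) x +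
        ENNReal.ofReal (A' ^ p) * annulusKer n (R * ε) ρ (x - x₀) +
        (closedBall x₀ ρ).indicator (fun _ => ENNReal.ofReal (M ^ p)) x) := lintegral_mono hpt
    _ = ENNReal.ofReal ((A + C) ^ p * ε ^ (-(n : ℝ))) * volume (ball x₀ (R * ε)) +
        ENNReal.ofReal (A' ^ p) * ENNReal.ofReal (sphereArea n * Real.log (ρ / (R * ε))) +
        ENNReal.ofReal (M ^ p) * volume (closedBall x₀ ρ) := by
      rw [lintegral_add_right _ (measurable_const.indicator measurableSet_closedBall),
        lintegral_add_left (measurable_const.indicator measurableSet_ball),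
        lintegral_indicator_const measurableSet_ball,
        lintegral_indicator_const measurableSet_closedBall,
        lintegral_const_mul' _ _ ENNReal.ofReal_ne_top,
        lintegral_sub_right_eq_self (fun x => annulusKer n (R * ε) ρ x) x₀,
        lintegral_annulusKer hn (by positivity) hRε]
    _ = _ := by
      rw [volume_ball_le x₀ (by positivity), ← hv,
        ← ENNReal.ofReal_toReal (measure_closedBall_lt_top (x := x₀) (r := ρ)).ne,
        ← measureReal_def, ← hV,
        ← ENNReal.ofReal_mul (by positivity), ← ENNReal.ofReal_mul (by positivity),
        ← ENNReal.ofReal_mul (by positivity), ← ENNReal.ofReal_add (by positivity)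
          (by positivity), ← ENNReal.ofReal_add (by positivity) (by positivity)]
      congr 1
      have e1 : (R * ε) ^ (n : ℝ) = R ^ (n : ℝ) * ε ^ (n : ℝ) :=
        Real.mul_rpow hR0.le hε0.le
      have e2 : ε ^ (-(n : ℝ)) * ε ^ (n : ℝ) = 1 := by
        rw [← Real.rpow_add hε0, neg_add_cancel, Real.rpow_zero]
      have e3 : Real.log (ρ / (R * ε)) = Real.log (ρ / R) + Real.log (1 / ε) := by
        rw [← Real.log_mul (by positivity) (by positivity)]
        congr 1
        field_simp
      rw [e1, e3]
      linear_combination (A + C) ^ p * v * R ^ (n : ℝ) * e2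

/-- A concentrating family shows that the exponential integral is unbounded above the critical
constant. -/
theorem not_exists_expIntegral_le {n : ℕ} (hn : 0 < n) {p q : ℝ} (hpq : q.HolderConjugate p)
    {F : Type*} [NormedAddCommGroup F]
    {Ω : Set (E n)} {ν : Measure (E n)} {lam κ A c : ℝ}
    (hκ : 0 < κ) (hA : 0 < A) (hκA : κ * A * sphereArea n = 1)
    {x₀ : E n} (hν : ∃ C₁ r₁ : ℝ, 0 < C₁ ∧ 0 < r₁ ∧ ∀ r : ℝ, 0 < r → r ≤ r₁ →
      ENNReal.ofReal (C₁ * r ^ lam) ≤ ν (ball x₀ r ∩ Ω)) (hΩm : MeasurableSet Ω)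
    {u : ℝ → E n → ℝ} {G : ℝ → E n → F}
    (hu : ∀ᶠ ε in 𝓝[>] (0 : ℝ), ∀ x ∈ ball x₀ ε, Real.log (1 / ε) - c ≤ preciseRep (u ε) x)
    (hpos : ∀ᶠ ε in 𝓝[>] (0 : ℝ), 0 < lpNormOn Ω (ENNReal.ofReal p) (G ε))
    (hG : ∀ A', A < A' → ∃ K : ℝ, ∀ᶠ ε in 𝓝[>] (0 : ℝ),
      lpNormOn Ω (ENNReal.ofReal p) (G ε) ^ p ≤ A' ^ p * sphereArea n * Real.log (1 / ε) + K)
    {α : ℝ} (hα : lam * κ ^ (-q) / sphereArea n < α) (hα0 : 0 < α) (C : ℝ) :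
    ∀ᶠ ε in 𝓝[>] (0 : ℝ), ENNReal.ofReal C <
      expIntegral Ω ν α q (u ε) (lpNormOn Ω (ENNReal.ofReal p) (G ε)) := by
  have hw0 := sphereArea_pos hn
  set w := sphereArea n with hw
  have hq := hpq.pos
  have hp := hpq.symm.pos
  obtain ⟨C₁, r₁, hC₁, hr₁, hν⟩ := hν
  obtain ⟨A', hAA', hA'⟩ : ∃ A', A < A' ∧ lam < α * (1 / (A' ^ p * w)) ^ (q - 1) := by
    have hlim : Tendsto (fun A' : ℝ => α * (1 / (A' ^ p * w)) ^ (q - 1)) (𝓝[>] A)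
        (𝓝 (α * (1 / (A ^ p * w)) ^ (q - 1))) := by
      have : ContinuousAt (fun A' : ℝ => α * (1 / (A' ^ p * w)) ^ (q - 1)) A := by
        refine continuousAt_const.mul (ContinuousAt.rpow_const ?_ (Or.inl (by positivity)))
        refine continuousAt_const.div ?_ (by positivity)
        exact (continuousAt_id.rpow_const (Or.inl hA.ne')).mul continuousAt_const
      exact this.tendsto.mono_left nhdsWithin_le_nhds
    have hlt : lam < α * (1 / (A ^ p * w)) ^ (q - 1) := by
      have e1 : (1 / (A ^ p * w)) ^ (q - 1) = κ ^ q * w := by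
        have hκe : κ = 1 / (A * w) := by
          field_simp
          linarith
        have e2 : p * (q - 1) = q := by
          have := hpq.symm.sub_one_mul_conj
          have := hpq.sub_one_mul_conj
          linarith
        rw [Real.div_rpow zero_le_one (by positivity), Real.one_rpow,
          Real.mul_rpow (by positivity) hw0.le, ← Real.rpow_mul hA.le, e2, hκe,
          Real.div_rpow zero_le_one (by positivity), Real.one_rpow,
          Real.mul_rpow hA.le hw0.le, Real.rpow_sub_one hw0.ne']
        have : w ^ q ≠ 0 := (Real.rpow_pos_of_pos hw0 q).ne'
        field_simp
      rw [e1]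
      rw [div_lt_iff₀ hw0, Real.rpow_neg hκ.le, ← div_eq_mul_inv,
        div_lt_iff₀ (Real.rpow_pos_of_pos hκ q)] at hα
      linarith
    obtain ⟨A', h1, h2⟩ := ((hlim.eventually (lt_mem_nhds hlt)).and self_mem_nhdsWithin).exists
    exact ⟨A', h2, h1⟩
  obtain ⟨K, hK⟩ := hG A' hAA'
  have hA'0 : 0 < A' := hA.trans hAA'
  set a := A' ^ p * w with ha
  have ha0 : 0 < a := by positivity
  have hT : Tendsto (fun ε : ℝ => Real.log (1 / ε)) (𝓝[>] 0) atTop := by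
    have := Real.tendsto_log_atTop.comp tendsto_inv_nhdsGT_zero
    simpa [Function.comp_def] using this
  -- the exponent, as a function of `T = log (1/ε)`
  have hexp : Tendsto (fun T : ℝ => C₁ * Real.exp (T * (α *
      (((T - c) / T) ^ q * (T / (a * T + K)) ^ (q - 1)) - lam))) atTop atTop := by
    have l0 : ∀ b : ℝ, Tendsto (fun T : ℝ => b / T) atTop (𝓝 0) := fun b =>
      tendsto_const_nhds.div_atTop tendsto_id
    have l1 : Tendsto (fun T : ℝ => (T - c) / T) atTop (𝓝 1) := by
      have := (tendsto_const_nhds (x := (1 : ℝ))).sub (l0 c)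
      rw [sub_zero] at this
      refine this.congr' ?_
      filter_upwards [eventually_gt_atTop 0] with T hT
      field_simp
    have l2 : Tendsto (fun T : ℝ => T / (a * T + K)) atTop (𝓝 (1 / a)) := by
      have := (tendsto_const_nhds (x := a)).add (l0 K)
      rw [add_zero] at this
      refine ((tendsto_const_nhds (x := (1 : ℝ))).div this ha0.ne').congr' ?_
      filter_upwards [eventually_gt_atTop 0] with T hT
      have e : a * T + K = T * (a + K / T) := by field_simp
      rw [Pi.div_apply, e, div_mul_cancel_left₀ hT.ne', one_div]
    have l3 := ((l1.rpow_const (p := q) (Or.inl one_ne_zero)).mul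
      (l2.rpow_const (p := q - 1) (Or.inl (by positivity)))).const_mul α
    rw [Real.one_rpow, one_mul] at l3
    have l4 := l3.sub_const lam
    refine Tendsto.const_mul_atTop hC₁ (Real.tendsto_exp_atTop.comp ?_)
    exact tendsto_id.atTop_mul_pos (by linarith) l4
  have hfin := (hexp.comp hT).eventually (eventually_gt_atTop (max C 0))
  filter_upwards [hu, hpos, hK, hfin, hT.eventually (eventually_gt_atTop (max c 0)),
    Ioo_mem_nhdsGT hr₁] with ε h1 h2 h3 h4 h5 h6
  have hε0 : 0 < ε := h6.1
  set T := Real.log (1 / ε) with hTdef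
  have hT0 : 0 < T := (le_max_right _ _).trans_lt h5
  have hTc : 0 < T - c := sub_pos.2 ((le_max_left _ _).trans_lt h5)
  set N := lpNormOn Ω (ENNReal.ofReal p) (G ε) with hN
  have haK : 0 < a * T + K := (Real.rpow_pos_of_pos h2 p).trans_le h3
  set L := T * (α * (((T - c) / T) ^ q * (T / (a * T + K)) ^ (q - 1))) with hL
  have hkey : L ≤ α * ((T - c) / N) ^ q := by
    have e1 : N ^ q ≤ (a * T + K) ^ (q - 1) := by
      have : q = p * (q - 1) := by
        have := hpq.sub_one_mul_conj
        linarith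
      calc N ^ q = (N ^ p) ^ (q - 1) := by rw [← Real.rpow_mul h2.le, ← this]
        _ ≤ _ := by
          have : 0 ≤ q - 1 := by linarith [hpq.lt]
          gcongr
    calc L = α * ((T - c) ^ q / (a * T + K) ^ (q - 1)) := by
          rw [hL, Real.div_rpow hTc.le hT0.le, Real.div_rpow hT0.le haK.le,
            Real.rpow_sub_one hT0.ne']
          have : T ^ q ≠ 0 := (Real.rpow_pos_of_pos hT0 q).ne'
          field_simp
      _ ≤ α * ((T - c) ^ q / N ^ q) := by
          have := Real.rpow_pos_of_pos h2 q
          gcongr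
      _ = _ := by rw [Real.div_rpow hTc.le h2.le]
  calc ENNReal.ofReal C ≤ ENNReal.ofReal (max C 0) := ENNReal.ofReal_le_ofReal (le_max_left _ _)
    _ < ENNReal.ofReal (C₁ * Real.exp (L - lam * T)) := by
        rw [ENNReal.ofReal_lt_ofReal_iff (by positivity)]
        have e : L - lam * T = T * (α * (((T - c) / T) ^ q * (T / (a * T + K)) ^ (q - 1)) - lam) := by
          rw [hL]
          ring
        rw [e]
        exact h4
    _ = ENNReal.ofReal (Real.exp L) * ENNReal.ofReal (C₁ * ε ^ lam) := by
        rw [← ENNReal.ofReal_mul (by positivity)]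
        congr 1
        have : ε = Real.exp (-T) := by
          rw [hTdef, one_div, Real.log_inv, neg_neg, Real.exp_log hε0]
        rw [this, ← Real.exp_mul, sub_eq_add_neg, Real.exp_add]
        ring_nf
    _ ≤ ENNReal.ofReal (Real.exp L) * ν (ball x₀ ε ∩ Ω) := by
        gcongr
        exact hν ε hε0 h6.2.le
    _ = ∫⁻ _ in ball x₀ ε ∩ Ω, ENNReal.ofReal (Real.exp L) ∂ν := by
        rw [lintegral_const, Measure.restrict_apply_univ]
    _ ≤ ∫⁻ x in ball x₀ ε ∩ Ω,
          ENNReal.ofReal (Real.exp (α * (|preciseRep (u ε) x| / N) ^ q)) ∂ν := by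
        refine setLIntegral_mono' (measurableSet_ball.inter hΩm) fun x hx => ?_
        refine ENNReal.ofReal_le_ofReal (Real.exp_le_exp.2 (hkey.trans ?_))
        have := (h1 x hx.1).trans (le_abs_self _)
        gcongr
    _ ≤ _ := lintegral_mono_set inter_subset_right

theorem preciseRep_of_continuous {n : ℕ} {φ : E n → ℝ} (hφ : Continuous φ) (x : E n) :
    preciseRep φ x = φ x :=
  (tendsto_average_of_continuousAt one_pos fun _ _ => hφ.continuousAt).limUnder_eq

theorem lpNormOn_congr {n : ℕ} {F : Type*} [NormedAddCommGroup F] {Ω : Set (E n)} {p : ℝ≥0∞}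
    {f g : E n → F} (h : f =ᵐ[volume] g) : lpNormOn Ω p f = lpNormOn Ω p g := by
  rw [lpNormOn, lpNormOn, eLpNorm_congr_ae (ae_restrict_of_ae h)]

theorem lpNormOn_rpow_le {n : ℕ} {F : Type*} [NormedAddCommGroup F] {Ω : Set (E n)} {p : ℝ}
    (hp : 0 < p) {G : E n → F} {B : ℝ} (hB : 0 ≤ B)
    (h : ∫⁻ x, ENNReal.ofReal ‖G x‖ ^ p ≤ ENNReal.ofReal B) :
    lpNormOn Ω (ENNReal.ofReal p) G ^ p ≤ B := by
  have h1 : eLpNorm G (ENNReal.ofReal p) (volume.restrict Ω) ≤ ENNReal.ofReal B ^ (1 / p) := by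
    refine (eLpNorm_mono_measure _ Measure.restrict_le_self).trans ?_
    rw [eLpNorm_eq_lintegral_rpow_enorm_toReal (ENNReal.ofReal_pos.2 hp).ne'
      ENNReal.ofReal_ne_top, ENNReal.toReal_ofReal hp.le]
    simp only [ofReal_norm] at h
    gcongr
  rw [lpNormOn]
  have h2 : (eLpNorm G (ENNReal.ofReal p) (volume.restrict Ω)).toReal ≤ B ^ (1 / p) := by
    rw [ENNReal.ofReal_rpow_of_nonneg hB (by positivity)] at h1
    exact ENNReal.toReal_le_of_le_ofReal (by positivity) h1
  calc (eLpNorm G (ENNReal.ofReal p) (volume.restrict Ω)).toReal ^ p ≤ (B ^ (1 / p)) ^ p := by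
        gcongr
    _ = B := by rw [← Real.rpow_mul hB, one_div, inv_mul_cancel₀ hp.ne', Real.rpow_one]

theorem lpNormOn_pos_of_kerPot_ne_zero {n : ℕ} {F : Type*} [NormedAddCommGroup F]
    [MeasurableSpace F] {a p : ℝ} (hp : 0 < p) {k : E n → F → ℝ} (hk : IsRieszKernel a k)
    {Ω : Set (E n)} {G : E n → F} (hG : MemLp G (ENNReal.ofReal p) (volume.restrict Ω)) {x : E n}
    (h : kerPot k Ω G x ≠ 0) : 0 < lpNormOn Ω (ENNReal.ofReal p) G := by
  refine ENNReal.toReal_pos (fun h0 => h ?_) hG.2.ne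
  rw [eLpNorm_eq_zero_iff hG.1 (ENNReal.ofReal_pos.2 hp).ne'] at h0
  refine integral_eq_zero_of_ae ?_
  filter_upwards [h0] with y hy
  rw [hy]
  have := hk.bound (x - y) 0
  rw [norm_zero, mul_zero] at this
  simpa using this

theorem isTestFunction_cutLog {n : ℕ} {Ω : Set (E n)} {x₀ : E n} {s₀ ρ : ℝ} (hρ : 0 < ρ)
    (hΩ : closedBall x₀ ρ ⊆ Ω) (hs : s₀ < ρ ^ 2) {ε : ℝ} (hε : 0 < ε) :
    IsTestFunction Ω fun x => cutLog s₀ (ρ ^ 2) (‖x - x₀‖ ^ 2 + ε ^ 2) := by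
  have h1 : tsupport (fun x => cutLog s₀ (ρ ^ 2) (‖x - x₀‖ ^ 2 + ε ^ 2)) ⊆ closedBall x₀ ρ := by
    refine closure_minimal (fun x hx => ?_) isClosed_closedBall
    rw [mem_closedBall_iff_norm]
    by_contra! h
    refine hx (cutLog_of_ge hs ?_)
    have : ρ ^ 2 ≤ ‖x - x₀‖ ^ 2 := by gcongr
    nlinarith [sq_nonneg ε]
  exact ⟨contDiff_radial x₀ (by positivity) contDiffOn_cutLog,
    HasCompactSupport.of_support_subset_isCompact (isCompact_closedBall x₀ ρ)
      (subset_closure.trans h1), h1.trans hΩ⟩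

theorem le_cutLog {n : ℕ} {x₀ : E n} {s₀ s₁ : ℝ} (h : s₀ < s₁) {ε : ℝ} (hε : 0 < ε)
    (hε' : 2 * ε ^ 2 ≤ s₀) {x : E n} (hx : x ∈ ball x₀ ε) :
    Real.log (1 / ε) - 1 / 2 * Real.log 2 ≤ cutLog s₀ s₁ (‖x - x₀‖ ^ 2 + ε ^ 2) := by
  have hx' : ‖x - x₀‖ ^ 2 ≤ ε ^ 2 := by
    have := (mem_ball_iff_norm.1 hx).le
    gcongr
  rw [cutLog_of_le h (by linarith)]
  have h1 : Real.log (‖x - x₀‖ ^ 2 + ε ^ 2) ≤ Real.log (2 * ε ^ 2) :=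
    Real.log_le_log (by positivity) (by linarith)
  rw [Real.log_mul two_ne_zero (by positivity), Real.log_pow] at h1
  rw [one_div, Real.log_inv]
  push_cast at h1
  linarith

theorem cutLog_center_pos {n : ℕ} {x₀ : E n} {s₀ s₁ : ℝ} (h : s₀ < s₁) {ε : ℝ} (hε : 0 < ε)
    (hε' : 2 * ε ^ 2 ≤ s₀) (hε1 : ε < 1) : 0 < cutLog s₀ s₁ (‖x₀ - x₀‖ ^ 2 + ε ^ 2) := by
  rw [sub_self, norm_zero, cutLog_of_le h (by nlinarith [sq_nonneg ε])]
  have : Real.log (0 ^ 2 + ε ^ 2) < 0 := Real.log_neg (by positivity) (by nlinarith)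
  exact mul_pos_of_neg_of_neg (by norm_num) this

theorem exists_isProfile_deriv_iterate {n : ℕ} {s₀ s₁ : ℝ} (h : s₀ < s₁) (k : ℕ)
    (hkn : 2 * k + 1 < n) :
    ∃ Q, IsProfile s₀ s₁ (k + 1) Q
        (fun δ => deriv (((radLap n)^[k] fun _ => cutLog s₀ s₁) δ)) ∧
      gradRieszConst n (2 * k + 1) * (2 * |Q.eval 0|) * sphereArea n = 1 := by
  rcases Nat.eq_zero_or_pos k with rfl | hk
  · refine ⟨Polynomial.C (-(1 / 2)), by simpa using isProfile_deriv_cutLog h, ?_⟩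
    have := gradRieszConst_one (n := n) (by omega)
    rw [Polynomial.eval_C, abs_neg, abs_of_pos (by norm_num)]
    simpa using this
  · obtain ⟨j, rfl⟩ : ∃ j, k = j + 1 := ⟨k - 1, by omega⟩
    obtain ⟨P, hP, hP0⟩ := exists_isProfile_iterate (n := n) h j (by omega)
    refine ⟨_, by push_cast; exact hP.deriv, ?_⟩
    have h1 := gradRieszConst_mul (n := n) (k := j + 1) (by omega)
    have h2 := rieszConst_pos (n := n) (k := j + 1) (by omega) (by omega)
    have h3 := sphereArea_pos (n := n) (by omega)
    have hpos : 0 < P.eval 0 := by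
      by_contra! hle
      have : rieszConst n (2 * (j + 1 : ℕ)) * P.eval 0 * sphereArea n ≤ 0 :=
        mul_nonpos_of_nonpos_of_nonneg (mul_nonpos_of_nonneg_of_nonpos h2.le hle) h3.le
      linarith
    have h4 : (-(Polynomial.C (((j : ℤ) + 1 : ℤ) : ℝ) * P +
        Polynomial.X * Polynomial.derivative P)).eval 0 = -((j + 1) * P.eval 0) := by
      simp
    rw [h4, abs_neg, abs_of_pos (by positivity)]
    rw [← h1] at hP0
    push_cast at hP0 ⊢
    linear_combination hP0

theorem not_exists_even {n k : ℕ} (hk : 0 < k) (hkn : 2 * k < n) {p q : ℝ}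
    (hpq : q.HolderConjugate p) (hdp : (2 * k : ℝ) * p = n) {Ω : Set (E n)} (hΩ : IsOpen Ω)
    {ν : Measure (E n)} {lam : ℝ} (hlam : 0 < lam) {x₀ : E n} (hx₀ : x₀ ∈ Ω)
    (hν : ∃ C₁ r₁ : ℝ, 0 < C₁ ∧ 0 < r₁ ∧ ∀ r : ℝ, 0 < r → r ≤ r₁ →
      ENNReal.ofReal (C₁ * r ^ lam) ≤ ν (ball x₀ r ∩ Ω)) {α : ℝ}
    (hα : lam * rieszConst n (2 * k) ^ (-q) / sphereArea n < α) (C : ℝ) :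
    ∃ u, MemSobolevZero Ω (2 * k) (ENNReal.ofReal p) u ∧ ENNReal.ofReal C <
      expIntegral Ω ν α q u (lpNormOn Ω (ENNReal.ofReal p) (posLaplacian^[k] u)) := by
  have hn : 0 < n := by omega
  have hp := hpq.symm.pos
  have hω := sphereArea_pos hn
  have hκ := rieszConst_pos hk hkn
  have hk0 : (0 : ℝ) < k := by exact_mod_cast hk
  obtain ⟨ρ, hρ, hρΩ⟩ := Metric.nhds_basis_closedBall.mem_iff.1 (hΩ.mem_nhds hx₀)
  set s₀ := ρ ^ 2 / 2 with hs₀def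
  have hs₀ : 0 < s₀ := by positivity
  have hs : s₀ < ρ ^ 2 := half_lt_self (by positivity)
  set u : ℝ → E n → ℝ := fun ε x => cutLog s₀ (ρ ^ 2) (‖x - x₀‖ ^ 2 + ε ^ 2) with hu
  have htest : ∀ ε, 0 < ε → IsTestFunction Ω (u ε) := fun ε hε =>
    isTestFunction_cutLog hρ hρΩ hs hε
  have hsmall : ∀ᶠ ε in 𝓝[>] (0 : ℝ), 0 < ε ∧ ε < 1 ∧ 2 * ε ^ 2 ≤ s₀ := by
    have h1 : Tendsto (fun ε : ℝ => 2 * ε ^ 2) (𝓝[>] 0) (𝓝 (2 * 0 ^ 2)) :=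
      ((continuous_const.mul (continuous_pow 2)).tendsto 0).mono_left nhdsWithin_le_nhds
    filter_upwards [Ioo_mem_nhdsGT one_pos, h1.eventually (ge_mem_nhds (by simpa using hs₀))]
      with ε h2 h3 using ⟨h2.1, h2.2, h3⟩
  obtain ⟨j, rfl⟩ : ∃ j, k = j + 1 := ⟨k - 1, by omega⟩
  obtain ⟨Q, hQ, hQ0⟩ := exists_isProfile_iterate (n := n) hs j (by omega)
  obtain ⟨B, M, hB, hM, hbound⟩ := hQ.exists_bound hs₀
  have hA : 0 < Q.eval 0 := by
    by_contra! hle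
    have : rieszConst n (2 * (j + 1 : ℕ)) * Q.eval 0 * sphereArea n ≤ 0 :=
      mul_nonpos_of_nonpos_of_nonneg (mul_nonpos_of_nonneg_of_nonpos hκ.le hle) hω.le
    linarith
  have hev := not_exists_expIntegral_le hn hpq (u := u) (G := fun ε => cLap^[j + 1] (u ε))
    (c := 1 / 2 * Real.log 2) hκ hA hQ0 hν hΩ.measurableSet ?_ ?_ ?_ hα
    (lt_of_le_of_lt (by positivity) hα) C
  · obtain ⟨ε, h1, h2⟩ := (hev.and hsmall).exists
    refine ⟨u ε, (htest ε h2.1).memSobolevZero _ _, ?_⟩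
    rwa [lpNormOn_congr (iterate_posLaplacian_ae_cLap (htest ε h2.1) (j + 1))]
  · filter_upwards [hsmall] with ε hε x hx
    rw [preciseRep_of_continuous (htest ε hε.1).continuous]
    exact le_cutLog hs hε.1 hε.2.2 hx
  · filter_upwards [hsmall] with ε hε
    refine lpNormOn_pos_of_kerPot_ne_zero hp (isRieszKernel_scalar ((n : ℝ) - 2 * (j + 1 : ℕ)))
      ((((htest ε hε.1).iterate_cLap (j + 1)).memLp _).restrict Ω) (x := x₀) fun h0 => ?_
    have h1 := (htest ε hε.1).eq_kerPot_even (k := j + 1) hk hkn rfl x₀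
    rw [h0, mul_zero] at h1
    exact (cutLog_center_pos (x₀ := x₀) hs hε.1 hε.2.2 hε.2.1).ne' h1
  · intro A' hA'
    obtain ⟨K, hK⟩ := exists_lintegral_radial_le hn (by positivity) hp hdp hA.le hB hM hs₀ hs hA' x₀
    refine ⟨max K 0, ?_⟩
    filter_upwards [hK, hsmall] with ε h1 hε
    have hlog : 0 ≤ Real.log (1 / ε) :=
      Real.log_nonneg ((one_le_div hε.1).2 hε.2.1.le)
    have hA'0 : 0 < A' := hA.trans hA'
    refine lpNormOn_rpow_le hp (add_nonneg (by positivity) (le_max_right _ _))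
      ((h1 (fun x => ‖cLap^[j + 1] (u ε) x‖) (fun x => norm_nonneg _) ?_ ?_ ?_).trans
        (ENNReal.ofReal_le_ofReal (by gcongr; exact le_max_left _ _)))
    all_goals
      have hε2 : 0 < ε ^ 2 := pow_pos hε.1 2
      have hε21 : ε ^ 2 ≤ 1 := pow_le_one₀ hε.1.le hε.2.1.le
      have heq : cLap^[j + 1] (u ε) = fun x => _ :=
        iterate_cLap_radial x₀ hs hε2 (j + 1) hkn
      intro x
      simp only [heq, Real.norm_eq_abs]
    · intro hx
      refine ((hbound _ _ hε2 hε21 (le_add_of_nonneg_left (sq_nonneg _))).1 hx).trans (le_of_eq ?_)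
      rw [abs_of_pos hA, ← Real.rpow_intCast]
      congr 2
      push_cast
      ring
    · rcases lt_or_ge (‖x - x₀‖ ^ 2 + ε ^ 2) s₀ with h | h
      · exact Or.inr h
      · exact Or.inl ((hbound _ _ hε2 hε21 (le_add_of_nonneg_left (sq_nonneg _))).2 h)
    · intro hx
      rw [hQ.far _ _ hx, abs_zero]

theorem norm_cGrad_radial {n : ℕ} (x₀ : E n) {δ : ℝ} (hδ : 0 < δ) {F : ℝ → ℝ}
    (hF : ContDiffOn ℝ ∞ F (Ioi 0)) (x : E n) :
    ‖cGrad (fun x => F (‖x - x₀‖ ^ 2 + δ)) x‖ =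
      2 * ‖x - x₀‖ * |deriv F (‖x - x₀‖ ^ 2 + δ)| := by
  have : cGrad (fun x => F (‖x - x₀‖ ^ 2 + δ)) x =
      (2 * deriv F (‖x - x₀‖ ^ 2 + δ)) • (x - x₀) := by
    ext i
    rw [cGrad, PiLp.smul_apply, PiLp.sub_apply, smul_eq_mul]
    simp only [pd_radial x₀ hδ hF]
    ring
  rw [this, norm_smul, Real.norm_eq_abs, abs_mul, abs_two]
  ring

theorem not_exists_odd {n k : ℕ} (hkn : 2 * k + 1 < n) {p q : ℝ}
    (hpq : q.HolderConjugate p) (hdp : (2 * k + 1 : ℝ) * p = n) {Ω : Set (E n)} (hΩ : IsOpen Ω)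
    {ν : Measure (E n)} {lam : ℝ} (hlam : 0 < lam) {x₀ : E n} (hx₀ : x₀ ∈ Ω)
    (hν : ∃ C₁ r₁ : ℝ, 0 < C₁ ∧ 0 < r₁ ∧ ∀ r : ℝ, 0 < r → r ≤ r₁ →
      ENNReal.ofReal (C₁ * r ^ lam) ≤ ν (ball x₀ r ∩ Ω)) {α : ℝ}
    (hα : lam * gradRieszConst n (2 * k + 1) ^ (-q) / sphereArea n < α) (C : ℝ) :
    ∃ u, MemSobolevZero Ω (2 * k + 1) (ENNReal.ofReal p) u ∧ ENNReal.ofReal C <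
      expIntegral Ω ν α q u
        (lpNormOn Ω (ENNReal.ofReal p) (weakGradient (posLaplacian^[k] u))) := by
  have hn : 0 < n := by omega
  have hp := hpq.symm.pos
  have hω := sphereArea_pos hn
  have hκ := gradRieszConst_pos hkn
  obtain ⟨ρ, hρ, hρΩ⟩ := Metric.nhds_basis_closedBall.mem_iff.1 (hΩ.mem_nhds hx₀)
  set s₀ := ρ ^ 2 / 2 with hs₀def
  have hs₀ : 0 < s₀ := by positivity
  have hs : s₀ < ρ ^ 2 := half_lt_self (by positivity)
  set u : ℝ → E n → ℝ := fun ε x => cutLog s₀ (ρ ^ 2) (‖x - x₀‖ ^ 2 + ε ^ 2) with hu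
  have htest : ∀ ε, 0 < ε → IsTestFunction Ω (u ε) := fun ε hε =>
    isTestFunction_cutLog hρ hρΩ hs hε
  have hsmall : ∀ᶠ ε in 𝓝[>] (0 : ℝ), 0 < ε ∧ ε < 1 ∧ 2 * ε ^ 2 ≤ s₀ := by
    have h1 : Tendsto (fun ε : ℝ => 2 * ε ^ 2) (𝓝[>] 0) (𝓝 (2 * 0 ^ 2)) :=
      ((continuous_const.mul (continuous_pow 2)).tendsto 0).mono_left nhdsWithin_le_nhds
    filter_upwards [Ioo_mem_nhdsGT one_pos, h1.eventually (ge_mem_nhds (by simpa using hs₀))]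
      with ε h2 h3 using ⟨h2.1, h2.2, h3⟩
  obtain ⟨Q, hQ, hQ0⟩ := exists_isProfile_deriv_iterate (n := n) hs k hkn
  obtain ⟨B, M, hB, hM, hbound⟩ := hQ.exists_bound hs₀
  have hA : 0 < 2 * |Q.eval 0| := by
    refine lt_of_le_of_ne (by positivity) fun h => ?_
    rw [← h] at hQ0
    simp at hQ0
  have hev := not_exists_expIntegral_le hn hpq (u := u) (G := fun ε => cGrad (cLap^[k] (u ε)))
    (c := 1 / 2 * Real.log 2) hκ hA hQ0 hν hΩ.measurableSet ?_ ?_ ?_ hα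
    (lt_of_le_of_lt (by positivity) hα) C
  · obtain ⟨ε, h1, h2⟩ := (hev.and hsmall).exists
    refine ⟨u ε, (htest ε h2.1).memSobolevZero _ _, ?_⟩
    rwa [weakGradient_congr (iterate_posLaplacian_ae_cLap (htest ε h2.1) k),
      lpNormOn_congr (weakGradient_ae_cGrad ((htest ε h2.1).iterate_cLap k).1)]
  · filter_upwards [hsmall] with ε hε x hx
    rw [preciseRep_of_continuous (htest ε hε.1).continuous]
    exact le_cutLog hs hε.1 hε.2.2 hx
  · filter_upwards [hsmall] with ε hε
    have hT := (htest ε hε.1).iterate_cLap k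
    have hcs : HasCompactSupport (cGrad (cLap^[k] (u ε))) := by
      refine HasCompactSupport.intro hT.2.1 fun x hx => ?_
      exact (show IsTestFunction (tsupport (cLap^[k] (u ε))) _ from
        ⟨hT.1, hT.2.1, subset_rfl⟩).cGrad_eq_zero hx
    refine lpNormOn_pos_of_kerPot_ne_zero hp (isRieszKernel_vector ((n : ℝ) - (2 * k + 1)))
      ((hT.continuous_cGrad.memLp_of_hasCompactSupport hcs).restrict Ω) (x := x₀) fun h0 => ?_
    have h1 := (htest ε hε.1).eq_kerPot_odd hkn rfl x₀
    rw [h0, mul_zero] at h1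
    exact (cutLog_center_pos (x₀ := x₀) hs hε.1 hε.2.2 hε.2.1).ne' h1
  · intro A' hA'
    obtain ⟨K, hK⟩ := exists_lintegral_radial_le hn (by positivity) hp hdp hA.le
      (show 0 ≤ 2 * B by positivity) (show 0 ≤ 2 * ρ * M by positivity) hs₀ hs hA' x₀
    refine ⟨max K 0, ?_⟩
    filter_upwards [hK, hsmall] with ε h1 hε
    have hlog : 0 ≤ Real.log (1 / ε) :=
      Real.log_nonneg ((one_le_div hε.1).2 hε.2.1.le)
    have hA'0 : 0 < A' := hA.trans hA'
    refine lpNormOn_rpow_le hp (add_nonneg (by positivity) (le_max_right _ _))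
      ((h1 (fun x => ‖cGrad (cLap^[k] (u ε)) x‖) (fun x => norm_nonneg _) ?_ ?_ ?_).trans
        (ENNReal.ofReal_le_ofReal (by gcongr; exact le_max_left _ _)))
    all_goals
      have hε2 : 0 < ε ^ 2 := pow_pos hε.1 2
      have hε21 : ε ^ 2 ≤ 1 := pow_le_one₀ hε.1.le hε.2.1.le
      have hsm : ContDiffOn ℝ ∞ (((radLap n)^[k] fun _ => cutLog s₀ (ρ ^ 2)) (ε ^ 2)) (Ioi 0) := by
        rcases Nat.eq_zero_or_pos k with rfl | hk
        · exact contDiffOn_cutLog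
        · obtain ⟨j, rfl⟩ : ∃ j, k = j + 1 := ⟨k - 1, by omega⟩
          obtain ⟨P, hP, -⟩ := exists_isProfile_iterate (n := n) hs j (by omega)
          exact hP.contDiffOn _
      have heq : cLap^[k] (u ε) = fun x => _ :=
        iterate_cLap_radial x₀ hs hε2 k (by omega)
      intro x
      have hgr : ‖cGrad (cLap^[k] (u ε)) x‖ = 2 * ‖x - x₀‖ *
          |deriv (((radLap n)^[k] fun _ => cutLog s₀ (ρ ^ 2)) (ε ^ 2)) (‖x - x₀‖ ^ 2 + ε ^ 2)| := by
        rw [heq]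
        exact norm_cGrad_radial x₀ hε2 hsm x
      simp only [hgr]
      have hs0 : 0 < ‖x - x₀‖ ^ 2 + ε ^ 2 := by positivity
    · intro hx
      have h2 := (hbound _ _ hε2 hε21 (le_add_of_nonneg_left (sq_nonneg ‖x - x₀‖))).1 hx
      have h3 : ‖x - x₀‖ ≤ (‖x - x₀‖ ^ 2 + ε ^ 2) ^ (1 / 2 : ℝ) := by
        rw [← Real.sqrt_eq_rpow]
        exact Real.le_sqrt_of_sq_le (by linarith)
      set s := ‖x - x₀‖ ^ 2 + ε ^ 2 with hsdef
      calc 2 * ‖x - x₀‖ * |deriv (((radLap n)^[k] fun _ => cutLog s₀ (ρ ^ 2)) (ε ^ 2)) s|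
          ≤ 2 * s ^ (1 / 2 : ℝ) *
              (s ^ (-((k : ℤ) + 1)) * (|Q.eval 0| + B * (ε ^ 2 / s))) := by gcongr
        _ = (s ^ (1 / 2 : ℝ) * s ^ (((-((k : ℤ) + 1) : ℤ) : ℝ))) *
              (2 * |Q.eval 0| + 2 * B * (ε ^ 2 / s)) := by
            rw [Real.rpow_intCast]
            ring
        _ = _ := by
            rw [← Real.rpow_add hs0]
            congr 2
            push_cast
            ring
    · rcases lt_or_ge (‖x - x₀‖ ^ 2 + ε ^ 2) s₀ with h | h
      · exact Or.inr h
      · refine Or.inl ?_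
        rcases le_or_gt (‖x - x₀‖ ^ 2 + ε ^ 2) (ρ ^ 2) with h' | h'
        · have hxρ : ‖x - x₀‖ ≤ ρ := le_of_sq_le_sq (by linarith) hρ.le
          have := (hbound _ _ hε2 hε21 (le_add_of_nonneg_left (sq_nonneg ‖x - x₀‖))).2 h
          gcongr
        · rw [hQ.far _ _ h', abs_zero, mul_zero]
          positivity
    · intro hx
      rw [hQ.far _ _ hx, abs_zero, mul_zero]

theorem theorem6 (n d : ℕ) (hn : 3 ≤ n) (hd : 0 < d) (hdn : d < n)
    (p p' : ℝ) (hp : p = (n : ℝ) / d) (hp' : 1 / p + 1 / p' = 1)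
    (Ω : Set (E n)) (hΩ : IsOpen Ω) (hΩb : Bornology.IsBounded Ω)
    (ν : Measure (E n)) (lam : ℝ) (hlam : 0 < lam) (hlam' : lam ≤ n)
    (hν : ∃ C r₀ : ℝ, 0 < r₀ ∧ ∀ (x : E n) (r : ℝ), 0 < r → r ≤ r₀ →
      ν (ball x r ∩ Ω) ≤ ENNReal.ofReal (C * r ^ lam)) :
    -- functions in the Sobolev space have a well-defined value `ν`-almost everywhere on `Ω`
    (∀ u : E n → ℝ, MemSobolevZero Ω d (ENNReal.ofReal p) u →
      ∀ᵐ x ∂(ν.restrict Ω), Tendsto (ballAverage u x) (𝓝[>] 0) (𝓝 (preciseRep u x))) ∧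
    -- the inequality and its sharpness, `d` even
    (Even d →
      (∃ C : ℝ, ∀ u : E n → ℝ, MemSobolevZero Ω d (ENNReal.ofReal p) u →
        expIntegral Ω ν (lam * rieszConst n d ^ (-p') / sphereArea n) p' u
          (lpNormOn Ω (ENNReal.ofReal p) (posLaplacian^[d / 2] u)) ≤ ENNReal.ofReal C) ∧
      ((∃ x₀ ∈ Ω, ∃ C₁ r₁ : ℝ, 0 < C₁ ∧ 0 < r₁ ∧ ∀ r : ℝ, 0 < r → r ≤ r₁ →
          ENNReal.ofReal (C₁ * r ^ lam) ≤ ν (ball x₀ r ∩ Ω)) →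
        ∀ α : ℝ, lam * rieszConst n d ^ (-p') / sphereArea n < α →
          ¬ ∃ C : ℝ, ∀ u : E n → ℝ, MemSobolevZero Ω d (ENNReal.ofReal p) u →
            expIntegral Ω ν α p' u
              (lpNormOn Ω (ENNReal.ofReal p) (posLaplacian^[d / 2] u)) ≤ ENNReal.ofReal C)) ∧
    -- the inequality and its sharpness, `d` odd
    (Odd d →
      (∃ C : ℝ, ∀ u : E n → ℝ, MemSobolevZero Ω d (ENNReal.ofReal p) u →
        expIntegral Ω ν (lam / sphereArea n * gradRieszConst n d ^ (-p')) p' u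
          (lpNormOn Ω (ENNReal.ofReal p) (weakGradient (posLaplacian^[(d - 1) / 2] u)))
            ≤ ENNReal.ofReal C) ∧
      ((∃ x₀ ∈ Ω, ∃ C₁ r₁ : ℝ, 0 < C₁ ∧ 0 < r₁ ∧ ∀ r : ℝ, 0 < r → r ≤ r₁ →
          ENNReal.ofReal (C₁ * r ^ lam) ≤ ν (ball x₀ r ∩ Ω)) →
        ∀ α : ℝ, lam / sphereArea n * gradRieszConst n d ^ (-p') < α →
          ¬ ∃ C : ℝ, ∀ u : E n → ℝ, MemSobolevZero Ω d (ENNReal.ofReal p) u →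
            expIntegral Ω ν α p' u
              (lpNormOn Ω (ENNReal.ofReal p) (weakGradient (posLaplacian^[(d - 1) / 2] u)))
                ≤ ENNReal.ofReal C)) := by
  have hn0 : (0 : ℝ) < n := by
    have : 0 < n := by omega
    exact_mod_cast this
  have hd0 : (0 : ℝ) < d := by exact_mod_cast hd
  have hdn' : (d : ℝ) < n := by exact_mod_cast hdn
  have hp1 : 1 < p := by
    rw [hp, one_lt_div hd0]
    exact hdn'
  have hpq : p'.HolderConjugate p :=
    (Real.holderConjugate_iff.2 ⟨hp1, by simpa only [one_div] using hp'⟩).symm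
  have hdp : (d : ℝ) * p = n := by
    rw [hp]
    field_simp
  have hnq : (n : ℝ) / p' = n - d := by
    have h1 : 1 / p' = 1 - 1 / p := by linarith
    have h2 : 1 / p = d / n := by rw [hp, one_div_div]
    rw [div_eq_mul_one_div, h1, h2]
    field_simp
  have hn3 : 0 < n := by omega
  rcases Nat.even_or_odd d with he | ho
  · obtain ⟨k, rfl⟩ : ∃ k, d = 2 * k := by
      obtain ⟨k, hk⟩ := he
      exact ⟨k, by omega⟩
    have hk : 0 < k := by omega
    push_cast at hdp hnq
    obtain ⟨C, hC⟩ := exists_expIntegral_le hn3 hpq (isRieszKernel_scalar (n := n) (n / p'))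
      (rieszConst_pos hk hdn) hΩ hΩb hlam hν
    have hmain := fun (u : E n → ℝ) (hu : MemSobolevZero Ω (2 * k) (ENNReal.ofReal p) u) =>
      hC u (posLaplacian^[k] u) hu.1.1
        ((MemSobolev.iterate_posLaplacian (d := 0) (by simpa using hu.1)).1.restrict Ω)
        (fun ε hε => hu.exists_potential_even hk hdn hp1.le hnq hε)
    refine ⟨fun u hu => (hmain u hu).1, fun _ => ?_,
      fun ho => absurd ho (Nat.not_odd_iff_even.2 (even_two_mul k))⟩
    rw [Nat.mul_div_cancel_left k two_pos]
    push_cast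
    refine ⟨⟨C, fun u hu => (hmain u hu).2⟩, ?_⟩
    rintro ⟨x₀, hx₀, hlow⟩ α hα ⟨C', hC'⟩
    obtain ⟨u, hu, hlt⟩ := not_exists_even hk hdn hpq hdp hΩ hlam hx₀ hlow hα C'
    exact (hC' u hu).not_gt hlt
  · obtain ⟨k, rfl⟩ := ho
    push_cast at hdp hnq
    obtain ⟨C, hC⟩ := exists_expIntegral_le hn3 hpq (isRieszKernel_vector (n := n) (n / p'))
      (gradRieszConst_pos hdn) hΩ hΩb hlam hν
    have hmain := fun (u : E n → ℝ) (hu : MemSobolevZero Ω (2 * k + 1) (ENNReal.ofReal p) u) =>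
      hC u (weakGradient (posLaplacian^[k] u)) hu.1.1
        ((MemSobolev.iterate_posLaplacian (d := 1)
          (by simpa [add_comm] using hu.1)).memLp_weakGradient.restrict Ω)
        (fun ε hε => hu.exists_potential_odd hdn hp1.le hnq hε)
    refine ⟨fun u hu => (hmain u hu).1,
      fun he => absurd he (Nat.not_even_iff_odd.2 (odd_two_mul_add_one k)), fun _ => ?_⟩
    rw [Nat.add_sub_cancel, Nat.mul_div_cancel_left k two_pos]
    push_cast
    simp only [div_mul_eq_mul_div]
    refine ⟨⟨C, fun u hu => (hmain u hu).2⟩, ?_⟩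
    rintro ⟨x₀, hx₀, hlow⟩ α hα ⟨C', hC'⟩
    obtain ⟨u, hu, hlt⟩ := not_exists_odd hdn hpq hdp hΩ hlam hx₀ hlow hα C'
    exact (hC' u hu).not_gt hlt

end
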